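/- **Conventions.** Logarithms are natural. $\Lambda_{a,b}(x)=x^b\log^a x$. $f=\tilde O(g)$ means $f=O(g\log^k g)$ for some $k>0$; $f=\tilde\Omega(g)$ means $f\ge C\,|g\log^k g|$ eventually, for some $C>0$, $k\in\mathbb R$; $f=\tilde\Theta(g)$ means both. $f=\Delta(L)$ means $f=O(L^{-k})$ for every $k\ge 1$. For random variables $U,V$, the event $\{U\Rrightarrow V\}$ ("$U$ determines $V$") is the set of outcomes $\omega$ such that, conditionally on $U=U(\omega)$, almost surely $V=V(\omega)$. **Marked processes.** A marked process $X\sim(A^{\mathbb Z},\mu,a)$ is a stationary irreducible aperiodic Markov process of memory one on a finite alphabet $A$, with a renewal state $a\in A$ for which there is $c<1$ such that for all $n\ge1$ and $w\in(A\setminus\{a\})^n$ the probability of $X_{[0,n+1]}=awa$ given $\{X_0=X_{n+1}=a,\ X_i\ne a\ (1\le i\le n)\}$ lies in $[0,c]\cup\{1\}$. Put $\widehat X=(\mathbf 1\{X_n=a\})_n$ (its law is the marked-state distribution) and $h(X|\widehat X)=h(X)-h(\widehat X)$, where $h$ is the entropy rate. **Marker factors and skeletons.** A marker factor is a measurable map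 $\xi$ of $\widehat X$ into $\mathbb Z_{\ge0}^{\mathbb Z}$, a.s. commuting with the shift, with $\xi_0>0\Rightarrow\widehat X_0=1$ a.s. and $\mathbf P[\xi_0\ge r]>0$ for every $r\geq 1$. An interval $[\alpha,\beta]$, $\alpha\le\beta$, carries an $r$-skeleton ($r\ge1$) if $\xi_\alpha,\xi_{\beta+1}\ge r>\xi_i$ for $\alpha<i\le\beta$. The skeleton is $S=(\widehat X_{[\alpha,\beta]},\xi_{[\alpha,\beta]})$ with its position, where the label $\xi_\alpha$ is recorded only through $\tau(\xi_\alpha)$, for a fixed but arbitrary map $\tau:\mathbb Z_{\ge0}\to\mathbb Z_{\ge0}$ ($\tau=\mathrm{id}$ records it in full, a constant $\tau$ forgets it). $|S|=\beta-\alpha+1$, and $S_r=S_r(X)$ is the $r$-skeleton that covers $0$. $\xi$ is nice for $X$ with lengths sequence $(L_r)_{r\ge1}$ if $L_r\to\infty$; $L_{r+1}=\tilde O(L_r)$; with probability $1-\Delta(L_r)$, $X_{[-L_r,L_r]}$ determines the interval covered by $S_r(X)$; and for some $c>0$, both $L_r<L_{r+1}/\log^cL_{r+1}$ for all large $r$ and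 $\mathbf P[L_r/\log^cL_r\le|S_r|\le L_r]=1-\Delta(L_r)$. **Systems of fillers.** For a skeleton $S$ on $[\alpha,\beta]$, $A_S$ is the set of words $w\in A^{[\alpha,\beta]}$ whose occurrences of $a$ are as prescribed by $S$, and $\mu_S$ is the law of $X_{[\alpha,\beta]}$ given $\widehat X_{[\alpha,\beta]}$ and $X_{\beta+1}=a$. A system of fillers (SOF) is a translation-invariant family of equivalence relations $\sim_S$ on the sets $A_S$ such that, almost surely: for every decomposition $S=S^1\cdots S^m$ into skeletons, $\sim_S$ refines the product of the $\sim_{S^i}$; and $$\mathbf E\Big[\tfrac1{|S_r|}\sum_{i\in S_r}\mathbf 1\{[X_{S_r}]\Rrightarrow X_i\}\Big]\to1\qquad(r\to\infty).$$ Here the random class $[X_{S_r}]$ is understood to carry the positioned skeleton $S_r$ with it. The SOF is good if for some reals $K\ge k$: (1) almost surely, for every skeleton $S$ with $|S|$ large enough, every class $[w]$ of a filler $w$ with $\mu_S(w)>0$ satisfies $-\log\mu_S([w])\le|S|\,h(X|\widehat X)-\Lambda_{k,1/2}(|S|)$; (2) with probability $1-\Delta(L_r)$, $-\log\mu_{S_r}([X_{S_r}])\ge|S_r|\,h(X|\widehat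 X)-\Lambda_{K,1/2}(|S_r|)$. **Lemma.** Let $X\sim(A^{\mathbb Z},\mu,a)$ and $Y\sim(B^{\mathbb Z},\nu,b)$ be marked processes with $h(X)=h(Y)$ and $\widehat X\overset{d}{=}\widehat Y$. Let $\xi$ be a common marker factor, nice for both $X$ and $Y$ with the same lengths sequence $(L_r)_{r\ge1}$, and suppose that both $X$ and $Y$ have good SOFs with respect to $\xi$ (with the same $\tau$). Then there is an isomorphism $\phi$ from $X$ to $Y$ (a measurable, a.s. shift-commuting, measure preserving map with an inverse $\phi^{-1}$ of the same kind, up to null sets), with $\widehat{\phi(X)}=\widehat X$ and $\widehat{\phi^{-1}(Y)}=\widehat Y$ a.s., and there are ranks $r_i=r_i(n)\ge1$, $1\le i\le4$, with $L_{r_i(n)}=\tilde\Theta(n)$, such that $$\mathbf P\big[[X_{S_{r_1}}]\Rrightarrow[\phi(X)_{S_{r_2}}]\big]=1-\Delta(n),\qquad \mathbf P\big[[Y_{S_{r_3}}]\Rrightarrow[\phi^{-1}(Y)_{S_{r_4}}]\big]=1-\Delta(n).$$ -/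

import Mathlib

open MeasureTheory Filter Asymptotics
open scoped ENNReal

namespace KSCoding

noncomputable section

/-! ### Asymptotic notation -/

/-- `Λ_{a,b}(x) = x ^ b * (log x) ^ a`. -/
def Lam (a b x : ℝ) : ℝ := x ^ b * Real.log x ^ a

/-- `f = Õ(g)`: for some `k > 0`, `f = O(g * (log g) ^ k)`. -/
def SoftO (f g : ℕ → ℝ) : Prop :=
  ∃ k : ℝ, 0 < k ∧ f =O[atTop] fun n => Lam k 1 (g n)

/-- `f = Ω̃(g)`: for some real `k` and `C > 0`, `f ≥ C * |g * (log g) ^ k|` eventually. -/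
def SoftOmega (f g : ℕ → ℝ) : Prop :=
  ∃ k C : ℝ, 0 < C ∧ ∀ᶠ n in atTop, C * |Lam k 1 (g n)| ≤ f n

/-- `f = Θ̃(g)`. -/
def SoftTheta (f g : ℕ → ℝ) : Prop := SoftO f g ∧ SoftOmega f g

/-- `f(n) = Δ(L(n))`: `f` decays faster than every negative power of `L`. -/
def SuperPoly (f L : ℕ → ℝ) : Prop :=
  ∀ k : ℕ, f =O[atTop] fun n => (L n ^ k)⁻¹

/-! ### Stationary processes -/

/-- The left shift. -/
def shift {A : Type*} (x : ℤ → A) : ℤ → A := fun n => x (n + 1)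

/-- The event that the sample agrees with `w` on the integer interval `[m, n]`. -/
def cyl {A : Type*} (m n : ℤ) (w : ℤ → A) : Set (ℤ → A) :=
  {x | ∀ i ∈ Set.Icc m n, x i = w i}

/-- The indicator process of the state `a`: its law is the distribution of `a`. -/
def hat {A : Type*} [DecidableEq A] (a : A) (x : ℤ → A) : ℤ → Bool :=
  fun n => decide (x n = a)

/-- Aperiodic Markov process of memory one (`μ` is the law of the stationary process). -/
structure IsAperiodicMarkov {A : Type*} [MeasurableSpace A] (μ : Measure (ℤ → A)) : Prop where
  stationary : MeasurePreserving shift μ μ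
  memory_one : ∀ (w : ℤ → A) (n : ℕ), 1 ≤ n →
    μ (cyl (-(n : ℤ)) 0 w) * μ (cyl (-1) (-1) w)
      = μ (cyl (-(n : ℤ)) (-1) w) * μ (cyl (-1) 0 w)
  irreducible : ∀ a' a'' : A, ∃ n : ℕ, 0 < μ {x | x 0 = a' ∧ x (n : ℤ) = a''}
  aperiodic : ∀ (a' a'' : A) (d : ℕ),
    (∀ n : ℕ, 0 < μ {x | x 0 = a' ∧ x (n : ℤ) = a''} → d ∣ n) → d = 1

/-- `a` is a renewal state: given `X_0 = a`, the words `X_{[-n,-1]}` and `X_{[1,n]}` are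
independent, for all `n`. -/
def IsRenewalState {A : Type*} [MeasurableSpace A] (μ : Measure (ℤ → A)) (a : A) : Prop :=
  ∀ (w : ℤ → A) (n : ℕ), w 0 = a →
    μ (cyl (-(n : ℤ)) n w) * μ (cyl 0 0 w) = μ (cyl (-(n : ℤ)) 0 w) * μ (cyl 0 n w)

/-- Probability reduction property: for some `c < 1`, for all `n ≥ 1` and all words `w` of length
`n` avoiding `a`, the conditional probability of `X_{[0,n+1]} = a w a` given that
`X_0 = X_{n+1} = a` and that `a` does not occur in between lies in `[0,c] ∪ {1}`. -/
def ProbabilityReduction {A : Type*} [DecidableEq A] [MeasurableSpace A]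
    (μ : Measure (ℤ → A)) (a : A) : Prop :=
  ∃ c : ℝ, c < 1 ∧ ∀ (n : ℕ) (w : ℤ → A), 1 ≤ n → w 0 = a → w (n + 1) = a →
    (∀ i ∈ Set.Icc (1 : ℤ) n, w i ≠ a) →
      μ.real (cyl 0 (n + 1) w) ≤ c * μ.real (hat a ⁻¹' cyl 0 (n + 1) (hat a w)) ∨
      μ.real (cyl 0 (n + 1) w) = μ.real (hat a ⁻¹' cyl 0 (n + 1) (hat a w))

/-- Marked process. -/
structure IsMarkedProcess {A : Type*} [DecidableEq A] [MeasurableSpace A]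
    (μ : Measure (ℤ → A)) (a : A) : Prop where
  markov : IsAperiodicMarkov μ
  renewal : IsRenewalState μ a
  reduction : ProbabilityReduction μ a

/-- Shannon entropy (in nats) of `X_{[0,n-1]}`. -/
def blockEntropy {A : Type*} [Fintype A] [MeasurableSpace A] (μ : Measure (ℤ → A)) (n : ℕ) : ℝ :=
  ∑ w : Fin n → A, Real.negMulLog (μ.real {x | ∀ j : Fin n, x (j : ℤ) = w j})

/-- Entropy rate `h(X)` of a stationary process, `inf_n H(X_{[0,n-1]}) / n`, which is also the
limit. -/
def entropyRate {A : Type*} [Fintype A] [MeasurableSpace A] (μ : Measure (ℤ → A)) : ℝ :=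
  ⨅ n : ℕ, blockEntropy μ (n + 1) / (n + 1)

/-- Conditional entropy rate `h(X | X̂) = h(X, X̂) - h(X̂) = h(X) - h(X̂)`
(`X̂` is a function of `X`). -/
def condEntropyRate {A : Type*} [Fintype A] [DecidableEq A] [MeasurableSpace A]
    (μ : Measure (ℤ → A)) (a : A) : ℝ :=
  entropyRate μ - entropyRate (μ.map (hat a))

/-- `ω` belongs to the event `{f ⇛ g}`: given `f = f ω`, the variable `g` is a.s. constant, equal
to `g ω`. -/
def Determines {Ω V W : Type*} [MeasurableSpace Ω] (P : Measure Ω) (f : Ω → V) (g : Ω → W)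
    (ω : Ω) : Prop :=
  ∀ᵐ ω' ∂P, f ω' = f ω → g ω' = g ω

/-- The pair `φ`, `ψ` is an isomorphism of stationary processes and its inverse. -/
structure IsIsomorphism {A B : Type*} [MeasurableSpace A] [MeasurableSpace B]
    (μ : Measure (ℤ → A)) (ν : Measure (ℤ → B))
    (φ : (ℤ → A) → ℤ → B) (ψ : (ℤ → B) → ℤ → A) : Prop where
  preserving : MeasurePreserving φ μ ν
  preserving_inv : MeasurePreserving ψ ν μ
  equivariant : ∀ᵐ x ∂μ, φ (shift x) = shift (φ x)
  equivariant_inv : ∀ᵐ y ∂ν, ψ (shift y) = shift (ψ y)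
  left_inv : ∀ᵐ x ∂μ, ψ (φ x) = x
  right_inv : ∀ᵐ y ∂ν, φ (ψ y) = y

/-! ### Marker factors and skeletons -/

/-- Marker factor of a `{0,1}`-valued process with law `ρ`. -/
structure IsMarkerFactor (ρ : Measure (ℤ → Bool)) (ξ : (ℤ → Bool) → ℤ → ℕ) : Prop where
  measurable : Measurable ξ
  equivariant : ∀ᵐ ω ∂ρ, ξ (shift ω) = shift (ξ ω)
  marks : ∀ᵐ ω ∂ρ, 0 < ξ ω 0 → ω 0 = true
  unbounded : ∀ r : ℕ, 0 < r → 0 < ρ {ω | r ≤ ξ ω 0}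

/-- The interval `[α, γ - 1]` carries a skeleton of the label sequence `m`: for some rank `r ≥ 1`
the labels at `α` and `γ` are `≥ r`, and those strictly in between are `< r`. -/
def IsSkeleton (m : ℤ → ℕ) (α γ : ℤ) : Prop :=
  α < γ ∧ ∃ r : ℕ, 1 ≤ r ∧ r ≤ m α ∧ r ≤ m γ ∧ ∀ i ∈ Set.Ioo α γ, m i < r

/-- First coordinate of the `r`-skeleton that covers the coordinate `0`. -/
def leftEnd (m : ℤ → ℕ) (r : ℕ) : ℤ := sSup {i : ℤ | i ≤ 0 ∧ r ≤ m i}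

/-- First coordinate after the `r`-skeleton that covers the coordinate `0`. -/
def rightEnd (m : ℤ → ℕ) (r : ℕ) : ℤ := sInf {i : ℤ | 0 < i ∧ r ≤ m i}

/-- A skeleton up to translation: its length, the `{0,1}`-word and the word of labels. -/
structure Skel where
  len : ℕ
  st : Fin len → Bool
  lab : Fin len → ℕ

/-- The skeleton on `[α, γ - 1]`. The label at its first coordinate is recorded through `τ`:
`τ = id` records it in full, a constant `τ` forgets it. -/
def skelOn (τ : ℕ → ℕ) (ω : ℤ → Bool) (m : ℤ → ℕ) (α γ : ℤ) : Skel where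
  len := (γ - α).toNat
  st := fun j => ω (α + (j : ℕ))
  lab := fun j => if (j : ℕ) = 0 then τ (m α) else m (α + (j : ℕ))

/-- The filler space `A_S`. -/
def Filler {A : Type*} [DecidableEq A] (a : A) (S : Skel) : Type _ :=
  {w : Fin S.len → A // ∀ j, decide (w j = a) = S.st j}

/-- The filler that `x` induces on the skeleton of `ω = hat a x` on `[α, γ - 1]`. -/
def fillerOn {A : Type*} [DecidableEq A] (a : A) (τ : ℕ → ℕ) (m : ℤ → ℕ) (ω : ℤ → Bool)
    (x : ℤ → A) (h : hat a x = ω) (α γ : ℤ) : Filler a (skelOn τ ω m α γ) :=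
  ⟨fun j => x (α + (j : ℕ)), fun j => congrFun h (α + (j : ℕ))⟩

/-- The measure `μ_S` on words of length `|S|`: the law of `X_{[0,|S|-1]}` conditioned on
`X̂_{[0,|S|]}` being the word of `S` followed by `1`. -/
def fillerMeasure {A : Type*} [DecidableEq A] [MeasurableSpace A] (μ : Measure (ℤ → A)) (a : A)
    (S : Skel) : Measure (Fin S.len → A) :=
  (ProbabilityTheory.cond μ
    {x | (∀ j : Fin S.len, hat a x ((j : ℕ) : ℤ) = S.st j) ∧ x (S.len : ℤ) = a}).map
      fun x j => x ((j : ℕ) : ℤ)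

/-- Information `-log p`, equal to `∞` at `p = 0`. -/
def info (p : ℝ≥0∞) : EReal := -ENNReal.log p

/-- A nice marker factor `ξ` of the process `X̂` (where `X` has law `μ`) with lengths sequence
`L`. The skeleton `S_r(X)` in `determined` is identified with the interval it covers. -/
structure IsNice {A : Type*} [DecidableEq A] [MeasurableSpace A] (μ : Measure (ℤ → A)) (a : A)
    (ξ : (ℤ → Bool) → ℤ → ℕ) (L : ℕ → ℝ) : Prop where
  tendsto : Tendsto L atTop atTop
  soft_growth : SoftO (fun r => L (r + 1)) L
  determined : SuperPoly (fun r => μ.real {x | ¬ Determines μ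
    (fun x (i : {i : ℤ // |(i : ℝ)| ≤ L r}) => x i)
    (fun x => (leftEnd (ξ (hat a x)) r, rightEnd (ξ (hat a x)) r)) x}) L
  sizes : ∃ c : ℝ, 0 < c ∧ (∀ᶠ r in atTop, L r < L (r + 1) / Real.log (L (r + 1)) ^ c) ∧
    SuperPoly (fun r => μ.real {x | ¬
      (L r / Real.log (L r) ^ c ≤ ((rightEnd (ξ (hat a x)) r - leftEnd (ξ (hat a x)) r : ℤ) : ℝ) ∧
        ((rightEnd (ξ (hat a x)) r - leftEnd (ξ (hat a x)) r : ℤ) : ℝ) ≤ L r)}) L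

/-! ### Systems of fillers -/

/-- The skeleton `S_r(X)`, up to translation. -/
def skelAt {A : Type*} [DecidableEq A] (a : A) (ξ : (ℤ → Bool) → ℤ → ℕ) (τ : ℕ → ℕ) (r : ℕ)
    (x : ℤ → A) : Skel :=
  skelOn τ (hat a x) (ξ (hat a x)) (leftEnd (ξ (hat a x)) r) (rightEnd (ξ (hat a x)) r)

/-- The word `X_{S_r}`, as a filler of `S_r(X)`. -/
def fillerAt {A : Type*} [DecidableEq A] (a : A) (ξ : (ℤ → Bool) → ℤ → ℕ) (τ : ℕ → ℕ) (r : ℕ)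
    (x : ℤ → A) : Filler a (skelAt a ξ τ r x) :=
  fillerOn a τ (ξ (hat a x)) (hat a x) x rfl
    (leftEnd (ξ (hat a x)) r) (rightEnd (ξ (hat a x)) r)

/-- The random class `[X_{S_r}]`: the skeleton `S_r(X)`, with its position, together with the
class of the word `X_{S_r}` in the filler space of `S_r(X)`. -/
def classAt {A : Type*} [DecidableEq A] (a : A) (ξ : (ℤ → Bool) → ℤ → ℕ) (τ : ℕ → ℕ)
    (rel : (S : Skel) → Setoid (Filler a S)) (r : ℕ) (x : ℤ → A) :
    ℤ × (Σ S : Skel, Quotient (rel S)) :=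
  (leftEnd (ξ (hat a x)) r, ⟨skelAt a ξ τ r x, Quotient.mk (rel _) (fillerAt a ξ τ r x)⟩)

open Classical in
/-- System of fillers. The relations are indexed by skeletons up to translation, so the system is
translation-invariant. -/
structure SOF {A : Type*} [DecidableEq A] [MeasurableSpace A] (μ : Measure (ℤ → A)) (a : A)
    (ξ : (ℤ → Bool) → ℤ → ℕ) (τ : ℕ → ℕ) where
  /-- the equivalence relation `∼_S` on the filler space of `S` -/
  rel : (S : Skel) → Setoid (Filler a S)
  /-- if two fillers of a skeleton are equivalent, then so are their restrictions to each
  sub-skeleton (that is, to each factor of a skeleton decomposition) -/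
  refines : ∀ᵐ ω ∂(μ.map (hat a)), ∀ α γ α' γ' : ℤ,
    IsSkeleton (ξ ω) α γ → IsSkeleton (ξ ω) α' γ' → α ≤ α' → γ' ≤ γ →
    ∀ (x y : ℤ → A) (hx : hat a x = ω) (hy : hat a y = ω),
      (rel _) (fillerOn a τ (ξ ω) ω x hx α γ) (fillerOn a τ (ξ ω) ω y hy α γ) →
      (rel _) (fillerOn a τ (ξ ω) ω x hx α' γ') (fillerOn a τ (ξ ω) ω y hy α' γ')
  /-- the expected fraction of coordinates of `S_r` determined by `[X_{S_r}]` tends to `1` -/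
  determines : Tendsto (fun r : ℕ => ∫ x,
      ((((Finset.Ico (leftEnd (ξ (hat a x)) r) (rightEnd (ξ (hat a x)) r)).filter fun i =>
          Determines μ (classAt a ξ τ rel r) (fun x' => x' i) x).card : ℝ) /
        ((rightEnd (ξ (hat a x)) r - leftEnd (ξ (hat a x)) r : ℤ) : ℝ)) ∂μ)
    atTop (nhds 1)

/-- The information `I_{μ_S}([w])` of the class of the filler `w` of `S`. -/
def SOF.classInfo {A : Type*} [DecidableEq A] [MeasurableSpace A] {μ : Measure (ℤ → A)} {a : A}
    {ξ : (ℤ → Bool) → ℤ → ℕ} {τ : ℕ → ℕ} (𝒜 : SOF μ a ξ τ) (S : Skel) (w : Filler a S) : EReal :=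
  info (fillerMeasure μ a S (Subtype.val '' {v : Filler a S | (𝒜.rel S) v w}))

/-- Good system of fillers, with respect to the lengths sequence `L`. The upper bound is asked of
the classes of fillers of positive probability (a null class has infinite information). -/
def SOF.IsGood {A : Type*} [Fintype A] [DecidableEq A] [MeasurableSpace A] {μ : Measure (ℤ → A)}
    {a : A} {ξ : (ℤ → Bool) → ℤ → ℕ} {τ : ℕ → ℕ} (𝒜 : SOF μ a ξ τ) (L : ℕ → ℝ) : Prop :=
  ∃ k K : ℝ, k ≤ K ∧
    (∃ N : ℕ, ∀ᵐ ω ∂(μ.map (hat a)), ∀ α γ : ℤ, IsSkeleton (ξ ω) α γ → (N : ℤ) ≤ γ - α →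
      ∀ w : Filler a (skelOn τ ω (ξ ω) α γ), fillerMeasure μ a _ {w.1} ≠ 0 →
        𝒜.classInfo _ w ≤ ((((γ - α : ℤ) : ℝ) * condEntropyRate μ a
          - Lam k (1 / 2) ((γ - α : ℤ) : ℝ) : ℝ) : EReal)) ∧
    SuperPoly (fun r => μ.real {x | ¬
      (((((skelAt a ξ τ r x).len : ℝ) * condEntropyRate μ a
          - Lam K (1 / 2) ((skelAt a ξ τ r x).len : ℝ) : ℝ) : EReal)
        ≤ 𝒜.classInfo (skelAt a ξ τ r x) (fillerAt a ξ τ r x))}) L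

end

end KSCoding

open KSCoding

open MeasureTheory Filter Asymptotics
open scoped ENNReal
namespace KSCoding
noncomputable section

/-! ### Recoupling of finite distributions -/

/-! The processes have the same law of marked states, hence the same skeletons. Given the skeletons,
the renewal property makes the fillers of consecutive skeletons independent with the laws `μ_S` and
`ν_S`. It is enough to couple the two families of fillers along one growing sequence of ranks, so
that each side is eventually determined by the other. Such a sequence is `stp * j + 1`; classes of
fillers of X are recorded on the even levels `j`, and classes of fillers of Y on the odd ones.

The couplings are built upwards. On a skeleton of level `j + 1` the couplings of its pieces are
multiplied; this gives a joint law of the classes two levels below (same process as level `j + 1`)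
and one level below (the other process). The class on level `j + 1` determines those two levels
below, because a system of fillers refines. `exists_recoupling` then joins the class of the node to
the classes of its pieces, compatibly with all lower couplings, and the new coupling has few atoms:
at most those of the product plus the number of classes of the node, minus the number of values two
levels below.

Atoms are counted as follows. Let `h` be the common conditional entropy and `g s = ε √s /
log(s+3)^k`. The upper information bound leaves at most `exp(h|S| - 2 g|S|)` classes on a long
skeleton. Since `g (x + y) + c ≤ g x + g y`, the bound `exp(h|S| - g|S|)` on the number of atoms
passes from the pieces to the whole (`Link.ncard_kap_aux`). The classes of S that fail to determine
the classes of the pieces (split classes) number at most `exp(h|S| - Σ g|S^i|)`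
(`Link.ncard_split_le`). A typical class has mass at most `exp(-h|S| + Λ_{K,1/2}(|S|))` by the lower
information bound. If the pieces are shorter than S by a large enough power of the logarithm, which
a large `stp` ensures, then `Σ g|S^i|` exceeds `Λ_{K,1/2}(|S|)` by a margin that makes the mass of
the split classes superpolynomially small (`Link.split_le`, `heavy_numeric`).

The map `phi` reads the symbol at `n` off any level of X whose class is not split and for which the
classes of Y on the pieces determine that symbol. The couplings project downwards, so the readings
agree. The systems of fillers determine almost every coordinate (by mass transport), so almost every
sample is read completely, and the image has the law of Y. Exchanging the roles of the processes in
the same chain of couplings gives the inverse, since a sample and its image are compatible on every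
level. The rate is the mass of the split classes on the level whose length is comparable to `n`. -/

theorem mapDomain_ne_zero_of_mem {α β : Type*} (f : α → β) (u : α →₀ NNReal) {x : α}
    (hx : u x ≠ 0) : (u.mapDomain f) (f x) ≠ 0 := by
  classical
  rw [Finsupp.mapDomain, Finsupp.sum_apply]
  intro h
  have := (Finset.sum_eq_zero_iff.1 h) x (Finsupp.mem_support_iff.2 hx)
  simp at this
  exact hx this

theorem exists_of_mapDomain_ne_zero {α β : Type*} (f : α → β) (u : α →₀ NNReal) {y : β}
    (hy : (u.mapDomain f) y ≠ 0) : ∃ x, u x ≠ 0 ∧ f x = y := by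
  classical
  have := Finsupp.mapDomain_support (Finsupp.mem_support_iff.2 hy)
  rcases Finset.mem_image.1 this with ⟨x, hx, rfl⟩
  exact ⟨x, Finsupp.mem_support_iff.1 hx, rfl⟩

/-- Above each `p` there are two finite mass distributions of equal total, on the `q` and on the
`a`. The greedy (north-west corner) rule couples `m` atoms with `n` atoms by at most `m + n - 1`
atoms; the `-1`, once for each `p`, is the term with the marginal on `P`. -/
theorem exists_recoupling_finsupp {P Q A : Type*} (g : A → P) (n : ℕ) :
    ∀ (κ : P × Q →₀ NNReal) (α : A →₀ NNReal), κ.support.card + α.support.card = n →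
    κ.mapDomain Prod.fst = α.mapDomain g →
    ∃ lam : Q × A →₀ NNReal, lam.mapDomain Prod.snd = α ∧
      lam.mapDomain (fun z => (g z.2, z.1)) = κ ∧
      lam.support.card + (κ.mapDomain Prod.fst).support.card
        ≤ κ.support.card + α.support.card := by
  classical
  induction n using Nat.strong_induction_on with
  | _ n ih =>
  intro κ α hn h
  by_cases hα : α = 0
  · have hκ : κ = 0 := by
      refine Finsupp.ext fun x => ?_
      by_contra hx
      have := mapDomain_ne_zero_of_mem Prod.fst κ hx
      rw [h, hα] at this
      simp at this
    exact ⟨0, by simp [hα], by simp [hκ], by simp [hκ]⟩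
  obtain ⟨a, ha⟩ : ∃ a, α a ≠ 0 := by
    by_contra! hc
    exact hα (Finsupp.ext hc)
  have hp := mapDomain_ne_zero_of_mem g α ha
  rw [← h] at hp
  obtain ⟨⟨p, q⟩, hκ, hpe⟩ := exists_of_mapDomain_ne_zero _ _ hp
  simp only at hpe
  subst hpe
  -- Moving the largest possible mass exhausts at least one of the two atoms, so the total number of
  -- atoms drops and the induction applies.
  set m := min (κ (g a, q)) (α a) with hm
  have hm0 : m ≠ 0 := by
    rw [hm]; rcases min_choice (κ (g a, q)) (α a) with h' | h' <;> rw [h'] <;> assumption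
  have hle1 : Finsupp.single (g a, q) m ≤ κ := by
    intro x
    by_cases hx : x = (g a, q)
    · subst hx; simp [hm]
    · rw [Finsupp.single_eq_of_ne hx]; exact zero_le
  have hle2 : Finsupp.single a m ≤ α := by
    intro x
    by_cases hx : x = a
    · subst hx; simp [hm]
    · rw [Finsupp.single_eq_of_ne hx]; exact zero_le
  obtain ⟨κ', hκ'⟩ : ∃ κ', κ = κ' + Finsupp.single (g a, q) m :=
    ⟨κ - Finsupp.single (g a, q) m, (tsub_add_cancel_of_le hle1).symm⟩
  obtain ⟨α', hα'⟩ : ∃ α', α = α' + Finsupp.single a m :=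
    ⟨α - Finsupp.single a m, (tsub_add_cancel_of_le hle2).symm⟩
  have hv1 : κ (g a, q) = κ' (g a, q) + m := by rw [hκ']; simp
  have hv2 : α a = α' a + m := by rw [hα']; simp
  have hmarg : κ'.mapDomain Prod.fst = α'.mapDomain g := by
    rw [hκ', hα', Finsupp.mapDomain_add, Finsupp.mapDomain_add, Finsupp.mapDomain_single,
      Finsupp.mapDomain_single] at h
    exact add_right_cancel h
  have hs1 : κ'.support ⊆ κ.support := by
    intro x hx
    rw [Finsupp.mem_support_iff] at hx ⊢
    rw [hκ', Finsupp.add_apply]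
    exact fun h0 => hx (add_eq_zero.1 h0).1
  have hs2 : α'.support ⊆ α.support := by
    intro x hx
    rw [Finsupp.mem_support_iff] at hx ⊢
    rw [hα', Finsupp.add_apply]
    exact fun h0 => hx (add_eq_zero.1 h0).1
  have hc1 := Finset.card_le_card hs1
  have hc2 := Finset.card_le_card hs2
  have hd1 : κ' (g a, q) = 0 → κ'.support.card + 1 ≤ κ.support.card := by
    intro h0
    refine Finset.card_lt_card (Finset.ssubset_iff_subset_ne.2 ⟨hs1, fun he => ?_⟩)
    have : (g a, q) ∈ κ.support := Finsupp.mem_support_iff.2 hκ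
    rw [← he, Finsupp.mem_support_iff] at this
    exact this h0
  have hd2 : α' a = 0 → α'.support.card + 1 ≤ α.support.card := by
    intro h0
    refine Finset.card_lt_card (Finset.ssubset_iff_subset_ne.2 ⟨hs2, fun he => ?_⟩)
    have : a ∈ α.support := Finsupp.mem_support_iff.2 ha
    rw [← he, Finsupp.mem_support_iff] at this
    exact this h0
  have hor : κ' (g a, q) = 0 ∨ α' a = 0 := by
    rcases min_choice (κ (g a, q)) (α a) with h' | h'
    · left
      have : κ' (g a, q) + m = 0 + m := by rw [← hv1, zero_add, hm, h']
      exact add_right_cancel this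
    · right
      have : α' a + m = 0 + m := by rw [← hv2, zero_add, hm, h']
      exact add_right_cancel this
  obtain ⟨lam', hl1, hl2, hl3⟩ := ih (κ'.support.card + α'.support.card)
    (by rcases hor with h' | h'
        · have := hd1 h'; omega
        · have := hd2 h'; omega) κ' α' rfl hmarg
  refine ⟨lam' + Finsupp.single (q, a) m, ?_, ?_, ?_⟩
  · rw [Finsupp.mapDomain_add, hl1, Finsupp.mapDomain_single, hα']
  · rw [Finsupp.mapDomain_add, hl2, Finsupp.mapDomain_single, hκ']
  have hlam : (lam' + Finsupp.single (q, a) m).support.card ≤ lam'.support.card + 1 := by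
    refine (Finset.card_le_card Finsupp.support_add).trans
      ((Finset.card_union_le _ _).trans ?_)
    rw [Finsupp.support_single _ hm0]; simp
  have hPeq : κ.mapDomain Prod.fst = κ'.mapDomain Prod.fst + Finsupp.single (g a) m := by
    rw [hκ', Finsupp.mapDomain_add, Finsupp.mapDomain_single]
  have hP : (κ.mapDomain Prod.fst).support.card ≤ (κ'.mapDomain Prod.fst).support.card + 1 := by
    rw [hPeq]
    refine (Finset.card_le_card Finsupp.support_add).trans
      ((Finset.card_union_le _ _).trans ?_)
    rw [Finsupp.support_single _ hm0]; simp
  have hP' : (κ'.mapDomain Prod.fst) (g a) ≠ 0 →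
      (κ.mapDomain Prod.fst).support.card ≤ (κ'.mapDomain Prod.fst).support.card := by
    intro h0
    refine Finset.card_le_card ?_
    rw [hPeq]
    refine Finsupp.support_add.trans ?_
    rw [Finsupp.support_single _ hm0]
    refine Finset.union_subset subset_rfl ?_
    simpa using h0
  -- If both atoms are exhausted, the gain of two pays for the new atom of `lam` and for a possible
  -- loss of `g a` from the marginal. If only one is, the survivor keeps `g a` in the marginal, and
  -- one suffices.
  by_cases hb : κ' (g a, q) = 0
  · have e1 := hd1 hb
    by_cases hb2 : α' a = 0
    · have e2 := hd2 hb2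
      omega
    · have : (κ'.mapDomain Prod.fst) (g a) ≠ 0 := by
        rw [hmarg]; exact mapDomain_ne_zero_of_mem g α' hb2
      have := hP' this
      omega
  · have e2 := hd2 (hor.resolve_left hb)
    have : (κ'.mapDomain Prod.fst) (g a) ≠ 0 := mapDomain_ne_zero_of_mem Prod.fst κ' hb
    have := hP' this
    omega

/-- The weights of a distribution of finite support. -/
def pmfWeights {α : Type*} (p : PMF α) (hp : p.support.Finite) : α →₀ NNReal :=
  Finsupp.onFinset hp.toFinset (fun x => (p x).toNNReal) (by
    intro x hx
    rw [Set.Finite.mem_toFinset, PMF.mem_support_iff]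
    intro h; simp [h] at hx)

theorem pmfWeights_apply {α : Type*} (p : PMF α) (hp : p.support.Finite) (x : α) :
    ((pmfWeights p hp x : NNReal) : ℝ≥0∞) = p x := by
  simp [pmfWeights, ENNReal.coe_toNNReal (p.apply_ne_top x)]

theorem coe_mapDomain {α β : Type*} (f : α → β) (u : α →₀ NNReal) (b : β) [DecidableEq β] :
    ((u.mapDomain f b : NNReal) : ℝ≥0∞) = ∑' a, if b = f a then (u a : ℝ≥0∞) else 0 := by
  classical
  rw [tsum_eq_sum (s := u.support)
    (by intro x hx; rw [Finsupp.notMem_support_iff] at hx; simp [hx])]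
  rw [Finsupp.mapDomain, Finsupp.sum_apply, Finsupp.sum, ENNReal.ofNNReal_finsetSum]
  refine Finset.sum_congr rfl fun x _ => ?_
  rw [Finsupp.single_apply]
  by_cases h : b = f x
  · simp [h]
  · simp [h, Ne.symm h]

theorem pmf_map_eq_of_weights {α β : Type*} (f : α → β) (p : PMF α) (u : α →₀ NNReal)
    (hu : ∀ x, (u x : ℝ≥0∞) = p x) (b : β) : ((u.mapDomain f b : NNReal) : ℝ≥0∞) = p.map f b := by
  classical
  rw [coe_mapDomain, PMF.map_apply]
  refine tsum_congr fun x => ?_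
  rw [hu]

theorem support_ncard_of_weights {α : Type*} (p : PMF α) (u : α →₀ NNReal)
    (hu : ∀ x, (u x : ℝ≥0∞) = p x) : p.support = ↑u.support := by
  ext x
  rw [PMF.mem_support_iff, ← hu]
  simp

theorem exists_recoupling {P Q A : Type*} (κ : PMF (P × Q)) (α : PMF A) (g : A → P)
    (hκ : κ.support.Finite) (hα : α.support.Finite) (h : κ.map Prod.fst = α.map g) :
    ∃ lam : PMF (Q × A), lam.map Prod.snd = α ∧ lam.map (fun z => (g z.2, z.1)) = κ ∧
      lam.support.Finite ∧
      lam.support.ncard + (κ.map Prod.fst).support.ncard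
        ≤ κ.support.ncard + α.support.ncard := by
  classical
  have hm : (pmfWeights κ hκ).mapDomain Prod.fst = (pmfWeights α hα).mapDomain g := by
    ext b
    have e1 := pmf_map_eq_of_weights Prod.fst κ _ (pmfWeights_apply κ hκ) b
    have e2 := pmf_map_eq_of_weights g α _ (pmfWeights_apply α hα) b
    rw [h, ← e2] at e1
    exact_mod_cast e1
  obtain ⟨u, h1, h2, h3⟩ := exists_recoupling_finsupp g _ _ _ rfl hm
  have hsum : ∑ z ∈ u.support, (u z : ℝ≥0∞) = 1 := by
    have e := coe_mapDomain (fun _ : Q × A => ()) u ()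
    have e' := coe_mapDomain (fun _ : A => ()) (u.mapDomain Prod.snd) ()
    rw [← Finsupp.mapDomain_comp] at e'
    have : (fun _ : A => ()) ∘ Prod.snd = (fun _ : Q × A => ()) := rfl
    rw [this, e, h1] at e'
    simp only [if_true, pmfWeights_apply] at e'
    rw [α.tsum_coe] at e'
    rw [← e', tsum_eq_sum]
    intro x hx
    rw [Finsupp.notMem_support_iff] at hx
    simp [hx]
  let lam : PMF (Q × A) := PMF.ofFinset (fun z => (u z : ℝ≥0∞)) u.support hsum (by
    intro x hx
    rw [Finsupp.notMem_support_iff] at hx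
    simp [hx])
  have hl : ∀ x, (u x : ℝ≥0∞) = lam x := fun x => rfl
  have hls := support_ncard_of_weights lam u hl
  refine ⟨lam, ?_, ?_, ?_, ?_⟩
  · ext b
    rw [← pmf_map_eq_of_weights _ lam u hl, h1, pmfWeights_apply]
  · ext b
    rw [← pmf_map_eq_of_weights _ lam u hl, h2, pmfWeights_apply]
  · rw [hls]; exact u.support.finite_toSet
  · have e1 := support_ncard_of_weights κ _ (pmfWeights_apply κ hκ)
    have e2 := support_ncard_of_weights α _ (pmfWeights_apply α hα)
    have e3 := support_ncard_of_weights (κ.map Prod.fst)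
      ((pmfWeights κ hκ).mapDomain Prod.fst)
      (fun x => pmf_map_eq_of_weights Prod.fst κ _ (pmfWeights_apply κ hκ) x)
    rw [hls, e1, e2, e3]
    simpa only [Set.ncard_coe_finset] using h3

/-! ### Products of lists of distributions -/

/-- The law of a list of independent variables. -/
def listProd {α : Type*} : List (PMF α) → PMF (List α)
  | [] => PMF.pure []
  | p :: l => p.bind fun a => (listProd l).map (a :: ·)

theorem listProd_map {α β : Type*} (f : α → β) (l : List (PMF α)) :
    (listProd l).map (List.map f) = listProd (l.map (PMF.map f)) := by
  induction l with
  | nil => simp [listProd, PMF.pure_map]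
  | cons p l ih =>
    simp only [listProd, List.map_cons, PMF.map_bind, PMF.bind_map, PMF.map_comp, ← ih]
    rfl

theorem listProd_cons_apply {α : Type*} (p : PMF α) (l : List (PMF α)) (a : α) (c : List α) :
    listProd (p :: l) (a :: c) = p a * listProd l c := by
  classical
  simp only [listProd, PMF.bind_apply, PMF.map_apply]
  rw [tsum_eq_single a]
  · rw [tsum_eq_single c]
    · simp
    · intro c' hc'; simp [Ne.symm hc']
  · intro a' ha'
    simp [Ne.symm ha']

theorem listProd_cons_nil {α : Type*} (p : PMF α) (l : List (PMF α)) :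
    listProd (p :: l) [] = 0 := by
  classical
  simp [listProd, PMF.bind_apply, PMF.map_apply]

theorem listProd_nil_cons {α : Type*} (a : α) (c : List α) :
    listProd [] (a :: c) = 0 := by
  simp [listProd]

theorem listProd_nil_nil {α : Type*} : listProd ([] : List (PMF α)) [] = 1 := by
  simp [listProd]

/-- The support of a product along a list is the set of lists of elements of the supports. -/
theorem forall_of_listProd_ne_zero {α γ : Type*} (f : γ → PMF α) (v : γ → α) (l : List γ)
    (h : listProd (l.map f) (l.map v) ≠ 0) : ∀ t ∈ l, f t (v t) ≠ 0 := by
  induction l with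
  | nil => simp
  | cons t l ih =>
    rw [List.map_cons, List.map_cons, listProd_cons_apply] at h
    intro s hs
    rcases List.mem_cons.1 hs with rfl | hs
    · exact left_ne_zero_of_mul h
    · exact ih (right_ne_zero_of_mul h) s hs

theorem support_listProd_cons {α : Type*} (p : PMF α) (l : List (PMF α)) :
    (listProd (p :: l)).support =
      (fun z : α × List α => z.1 :: z.2) '' (p.support ×ˢ (listProd l).support) := by
  ext c
  cases c with
  | nil => simp [PMF.mem_support_iff, listProd_cons_nil]
  | cons a c =>
    rw [PMF.mem_support_iff, listProd_cons_apply]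
    simp [PMF.mem_support_iff]

theorem support_listProd {α : Type*} (l : List (PMF α)) (h : ∀ p ∈ l, p.support.Finite) :
    (listProd l).support.Finite ∧
      (listProd l).support.ncard = (l.map fun p => p.support.ncard).prod := by
  induction l with
  | nil => simp [listProd]
  | cons p l ih =>
    have h1 := h p (by simp)
    obtain ⟨h2, h3⟩ := ih fun q hq => h q (by simp [hq])
    rw [support_listProd_cons]
    refine ⟨(h1.prod h2).image _, ?_⟩
    rw [Set.ncard_image_of_injective, Set.ncard_prod, h3]
    · simp
    · rintro ⟨a, b⟩ ⟨c, d⟩ h; simpa using h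

/-! ### The chain of couplings -/

/-- Data of a tree of finite distributions: own laws, refinement maps and children. -/
structure ChainData (T : Type*) where
  pi : ℕ → T → PMF ℕ
  -- The symbol of a node of level `j + 1` induces, child by child, the symbols two levels below;
  -- the level between belongs to the other process.
  rf : ℕ → T → ℕ → List (List ℕ)
  ch : ℕ → T → List T

variable {T : Type*}

/-- The law of the list of symbols of the children. -/
def ChainData.PR (D : ChainData T) (j : ℕ) (t : T) : PMF (List ℕ) :=
  listProd ((D.ch j t).map (D.pi (j - 1)))

/-- Properties of the coupling `lam` on `t` at level `j + 1`, where `K` is the product of the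
couplings on the children. -/
def ChainData.IsStep (D : ChainData T) (j : ℕ) (t : T) (K : PMF (List (List ℕ) × List ℕ))
    (lam : PMF (List ℕ × ℕ)) : Prop :=
  lam.map Prod.snd = D.pi (j + 1) t ∧
  lam.map (fun z => (D.rf (j + 1) t z.2, z.1)) = K ∧
  lam.support.Finite ∧
  lam.support.ncard + (K.map Prod.fst).support.ncard
    ≤ K.support.ncard + (D.pi (j + 1) t).support.ncard

open Classical in
/-- The coupling of the symbols of the children with the symbol of the node. -/
def ChainData.kap (D : ChainData T) : ℕ → T → PMF (List ℕ × ℕ)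
  | 0, t => (D.pi 0 t).map fun c => ([], c)
  | j + 1, t =>
    let K : PMF (List (List ℕ) × List ℕ) := (listProd ((D.ch (j + 1) t).map (D.kap j))).map
      fun l => (l.map Prod.fst, l.map Prod.snd)
    -- The default is never met on admissible nodes, where the recoupling exists.
    if h : ∃ lam, D.IsStep j t K lam then h.choose else (D.pi 0 t).map fun c => ([], c)

/-- The product of the couplings on the children. -/
def ChainData.K (D : ChainData T) (j : ℕ) (t : T) : PMF (List (List ℕ) × List ℕ) :=
  (listProd ((D.ch (j + 1) t).map (D.kap j))).map fun l => (l.map Prod.fst, l.map Prod.snd)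

/-- Hypotheses on the admissible nodes of a tree of finite distributions. -/
structure ChainData.IsChain (D : ChainData T) (Adm : ℕ → T → Prop) : Prop where
  ch_zero : ∀ t, D.ch 0 t = []
  adm_ch : ∀ j t, Adm (j + 1) t → ∀ t' ∈ D.ch (j + 1) t, Adm j t'
  finite : ∀ j t, Adm j t → (D.pi j t).support.Finite
  refine : ∀ j t, Adm (j + 1) t →
    (D.pi (j + 1) t).map (D.rf (j + 1) t) = listProd ((D.ch (j + 1) t).map (D.PR j))

variable {D : ChainData T} {Adm : ℕ → T → Prop}

/-- The three claims go through the induction together: the marginals of the couplings on the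
children are what makes the marginal of their product match the refinement map, which is the
hypothesis of the recoupling. -/
theorem kap_spec (hD : D.IsChain Adm) (j : ℕ) : ∀ t, Adm j t →
    (D.kap j t).map Prod.snd = D.pi j t ∧ (D.kap j t).map Prod.fst = D.PR j t ∧
      (D.kap j t).support.Finite := by
  induction j with
  | zero =>
    intro t ht
    refine ⟨?_, ?_, ?_⟩
    · simp only [ChainData.kap, PMF.map_comp]
      exact PMF.map_id _
    · simp only [ChainData.kap, PMF.map_comp, ChainData.PR, hD.ch_zero]
      exact PMF.map_const _ _
    · simp only [ChainData.kap, PMF.support_map]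
      exact (hD.finite 0 t ht).image _
  | succ j ih =>
    intro t ht
    have hfin : (D.K j t).support.Finite := by
      rw [ChainData.K, PMF.support_map]
      refine Set.Finite.image _ (support_listProd _ ?_).1
      intro p hp
      obtain ⟨t', ht', rfl⟩ := List.mem_map.1 hp
      exact (ih t' (hD.adm_ch j t ht t' ht')).2.2
    have hfst : (D.K j t).map Prod.fst = (D.pi (j + 1) t).map (D.rf (j + 1) t) := by
      rw [hD.refine j t ht, ChainData.K, PMF.map_comp]
      change (listProd _).map (List.map Prod.fst) = _
      rw [listProd_map, List.map_map]
      congr 1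
      exact List.map_congr_left fun t' ht' => (ih t' (hD.adm_ch j t ht t' ht')).2.1
    have hsnd : (D.K j t).map Prod.snd = D.PR (j + 1) t := by
      rw [ChainData.K, PMF.map_comp]
      change (listProd _).map (List.map Prod.snd) = _
      rw [listProd_map, List.map_map, ChainData.PR]
      congr 1
      exact List.map_congr_left fun t' ht' => (ih t' (hD.adm_ch j t ht t' ht')).1
    have hex : ∃ lam, D.IsStep j t (D.K j t) lam :=
      exists_recoupling _ _ _ hfin (hD.finite _ t ht) hfst
    have hk : D.kap (j + 1) t = hex.choose := by
      rw [ChainData.kap]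
      exact dif_pos hex
    have hs := hex.choose_spec
    rw [← hk] at hs
    refine ⟨hs.1, ?_, hs.2.2.1⟩
    rw [← hsnd, ← hs.2.1, PMF.map_comp]
    rfl

theorem kap_isStep (hD : D.IsChain Adm) (j : ℕ) (t : T) (ht : Adm (j + 1) t) :
    D.IsStep j t (D.K j t) (D.kap (j + 1) t) := by
  have hfin : (D.K j t).support.Finite := by
    rw [ChainData.K, PMF.support_map]
    refine Set.Finite.image _ (support_listProd _ ?_).1
    intro p hp
    obtain ⟨t', ht', rfl⟩ := List.mem_map.1 hp
    exact (kap_spec hD j t' (hD.adm_ch j t ht t' ht')).2.2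
  have hfst : (D.K j t).map Prod.fst = (D.pi (j + 1) t).map (D.rf (j + 1) t) := by
    rw [hD.refine j t ht, ChainData.K, PMF.map_comp]
    change (listProd _).map (List.map Prod.fst) = _
    rw [listProd_map, List.map_map]
    congr 1
    exact List.map_congr_left fun t' ht' => (kap_spec hD j t' (hD.adm_ch j t ht t' ht')).2.1
  have hex : ∃ lam, D.IsStep j t (D.K j t) lam :=
    exists_recoupling _ _ _ hfin (hD.finite _ t ht) hfst
  have hk : D.kap (j + 1) t = hex.choose := by
    rw [ChainData.kap]
    exact dif_pos hex
  rw [hk]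
  exact hex.choose_spec

theorem ncard_K_le (hD : D.IsChain Adm) (j : ℕ) (t : T) (ht : Adm (j + 1) t) :
    (D.K j t).support.ncard
      ≤ ((D.ch (j + 1) t).map fun t' => (D.kap j t').support.ncard).prod := by
  obtain ⟨h1, h2⟩ := support_listProd ((D.ch (j + 1) t).map (D.kap j)) (by
    intro p hp
    obtain ⟨t', ht', rfl⟩ := List.mem_map.1 hp
    exact (kap_spec hD j t' (hD.adm_ch j t ht t' ht')).2.2)
  rw [ChainData.K, PMF.support_map]
  refine (Set.ncard_image_le h1).trans ?_
  rw [h2, List.map_map]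
  rfl

/-- Compatible symbols on a node restrict to compatible symbols on its children. -/
theorem kap_child_ne_zero (hD : D.IsChain Adm) (j : ℕ) (t : T) (ht : Adm (j + 1) t) (c : ℕ)
    {γ : Type*} (l : List γ) (f : γ → T) (hl : D.ch (j + 1) t = l.map f)
    (p : γ → List ℕ) (q : γ → ℕ) (hp : D.rf (j + 1) t c = l.map p)
    (h : D.kap (j + 1) t (l.map q, c) ≠ 0) :
    ∀ s ∈ l, D.kap j (f s) (p s, q s) ≠ 0 := by
  have h2 := (kap_isStep hD j t ht).2.1
  have h3 : (l.map p, l.map q) ∈ (D.K j t).support := by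
    rw [← h2, PMF.support_map]
    exact ⟨(l.map q, c), h, by simp [hp]⟩
  rw [ChainData.K, PMF.support_map] at h3
  obtain ⟨z, hz, hz'⟩ := h3
  have hz2 : z = l.map fun s => (p s, q s) := by
    simp only [Prod.mk.injEq] at hz'
    have := List.zip_of_prod hz'.1 hz'.2
    rw [this, List.zip_map']
  rw [hz2, hl, List.map_map] at hz
  exact forall_of_listProd_ne_zero _ _ l hz

/-- The symbol `c` of the node `t` determines the symbols `q` of the children. -/
def ChainData.Uns (D : ChainData T) (j : ℕ) (t : T) (c : ℕ) (q : List ℕ) : Prop :=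
  D.kap j t (q, c) ≠ 0 ∧ ∀ q', D.kap j t (q', c) ≠ 0 → q' = q

/-- The symbols of the node that do not determine those of the children. -/
def ChainData.split (D : ChainData T) (j : ℕ) (t : T) : Set ℕ :=
  {c | D.pi j t c ≠ 0 ∧ ¬ ∃ q, D.Uns j t c q}

theorem exists_kap_ne_zero (hD : D.IsChain Adm) (j : ℕ) (t : T) (ht : Adm j t) (c : ℕ)
    (hc : D.pi j t c ≠ 0) : ∃ q, D.kap j t (q, c) ≠ 0 := by
  have h1 : c ∈ (D.pi j t).support := hc
  rw [← (kap_spec hD j t ht).1, PMF.support_map] at h1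
  obtain ⟨⟨q, c'⟩, h, rfl⟩ := h1
  exact ⟨q, h⟩

/-- Each symbol of the node has a partner in the coupling, and each split symbol a second one, so
the coupling has at least `|supp π| + |split|` atoms. The recoupling bound gives at most `|supp K| +
|supp π|`. -/
theorem ncard_split_le (hD : D.IsChain Adm) (j : ℕ) (t : T) (ht : Adm (j + 1) t) :
    (D.split (j + 1) t).ncard ≤ (D.K j t).support.ncard := by
  obtain ⟨-, -, hfin, hcard⟩ := kap_isStep hD j t ht
  have hpf := hD.finite (j + 1) t ht
  have hex : ∀ c ∈ (D.pi (j + 1) t).support, ∃ q, D.kap (j + 1) t (q, c) ≠ 0 :=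
    fun c hc => exists_kap_ne_zero hD _ t ht c hc
  choose! q0 hq0 using hex
  have hex1 : ∀ c ∈ D.split (j + 1) t, ∃ q, D.kap (j + 1) t (q, c) ≠ 0 ∧ q ≠ q0 c := by
    rintro c ⟨hc, hc'⟩
    by_contra! hcon
    exact hc' ⟨q0 c, hq0 c hc, hcon⟩
  choose! q1 hq1 using hex1
  have hsub : D.split (j + 1) t ⊆ (D.pi (j + 1) t).support := fun c hc => hc.1
  have hdisj : Disjoint ((fun c => (q0 c, c)) '' (D.pi (j + 1) t).support)
      ((fun c => (q1 c, c)) '' D.split (j + 1) t) := by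
    rw [Set.disjoint_left]
    rintro _ ⟨c, hc, rfl⟩ ⟨c', hc', h⟩
    simp only [Prod.mk.injEq] at h
    obtain ⟨h1, rfl⟩ := h
    exact (hq1 _ hc').2 h1
  have hu : ((fun c => (q0 c, c)) '' (D.pi (j + 1) t).support) ∪
      ((fun c => (q1 c, c)) '' D.split (j + 1) t) ⊆ (D.kap (j + 1) t).support := by
    refine Set.union_subset ?_ ?_
    · rintro _ ⟨c, hc, rfl⟩; exact hq0 c hc
    · rintro _ ⟨c, hc, rfl⟩; exact (hq1 c hc).1
  have h1 := Set.ncard_le_ncard hu hfin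
  rw [Set.ncard_union_eq hdisj (hpf.image _) ((hpf.subset hsub).image _),
    Set.ncard_image_of_injective _ (fun a b h => (Prod.mk.inj h).2),
    Set.ncard_image_of_injective _ (fun a b h => (Prod.mk.inj h).2)] at h1
  omega

/-- Up to the mass of the split symbols, the symbols of the children are read off the symbol of
the node. -/
theorem PR_le_uns_add_split (hD : D.IsChain Adm) (j : ℕ) (t : T) (ht : Adm j t)
    (Q : Set (List ℕ)) :
    (D.PR j t).toOuterMeasure Q ≤
      (D.pi j t).toOuterMeasure {c | ∃ q ∈ Q, D.Uns j t c q} +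
        (D.pi j t).toOuterMeasure (D.split j t) := by
  obtain ⟨h1, h2, -⟩ := kap_spec hD j t ht
  refine le_trans ?_ (measure_union_le _ _)
  -- Both laws are marginals of the same coupling, so the claim becomes an inclusion of events up to
  -- null atoms.
  rw [← h1, ← h2, PMF.toOuterMeasure_map_apply, PMF.toOuterMeasure_map_apply]
  refine PMF.toOuterMeasure_mono _ ?_
  rintro ⟨q, c⟩ ⟨hq, hz⟩
  by_cases hs : ∃ q, D.Uns j t c q
  · left
    obtain ⟨q', hq'⟩ := hs
    have : q = q' := hq'.2 q hz
    exact ⟨q, hq, this ▸ hq'⟩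
  · right
    refine ⟨?_, hs⟩
    change c ∈ (D.pi j t).support
    rw [← h1, PMF.support_map]
    exact ⟨(q, c), hz, rfl⟩

end
end KSCoding

open MeasureTheory Filter Asymptotics
open scoped ENNReal
namespace KSCoding
noncomputable section

/-! ### Skeletons and their pieces -/

/-- The `{0,1}`-word of a skeleton, extended by `false`. -/
def Skel.stx (S : Skel) (k : ℕ) : Bool := if h : k < S.len then S.st ⟨k, h⟩ else false

/-- The word of labels of a skeleton, extended by `0`. -/
def Skel.labx (S : Skel) (k : ℕ) : ℕ := if h : k < S.len then S.lab ⟨k, h⟩ else 0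

theorem Skel.ext' {S S' : Skel} (h : S.len = S'.len) (h1 : ∀ k < S.len, S.stx k = S'.stx k)
    (h2 : ∀ k < S.len, S.labx k = S'.labx k) : S = S' := by
  obtain ⟨n, st, lab⟩ := S
  obtain ⟨n', st', lab'⟩ := S'
  obtain rfl : n = n' := h
  have e1 : st = st' := by
    funext ⟨k, hk⟩
    simpa [Skel.stx, hk] using h1 k hk
  have e2 : lab = lab' := by
    funext ⟨k, hk⟩
    simpa [Skel.labx, hk] using h2 k hk
  rw [e1, e2]

/-- The part `[u, v)` of a skeleton. -/
def Skel.sub (τ : ℕ → ℕ) (S : Skel) (u v : ℕ) : Skel where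
  len := v - u
  st := fun j => S.stx (u + j)
  -- A piece that starts at the first coordinate inherits a label that has already passed through
  -- `τ`, and `τ` need not be idempotent.
  lab := fun j => if (j : ℕ) = 0 ∧ u ≠ 0 then τ (S.labx u) else S.labx (u + j)

theorem skelOn_stx (τ : ℕ → ℕ) (ω : ℤ → Bool) (m : ℤ → ℕ) (α β : ℤ) (k : ℕ)
    (hk : (k : ℤ) < β - α) : (skelOn τ ω m α β).stx k = ω (α + k) := by
  have : k < (β - α).toNat := by omega
  simp [Skel.stx, skelOn, this]

theorem skelOn_labx (τ : ℕ → ℕ) (ω : ℤ → Bool) (m : ℤ → ℕ) (α β : ℤ) (k : ℕ)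
    (hk : (k : ℤ) < β - α) (hk0 : k ≠ 0) : (skelOn τ ω m α β).labx k = m (α + k) := by
  have : k < (β - α).toNat := by omega
  simp [Skel.labx, skelOn, this, hk0]

theorem skelOn_labx_zero (τ : ℕ → ℕ) (ω : ℤ → Bool) (m : ℤ → ℕ) (α β : ℤ) (h : α < β) :
    (skelOn τ ω m α β).labx 0 = τ (m α) := by
  have : 0 < (β - α).toNat := by omega
  simp [Skel.labx, skelOn, this]

/-- Pieces can thus be computed from the skeleton alone, without the sample that carries it. -/
theorem skelOn_sub (τ : ℕ → ℕ) (ω : ℤ → Bool) (m : ℤ → ℕ) (α β : ℤ) (u v : ℕ)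
    (huv : u < v) (hv : (v : ℤ) ≤ β - α) :
    (skelOn τ ω m α β).sub τ u v = skelOn τ ω m (α + u) (α + v) := by
  have hl : ((skelOn τ ω m α β).sub τ u v).len = v - u := rfl
  have hl2 : (skelOn τ ω m (α + u) (α + v)).len = v - u := by simp [skelOn]
  refine Skel.ext' (hl.trans hl2.symm) ?_ ?_
  · intro k hk
    rw [hl] at hk
    rw [skelOn_stx _ _ _ _ _ _ (by omega), Skel.stx]
    simp only [hl, hk, dif_pos]
    change (skelOn τ ω m α β).stx (u + k) = _
    rw [skelOn_stx _ _ _ _ _ _ (by omega)]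
    push_cast; congr 1; ring
  · intro k hk
    rw [hl] at hk
    rw [Skel.labx]
    simp only [hl, hk, dif_pos]
    change (if k = 0 ∧ u ≠ 0 then τ ((skelOn τ ω m α β).labx u)
      else (skelOn τ ω m α β).labx (u + k)) = _
    by_cases hk0 : k = 0
    · subst hk0
      rw [skelOn_labx_zero _ _ _ _ _ (by omega)]
      by_cases hu : u = 0
      · subst hu
        simp [skelOn_labx_zero τ ω m α β (by omega)]
      · simp only [hu, ne_eq, not_false_iff, and_self, if_true]
        rw [skelOn_labx _ _ _ _ _ _ (by omega) hu]
    · rw [if_neg (by tauto), skelOn_labx _ _ _ _ _ _ (by omega) (by omega),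
        skelOn_labx _ _ _ _ _ _ (by omega) hk0]
      push_cast; congr 1; ring

/-- A list of consecutive intervals from `a` to `b`. -/
inductive Chn : ℕ → ℕ → List (ℕ × ℕ) → Prop
  | nil (a : ℕ) : Chn a a []
  | cons {a b c : ℕ} {l : List (ℕ × ℕ)} : a < b → Chn b c l → Chn a c ((a, b) :: l)

theorem Chn.le {a b : ℕ} {l : List (ℕ × ℕ)} (h : Chn a b l) : a ≤ b := by
  induction h with
  | nil => exact le_rfl
  | cons h _ ih => omega

theorem Chn.mem {a b : ℕ} {l : List (ℕ × ℕ)} (h : Chn a b l) :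
    ∀ z ∈ l, a ≤ z.1 ∧ z.1 < z.2 ∧ z.2 ≤ b := by
  induction h with
  | nil => simp
  | cons h h2 ih =>
    intro z hz
    have := h2.le
    rcases List.mem_cons.1 hz with rfl | hz
    · exact ⟨le_rfl, h, this⟩
    · have := ih z hz
      omega

theorem Chn.sum {a b : ℕ} {l : List (ℕ × ℕ)} (h : Chn a b l) :
    (l.map fun z => ((z.2 - z.1 : ℕ) : ℝ)).sum = (b : ℝ) - a := by
  induction h with
  | nil => simp
  | cons h h2 ih =>
    rw [List.map_cons, List.sum_cons, ih, Nat.cast_sub h.le]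
    ring

theorem Chn.cover {a b : ℕ} {l : List (ℕ × ℕ)} (h : Chn a b l) (k : ℕ) (h1 : a ≤ k)
    (h2 : k < b) : ∃ z ∈ l, z.1 ≤ k ∧ k < z.2 := by
  induction h with
  | nil => omega
  | cons h h3 ih =>
    rename_i a b c l
    by_cases hk : k < b
    · exact ⟨(a, b), by simp, h1, hk⟩
    · obtain ⟨z, hz, hz'⟩ := ih (by omega) h2
      exact ⟨z, by simp [hz], hz'⟩

/-- The intervals into which the points of `P` cut `[s, c + n)`, when `[s, c)` is already known
to contain no cut. -/
def piecesFrom (P : ℕ → Bool) : ℕ → ℕ → ℕ → List (ℕ × ℕ)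
  | s, c, 0 => [(s, c)]
  | s, c, n + 1 => if P c then (s, c) :: piecesFrom P c (c + 1) n else piecesFrom P s (c + 1) n

theorem piecesFrom_chn (P : ℕ → Bool) (n : ℕ) : ∀ s c, s < c → Chn s (c + n) (piecesFrom P s c n) := by
  induction n with
  | zero => intro s c h; exact Chn.cons h (Chn.nil _)
  | succ n ih =>
    intro s c h
    rw [piecesFrom]
    split
    · refine Chn.cons h ?_
      have := ih c (c + 1) (by omega)
      rwa [show c + 1 + n = c + (n + 1) by omega] at this
    · have := ih s (c + 1) (by omega)
      rwa [show c + 1 + n = c + (n + 1) by omega] at this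

/-- The restriction `c ≤ i` is forced by the recursion, which never looks at `P` on `[s, c)`. -/
theorem piecesFrom_mem (P : ℕ → Bool) (n : ℕ) : ∀ s c, s < c → ∀ z ∈ piecesFrom P s c n,
    (z.1 = s ∨ P z.1 = true) ∧ (z.2 = c + n ∨ P z.2 = true) ∧
      ∀ i, c ≤ i → z.1 < i → i < z.2 → P i = false := by
  induction n with
  | zero =>
    intro s c h z hz
    simp only [piecesFrom, List.mem_singleton] at hz
    subst hz
    exact ⟨Or.inl rfl, Or.inl rfl, by intro i; simp; omega⟩
  | succ n ih =>
    intro s c h z hz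
    rw [piecesFrom] at hz
    split at hz
    · rename_i hP
      rcases List.mem_cons.1 hz with rfl | hz
      · exact ⟨Or.inl rfl, Or.inr hP, by intro i; simp; omega⟩
      · obtain ⟨h1, h2, h3⟩ := ih c (c + 1) (by omega) z hz
        have h4 := ((piecesFrom_chn P n c (c + 1) (by omega)).mem z hz).1
        refine ⟨Or.inr (by rcases h1 with h1 | h1 <;> simp_all), ?_, ?_⟩
        · rcases h2 with h2 | h2
          · left; omega
          · exact Or.inr h2
        · intro i _ hi1 hi2
          exact h3 i (by omega) hi1 hi2
    · rename_i hP
      obtain ⟨h1, h2, h3⟩ := ih s (c + 1) (by omega) z hz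
      refine ⟨h1, ?_, ?_⟩
      · rcases h2 with h2 | h2
        · left; omega
        · exact Or.inr h2
      · intro i hc hi1 hi2
        by_cases hic : i = c
        · subst hic; simpa using hP
        · exact h3 i (by omega) hi1 hi2

/-- The pieces of rank `r` of a skeleton. -/
def pcs (r : ℕ) (S : Skel) : List (ℕ × ℕ) :=
  -- The scan starts at `1`: the first coordinate always opens a piece, and its label is known only
  -- through `τ`.
  if S.len = 0 then [] else piecesFrom (fun k => decide (r ≤ S.labx k)) 0 1 (S.len - 1)

theorem pcs_chn (r : ℕ) (S : Skel) : Chn 0 S.len (pcs r S) := by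
  rw [pcs]
  split
  · rename_i h; rw [h]; exact Chn.nil 0
  · have := piecesFrom_chn (fun k => decide (r ≤ S.labx k)) (S.len - 1) 0 1 (by omega)
    rwa [show 1 + (S.len - 1) = S.len by omega] at this

theorem pcs_mem (r : ℕ) (S : Skel) (z : ℕ × ℕ) (hz : z ∈ pcs r S) :
    (z.1 = 0 ∨ r ≤ S.labx z.1) ∧ (z.2 = S.len ∨ r ≤ S.labx z.2) ∧
      ∀ i, z.1 < i → i < z.2 → S.labx i < r := by
  rw [pcs] at hz
  split at hz
  · simp at hz
  · obtain ⟨h1, h2, h3⟩ := piecesFrom_mem _ _ 0 1 (by omega) z hz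
    refine ⟨by simpa using h1, ?_, ?_⟩
    · rcases h2 with h2 | h2
      · left; omega
      · right; simpa using h2
    · intro i hi1 hi2
      have := h3 i (by omega) hi1 hi2
      simpa using this

/-- The interval `[α, β - 1]` carries an `r`-skeleton of the label sequence `m`. -/
def Sk (m : ℤ → ℕ) (r : ℕ) (α β : ℤ) : Prop :=
  α < β ∧ r ≤ m α ∧ r ≤ m β ∧ ∀ i ∈ Set.Ioo α β, m i < r

theorem Sk.isSkeleton {m : ℤ → ℕ} {r : ℕ} {α β : ℤ} (h : Sk m r α β) (hr : 1 ≤ r) :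
    IsSkeleton m α β := ⟨h.1, r, hr, h.2⟩

/-- At interior cuts the label is read off the skeleton. At the two outer ends it is not recorded
there (or only through `τ`), and `r ≤ r'` is used with the labels of the sample. -/
theorem Sk.piece {m : ℤ → ℕ} {r r' : ℕ} {α β : ℤ} (h : Sk m r' α β) (hr : r ≤ r') (τ : ℕ → ℕ)
    (ω : ℤ → Bool) (z : ℕ × ℕ) (hz : z ∈ pcs r (skelOn τ ω m α β)) :
    Sk m r (α + z.1) (α + z.2) ∧ α + z.2 ≤ β ∧
    (skelOn τ ω m α β).sub τ z.1 z.2 = skelOn τ ω m (α + z.1) (α + z.2) := by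
  obtain ⟨-, h2, h3⟩ := (pcs_chn r _).mem z hz
  obtain ⟨h4, h5, h6⟩ := pcs_mem r _ z hz
  have hlen : ((skelOn τ ω m α β).len : ℤ) = β - α := by
    have := h.1
    simp [skelOn]; omega
  have hz2 : (z.2 : ℤ) ≤ β - α := by omega
  refine ⟨⟨by omega, ?_, ?_, ?_⟩, by omega, skelOn_sub _ _ _ _ _ _ _ h2 hz2⟩
  · rcases Nat.eq_zero_or_pos z.1 with h0 | h0
    · rw [h0]; simpa using hr.trans h.2.1
    · have := h4.resolve_left (by omega)
      rwa [skelOn_labx _ _ _ _ _ _ (by omega) (by omega)] at this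
  · by_cases he : z.2 = (skelOn τ ω m α β).len
    · have : α + (z.2 : ℤ) = β := by omega
      rw [this]; exact hr.trans h.2.2.1
    · have := h5.resolve_left he
      rwa [skelOn_labx _ _ _ _ _ _ (by omega) (by omega)] at this
  · rintro i ⟨hi1, hi2⟩
    obtain ⟨k, hk⟩ := Int.eq_ofNat_of_zero_le (show 0 ≤ i - α by omega)
    have := h6 k (by omega) (by omega)
    rw [skelOn_labx _ _ _ _ _ _ (by omega) (by omega)] at this
    rwa [show α + (k : ℤ) = i by omega] at this

theorem Sk.ends {m : ℤ → ℕ} {r : ℕ} {α β : ℤ} (h : Sk m r α β) (h0 : α ≤ 0) (h1 : 0 < β) :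
    leftEnd m r = α ∧ rightEnd m r = β := by
  constructor
  · refine IsGreatest.csSup_eq ⟨⟨h0, h.2.1⟩, ?_⟩
    rintro i ⟨hi, hi'⟩
    by_contra! hc
    exact absurd hi' (not_le.2 (h.2.2.2 i ⟨hc, by omega⟩))
  · refine IsLeast.csInf_eq ⟨⟨h1, h.2.2.1⟩, ?_⟩
    rintro i ⟨hi, hi'⟩
    by_contra! hc
    exact absurd hi' (not_le.2 (h.2.2.2 i ⟨by omega, hc⟩))

/-- Labels of all ranks occur on both sides. -/
def Reg (m : ℤ → ℕ) : Prop := ∀ (r : ℕ) (N : ℤ), (∃ i ≤ N, r ≤ m i) ∧ ∃ i ≥ N, r ≤ m i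

theorem Reg.sk {m : ℤ → ℕ} (h : Reg m) (r : ℕ) :
    Sk m r (leftEnd m r) (rightEnd m r) ∧ leftEnd m r ≤ 0 ∧ 0 < rightEnd m r := by
  obtain ⟨i, hi, hi'⟩ := (h r 0).1
  obtain ⟨k, hk, hk'⟩ := (h r 1).2
  have hl : leftEnd m r ∈ {i : ℤ | i ≤ 0 ∧ r ≤ m i} :=
    Int.csSup_mem ⟨i, hi, hi'⟩ ⟨0, fun x hx => hx.1⟩
  have hr : rightEnd m r ∈ {i : ℤ | 0 < i ∧ r ≤ m i} :=
    Int.csInf_mem ⟨k, by omega, hk'⟩ ⟨0, fun x hx => hx.1.le⟩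
  refine ⟨⟨by have := hl.1; have := hr.1; omega, hl.2, hr.2, ?_⟩, hl.1, hr.1⟩
  rintro j ⟨hj1, hj2⟩
  by_contra! hc
  by_cases hj : j ≤ 0
  · have : j ≤ leftEnd m r := le_csSup ⟨0, fun x hx => hx.1⟩ ⟨hj, hc⟩
    omega
  · have : rightEnd m r ≤ j := csInf_le ⟨0, fun x hx => hx.1.le⟩ ⟨by omega, hc⟩
    omega

/-- Skeletons of large rank cover every given interval. -/
theorem Reg.eventually_cover {m : ℤ → ℕ} (h : Reg m) (M : ℕ) : ∃ r0, ∀ r ≥ r0,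
    leftEnd m r < -M ∧ (M : ℤ) < rightEnd m r := by
  -- A rank above all labels in `[-M, M]` leaves no possible end inside that window.
  refine ⟨(Finset.Icc (-(M : ℤ)) M).sup m + 1, fun r hr => ?_⟩
  have hlt : ∀ i : ℤ, -(M : ℤ) ≤ i → i ≤ M → m i < r := by
    intro i h1 h2
    have := Finset.le_sup (f := m) (Finset.mem_Icc.2 ⟨h1, h2⟩)
    omega
  obtain ⟨hs, h0, h1⟩ := h.sk r
  constructor
  · by_contra! hc
    exact absurd hs.2.1 (not_le.2 (hlt _ hc (by omega)))
  · by_contra! hc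
    exact absurd hs.2.2.1 (not_le.2 (hlt _ (by omega) hc))

/-! ### Translations -/

/-- Translation by `n`. -/
def shN {A : Type*} (n : ℤ) (x : ℤ → A) : ℤ → A := fun i => x (i + n)

theorem shN_shN {A : Type*} (n k : ℤ) (x : ℤ → A) : shN n (shN k x) = shN (n + k) x := by
  funext i; simp [shN, add_assoc]

theorem shN_zero {A : Type*} (x : ℤ → A) : shN 0 x = x := by funext i; simp [shN]

theorem shift_eq_shN {A : Type*} : (shift : (ℤ → A) → ℤ → A) = shN 1 := rfl

theorem hat_shN {A : Type*} [DecidableEq A] (a : A) (n : ℤ) (x : ℤ → A) :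
    hat a (shN n x) = shN n (hat a x) := rfl

theorem sk_shN (m : ℤ → ℕ) (r : ℕ) (α β n : ℤ) :
    Sk (shN n m) r α β ↔ Sk m r (α + n) (β + n) := by
  unfold Sk shN
  refine and_congr (by omega) (and_congr Iff.rfl (and_congr Iff.rfl ?_))
  constructor
  · intro h i hi
    have := h (i - n) ⟨by have := hi.1; omega, by have := hi.2; omega⟩
    rwa [sub_add_cancel] at this
  · intro h i hi
    exact h (i + n) ⟨by have := hi.1; omega, by have := hi.2; omega⟩

theorem skelOn_shN (τ : ℕ → ℕ) (ω : ℤ → Bool) (m : ℤ → ℕ) (α β n : ℤ) :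
    skelOn τ (shN n ω) (shN n m) α β = skelOn τ ω m (α + n) (β + n) := by
  unfold skelOn shN
  have : β - α = β + n - (α + n) := by ring
  rw [Skel.mk.injEq]
  refine ⟨by rw [this], ?_, ?_⟩
  · rw [show β + n - (α + n) = β - α by ring]
    refine heq_of_eq (funext fun j => ?_)
    congr 1; ring
  · rw [show β + n - (α + n) = β - α by ring]
    refine heq_of_eq (funext fun j => ?_)
    have e : α + (j : ℤ) + n = α + n + (j : ℤ) := by ring
    rw [e]

end
end KSCoding

open MeasureTheory Filter Asymptotics
open scoped ENNReal
namespace KSCoding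
noncomputable section

/-! ### Stationarity -/

theorem measurableSet_apply_eq {ι A : Type*} [MeasurableSpace A] [MeasurableSingletonClass A]
    (i : ι) (a : A) : MeasurableSet {x : ι → A | x i = a} := by
  have h : MeasurableSet ((fun x : ι → A => x i) ⁻¹' {a}) :=
    measurable_pi_apply i (measurableSet_singleton a)
  exact h

section Shift
variable {A : Type*} [MeasurableSpace A]

theorem measurable_shN (n : ℤ) : Measurable (shN n : (ℤ → A) → ℤ → A) :=
  measurable_pi_lambda _ fun i => measurable_pi_apply (i + n)

/-- Translation by `n` as a measurable equivalence. -/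
def shNEquiv (n : ℤ) : (ℤ → A) ≃ᵐ (ℤ → A) where
  toFun := shN n
  invFun := shN (-n)
  left_inv x := by rw [shN_shN]; simp [shN_zero]
  right_inv x := by rw [shN_shN]; simp [shN_zero]
  measurable_toFun := measurable_shN n
  measurable_invFun := measurable_shN (-n)

theorem measurePreserving_shN {μ : Measure (ℤ → A)} (h : MeasurePreserving shift μ μ) (n : ℤ) :
    MeasurePreserving (shN n) μ μ := by
  have h1 : MeasurePreserving (shN 1) μ μ := h
  have h2 : MeasurePreserving (shN (-1)) μ μ :=
    MeasurePreserving.symm (shNEquiv (A := A) 1) h1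
  induction n with
  | zero =>
    have : (shN 0 : (ℤ → A) → ℤ → A) = id := funext shN_zero
    rw [this]; exact MeasurePreserving.id μ
  | succ n ih =>
    have : (shN ((n : ℤ) + 1) : (ℤ → A) → ℤ → A) = shN (n : ℤ) ∘ shN 1 := by
      funext x; simp [shN_shN]
    rw [this]; exact ih.comp h1
  | pred n ih =>
    have : (shN (-(n : ℤ) - 1) : (ℤ → A) → ℤ → A) = shN (-(n : ℤ)) ∘ shN (-1) := by
      funext x; simp [shN_shN, sub_eq_add_neg]
    rw [this]; exact ih.comp h2

/-- Translations are measurable equivalences, so no measurability of `s` is needed; events about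
determination can be translated freely. -/
theorem measure_shN {μ : Measure (ℤ → A)} (h : MeasurePreserving shift μ μ) (n : ℤ)
    (s : Set (ℤ → A)) : μ (shN n ⁻¹' s) = μ s :=
  MeasurePreserving.measure_preimage_equiv (f := shNEquiv n) (measurePreserving_shN h n) s

theorem ae_shN {μ : Measure (ℤ → A)} (h : MeasurePreserving shift μ μ) {p : (ℤ → A) → Prop}
    (hp : ∀ᵐ x ∂μ, p x) : ∀ᵐ x ∂μ, ∀ n, p (shN n x) :=
  ae_all_iff.2 fun n => (measurePreserving_shN h n).quasiMeasurePreserving.ae hp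

theorem measurable_hat {A : Type*} [MeasurableSpace A] [MeasurableSingletonClass A]
    [DecidableEq A] (a : A) : Measurable (hat a : (ℤ → A) → ℤ → Bool) := by
  refine measurable_pi_lambda _ fun i => ?_
  refine measurable_to_bool ?_
  have : (fun x : ℤ → A => hat a x i) ⁻¹' {true} = {x | x i = a} := by
    ext x; simp [hat]
  rw [this]
  exact measurableSet_apply_eq i a

end Shift

/-! ### Cylinder sets -/

/-- Cylinders over increasing finite windows form a generating π-system, because the intersection of
two of them is empty or is the cylinder of the larger window. -/
theorem ext_of_windows {ι A : Type*} [Countable ι] [Finite A] [MeasurableSpace A]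
    [MeasurableSingletonClass A] (I : ℕ → Set ι) (hI : Monotone I) (hfin : ∀ n, (I n).Finite)
    (hcov : ∀ i, ∃ n, i ∈ I n) (m1 m2 : Measure (ι → A)) [IsFiniteMeasure m1]
    (h : ∀ (n : ℕ) (w : ι → A), m1 {f | ∀ i ∈ I n, f i = w i} = m2 {f | ∀ i ∈ I n, f i = w i}) :
    m1 = m2 := by
  classical
  -- A default letter is needed to extend words on a window; the empty alphabet is settled apart.
  by_cases hne : Nonempty A
  swap
  · rw [not_nonempty_iff] at hne
    rcases isEmpty_or_nonempty ι with hι | ⟨⟨i⟩⟩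
    · have : ∀ w : ι → A, {f : ι → A | ∀ i ∈ I 0, f i = w i} = Set.univ := by
        intro w; ext f; simp
      have h0 := h 0 isEmptyElim
      rw [this] at h0
      ext s hs
      rcases Set.eq_empty_or_nonempty s with rfl | ⟨x, hx⟩
      · simp
      · have : s = Set.univ := by
          ext y; rw [Subsingleton.elim y x]; simp [hx]
        rw [this, h0]
    · have : IsEmpty (ι → A) := ⟨fun f => hne.elim (f i)⟩
      ext s hs
      rw [Set.eq_empty_of_isEmpty s]; simp
  obtain ⟨b⟩ := hne
  let ext' : ∀ n, (I n → A) → ι → A := fun n p i => if h : i ∈ I n then p ⟨i, h⟩ else b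
  have hmeas : ∀ n (w : ι → A), MeasurableSet {f : ι → A | ∀ i ∈ I n, f i = w i} := by
    intro n w
    have : {f : ι → A | ∀ i ∈ I n, f i = w i} = ⋂ i ∈ I n, {f | f i = w i} := by
      ext f; simp
    rw [this]
    exact MeasurableSet.biInter (hfin n).countable fun i _ =>
      measurableSet_apply_eq i _
  have hpart : ∀ n (s : Set (ι → A)),
      s = ⋃ p : I n → A, s ∩ {f | ∀ i ∈ I n, f i = ext' n p i} := by
    intro n s
    ext f
    simp only [Set.mem_iUnion, Set.mem_inter_iff, Set.mem_ofPred_eq]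
    constructor
    · intro hf
      refine ⟨fun i => f i, hf, fun i hi => by simp [ext', hi]⟩
    · rintro ⟨p, hf, -⟩; exact hf
  refine ext_of_generate_finite {s | ∃ (n : ℕ) (w : ι → A), s = {f : ι → A | ∀ i ∈ I n, f i = w i}}
    ?_ ?_ ?_ ?_
  · apply le_antisymm
    · refine iSup_le fun i => ?_
      obtain ⟨n, hn⟩ := hcov i
      rintro _ ⟨B, -, rfl⟩
      rw [hpart n ((fun f : ι → A => f i) ⁻¹' B)]
      have : Finite (I n) := hfin n
      refine MeasurableSet.iUnion fun p => ?_
      by_cases hp : ext' n p i ∈ B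
      · refine MeasurableSpace.measurableSet_generateFrom ⟨n, ext' n p, ?_⟩
        ext f
        simp only [Set.mem_inter_iff, Set.mem_preimage, Set.mem_ofPred_eq, and_iff_right_iff_imp]
        intro hf; rw [hf i hn]; exact hp
      · convert MeasurableSet.empty
        ext f
        simp only [Set.mem_inter_iff, Set.mem_preimage, Set.mem_ofPred_eq, Set.mem_empty_iff_false,
          iff_false, not_and]
        intro hf hf2; rw [hf2 i hn] at hf; exact hp hf
    · refine MeasurableSpace.generateFrom_le ?_
      rintro _ ⟨n, w, rfl⟩
      exact hmeas n w
  · rintro _ ⟨n, w, rfl⟩ _ ⟨n', w', rfl⟩ ⟨g, hg1, hg2⟩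
    refine ⟨max n n', g, ?_⟩
    ext f
    constructor
    · rintro ⟨h1, h2⟩ i hi
      rcases le_total n n' with hnn | hnn
      · rw [max_eq_right hnn] at hi; rw [h2 i hi, hg2 i hi]
      · rw [max_eq_left hnn] at hi; rw [h1 i hi, hg1 i hi]
    · intro hf
      refine ⟨fun i hi => ?_, fun i hi => ?_⟩
      · rw [hf i (hI (le_max_left _ _) hi), hg1 i hi]
      · rw [hf i (hI (le_max_right _ _) hi), hg2 i hi]
  · rintro _ ⟨n, w, rfl⟩; exact h n w
  · have : Finite (I 0) := hfin 0
    have key : ∀ m : Measure (ι → A), m Set.univ =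
        ∑' p : I 0 → A, m {f | ∀ i ∈ I 0, f i = ext' 0 p i} := by
      intro m
      conv_lhs => rw [hpart 0 Set.univ]
      simp only [Set.univ_inter]
      refine measure_iUnion ?_ fun p => hmeas 0 _
      intro p p' hpp
      refine Set.disjoint_left.2 fun f hf hf' => hpp ?_
      funext i
      have e1 := hf i i.2
      have e2 := hf' i i.2
      simp only [ext', Subtype.coe_prop, dif_pos] at e1 e2
      exact e1.symm.trans e2
    rw [key m1, key m2]
    exact tsum_congr fun p => h 0 _

/-! ### Renewal -/

section Renewal
variable {A : Type*} [Fintype A] [DecidableEq A] [MeasurableSpace A] [MeasurableSingletonClass A]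

/-- The past of `x` at `p`, read backwards. -/
def past (p : ℤ) (x : ℤ → A) : ℕ → A := fun k => x (p - k)

/-- The future of `x` at `p`. -/
def fut (p : ℤ) (x : ℤ → A) : ℕ → A := fun k => x (p + k)

omit [Fintype A] [DecidableEq A] [MeasurableSingletonClass A] in
theorem measurable_past (p : ℤ) : Measurable (past p : (ℤ → A) → ℕ → A) :=
  measurable_pi_lambda _ fun _ => measurable_pi_apply _

omit [Fintype A] [DecidableEq A] [MeasurableSingletonClass A] in
theorem measurable_fut (p : ℤ) : Measurable (fut p : (ℤ → A) → ℕ → A) :=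
  measurable_pi_lambda _ fun _ => measurable_pi_apply _

/-- The definition of a renewal state only concerns words on symmetric windows. Reading a sample as
a sequence of pairs (past, future) turns both sides into finite measures that agree on the
cylinders, hence on all measurable sets. -/
theorem renewal_zero {μ : Measure (ℤ → A)} [IsProbabilityMeasure μ] {a : A}
    (h : IsRenewalState μ a) (E F : Set (ℕ → A)) (hE : MeasurableSet E) (hF : MeasurableSet F) :
    μ (past 0 ⁻¹' E ∩ fut 0 ⁻¹' F ∩ {x | x 0 = a}) * μ {x | x 0 = a} =
      μ (past 0 ⁻¹' E ∩ {x | x 0 = a}) * μ (fut 0 ⁻¹' F ∩ {x | x 0 = a}) := by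
  set μa := μ.restrict {x : ℤ → A | x 0 = a} with hμa
  let J : (ℤ → A) → ℕ → A × A := fun x k => (past 0 x k, fut 0 x k)
  have hJ : Measurable J := by
    refine measurable_pi_lambda _ fun k => ?_
    exact ((measurable_pi_apply k).comp (measurable_past 0)).prodMk
      ((measurable_pi_apply k).comp (measurable_fut 0))
  let Z : (ℕ → A) × (ℕ → A) → ℕ → A × A := fun z k => (z.1 k, z.2 k)
  have hZ : Measurable Z := by
    refine measurable_pi_lambda _ fun k => ?_
    exact ((measurable_pi_apply k).comp measurable_fst).prodMk
      ((measurable_pi_apply k).comp measurable_snd)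
  have hm : ((μ {x | x 0 = a}) • μa.map J) =
      ((μa.map (past 0)).prod (μa.map (fut 0))).map Z := by
    have : IsFiniteMeasure ((μ {x | x 0 = a}) • μa.map J) :=
      Measure.smul_finite _ (measure_ne_top _ _)
    refine ext_of_windows (fun n => Set.Iic n) (fun a b hab => Set.Iic_subset_Iic.2 hab)
      (fun n => Set.finite_Iic n) (fun i => ⟨i, Set.mem_Iic.2 le_rfl⟩) _ _ fun n w => ?_
    have hcm : MeasurableSet {f : ℕ → A × A | ∀ i ∈ Set.Iic n, f i = w i} := by
      have : {f : ℕ → A × A | ∀ i ∈ Set.Iic n, f i = w i} = ⋂ i ∈ Set.Iic n, {f | f i = w i} := by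
        ext f; simp
      rw [this]
      exact MeasurableSet.biInter (Set.finite_Iic n).countable fun i _ =>
        measurableSet_apply_eq i _
    have hcm1 : ∀ w : ℕ → A, MeasurableSet {f : ℕ → A | ∀ i ∈ Set.Iic n, f i = w i} := by
      intro w
      have : {f : ℕ → A | ∀ i ∈ Set.Iic n, f i = w i} = ⋂ i ∈ Set.Iic n, {f | f i = w i} := by
        ext f; simp
      rw [this]
      exact MeasurableSet.biInter (Set.finite_Iic n).countable fun i _ =>
        measurableSet_apply_eq i _
    have hprod : Z ⁻¹' {f : ℕ → A × A | ∀ i ∈ Set.Iic n, f i = w i} =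
        {f : ℕ → A | ∀ i ∈ Set.Iic n, f i = (w i).1} ×ˢ
          {f : ℕ → A | ∀ i ∈ Set.Iic n, f i = (w i).2} := by
      ext ⟨f, g⟩
      simp only [Z, Set.mem_preimage, Set.mem_ofPred_eq, Set.mem_prod, Prod.ext_iff]
      exact ⟨fun h => ⟨fun i hi => (h i hi).1, fun i hi => (h i hi).2⟩,
        fun h i hi => ⟨h.1 i hi, h.2 i hi⟩⟩
    rw [Measure.smul_apply, Measure.map_apply hJ hcm, Measure.map_apply hZ hcm, hprod,
      Measure.prod_prod, Measure.map_apply (measurable_past 0) (hcm1 _),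
      Measure.map_apply (measurable_fut 0) (hcm1 _), hμa,
      Measure.restrict_apply (hJ hcm), Measure.restrict_apply (measurable_past 0 (hcm1 _)),
      Measure.restrict_apply (measurable_fut 0 (hcm1 _)), smul_eq_mul]
    -- The origin is read both by the past and by the future. A window that does not show `a` in
    -- both places is incompatible with `x 0 = a`, and both sides vanish.
    by_cases hw : (w 0).1 = a ∧ (w 0).2 = a
    · let v : ℤ → A := fun i => if i ≤ 0 then (w i.natAbs).1 else (w i.natAbs).2
      have hv0 : v 0 = a := by simp [v, hw.1]
      have hvn : ∀ k : ℕ, v (-(k : ℤ)) = (w k).1 := by intro k; simp [v]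
      have hvp : ∀ k : ℕ, v (k : ℤ) = (w k).2 := by
        intro k
        rcases Nat.eq_zero_or_pos k with rfl | hk
        · simp [v, hw.1, hw.2]
        · have : ¬ ((k : ℤ) ≤ 0) := by omega
          simp only [v, if_neg this, Int.natAbs_natCast]
      have e1 : J ⁻¹' {f : ℕ → A × A | ∀ i ∈ Set.Iic n, f i = w i} ∩ {x | x 0 = a} =
          cyl (-(n : ℤ)) n v := by
        ext x
        simp only [J, Set.mem_inter_iff, Set.mem_preimage, Set.mem_ofPred_eq, Set.mem_Iic, cyl,
          Set.mem_Icc, Prod.ext_iff, past, fut, zero_sub, zero_add]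
        constructor
        · rintro ⟨hx, -⟩ i ⟨hi1, hi2⟩
          rcases le_total i 0 with hi | hi
          · obtain ⟨k, hk⟩ := Int.eq_ofNat_of_zero_le (show 0 ≤ -i by omega)
            have := (hx k (by omega)).1
            rw [show i = -(k : ℤ) by omega, this, hvn]
          · obtain ⟨k, hk⟩ := Int.eq_ofNat_of_zero_le hi
            have := (hx k (by omega)).2
            rw [show i = (k : ℤ) by omega, this, hvp]
        · intro hx
          refine ⟨fun k hk => ⟨?_, ?_⟩, ?_⟩
          · rw [hx (-(k : ℤ)) (by omega), hvn]
          · rw [hx (k : ℤ) (by omega), hvp]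
          · rw [hx 0 (by omega), hv0]
      have e2 : past 0 ⁻¹' {f : ℕ → A | ∀ i ∈ Set.Iic n, f i = (w i).1} ∩ {x | x 0 = a} =
          cyl (-(n : ℤ)) 0 v := by
        ext x
        simp only [Set.mem_inter_iff, Set.mem_preimage, Set.mem_ofPred_eq, Set.mem_Iic, cyl,
          Set.mem_Icc, past, zero_sub]
        constructor
        · rintro ⟨hx, -⟩ i ⟨hi1, hi2⟩
          obtain ⟨k, hk⟩ := Int.eq_ofNat_of_zero_le (show 0 ≤ -i by omega)
          have := hx k (by omega)
          rw [show i = -(k : ℤ) by omega, this, hvn]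
        · intro hx
          refine ⟨fun k hk => ?_, ?_⟩
          · rw [hx (-(k : ℤ)) (by omega), hvn]
          · rw [hx 0 (by omega), hv0]
      have e3 : fut 0 ⁻¹' {f : ℕ → A | ∀ i ∈ Set.Iic n, f i = (w i).2} ∩ {x | x 0 = a} =
          cyl 0 n v := by
        ext x
        simp only [Set.mem_inter_iff, Set.mem_preimage, Set.mem_ofPred_eq, Set.mem_Iic, cyl,
          Set.mem_Icc, fut, zero_add]
        constructor
        · rintro ⟨hx, -⟩ i ⟨hi1, hi2⟩
          obtain ⟨k, hk⟩ := Int.eq_ofNat_of_zero_le hi1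
          have := hx k (by omega)
          rw [show i = (k : ℤ) by omega, this, hvp]
        · intro hx
          refine ⟨fun k hk => ?_, ?_⟩
          · rw [hx (k : ℤ) (by omega), hvp]
          · rw [hx 0 (by omega), hv0]
      have e4 : {x : ℤ → A | x 0 = a} = cyl 0 0 v := by
        ext x
        simp only [cyl, Set.mem_ofPred_eq, Set.mem_Icc]
        constructor
        · intro hx i hi
          rw [show i = 0 by omega, hx, hv0]
        · intro hx; rw [hx 0 (by omega), hv0]
      rw [e1, e2, e3, e4, mul_comm]
      exact h v n hv0
    · have e1 : J ⁻¹' {f : ℕ → A × A | ∀ i ∈ Set.Iic n, f i = w i} ∩ {x | x 0 = a} = ∅ := by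
        ext x
        simp only [J, Set.mem_inter_iff, Set.mem_preimage, Set.mem_ofPred_eq, Set.mem_Iic,
          Set.mem_empty_iff_false, iff_false, not_and]
        intro hx hx0
        have := hx 0 (Nat.zero_le _)
        simp only [past, fut, Prod.ext_iff] at this
        exact hw ⟨by rw [← this.1]; simpa using hx0, by rw [← this.2]; simpa using hx0⟩
      rw [e1, measure_empty, mul_zero]
      symm
      rw [mul_eq_zero]
      by_cases hw1 : (w 0).1 = a
      · right
        have : fut 0 ⁻¹' {f : ℕ → A | ∀ i ∈ Set.Iic n, f i = (w i).2} ∩ {x | x 0 = a} = ∅ := by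
          ext x
          simp only [Set.mem_inter_iff, Set.mem_preimage, Set.mem_ofPred_eq, Set.mem_Iic,
            Set.mem_empty_iff_false, iff_false, not_and]
          intro hx hx0
          have := hx 0 (Nat.zero_le _)
          simp only [fut] at this
          exact hw ⟨hw1, by rw [← this]; simpa using hx0⟩
        rw [this, measure_empty]
      · left
        have : past 0 ⁻¹' {f : ℕ → A | ∀ i ∈ Set.Iic n, f i = (w i).1} ∩ {x | x 0 = a} = ∅ := by
          ext x
          simp only [Set.mem_inter_iff, Set.mem_preimage, Set.mem_ofPred_eq, Set.mem_Iic,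
            Set.mem_empty_iff_false, iff_false, not_and]
          intro hx hx0
          have := hx 0 (Nat.zero_le _)
          simp only [past] at this
          exact hw1 (by rw [← this]; simpa using hx0)
        rw [this, measure_empty]
  have hEF : MeasurableSet {g : ℕ → A × A | (fun k => (g k).1) ∈ E ∧ (fun k => (g k).2) ∈ F} := by
    refine MeasurableSet.inter ?_ ?_
    · exact (measurable_pi_lambda (fun (g : ℕ → A × A) k => (g k).1)
        fun k => measurable_fst.comp (measurable_pi_apply k)) hE
    · exact (measurable_pi_lambda (fun (g : ℕ → A × A) k => (g k).2)
        fun k => measurable_snd.comp (measurable_pi_apply k)) hF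
  have := congrArg (fun m => m {g : ℕ → A × A | (fun k => (g k).1) ∈ E ∧ (fun k => (g k).2) ∈ F}) hm
  rw [Measure.smul_apply, Measure.map_apply hJ hEF, Measure.map_apply hZ hEF, smul_eq_mul] at this
  have e5 : Z ⁻¹' {g : ℕ → A × A | (fun k => (g k).1) ∈ E ∧ (fun k => (g k).2) ∈ F} = E ×ˢ F := by
    ext ⟨f, g⟩; rfl
  rw [e5, Measure.prod_prod, Measure.map_apply (measurable_past 0) hE,
    Measure.map_apply (measurable_fut 0) hF, hμa,
    Measure.restrict_apply (hJ hEF), Measure.restrict_apply (measurable_past 0 hE),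
    Measure.restrict_apply (measurable_fut 0 hF)] at this
  rw [← this, mul_comm]
  rfl

theorem renewal_at {μ : Measure (ℤ → A)} [IsProbabilityMeasure μ] {a : A}
    (hs : MeasurePreserving shift μ μ) (h : IsRenewalState μ a) (p : ℤ) (E F : Set (ℕ → A))
    (hE : MeasurableSet E) (hF : MeasurableSet F) :
    μ (past p ⁻¹' E ∩ fut p ⁻¹' F ∩ {x | x p = a}) * μ {x | x 0 = a} =
      μ (past p ⁻¹' E ∩ {x | x p = a}) * μ (fut p ⁻¹' F ∩ {x | x p = a}) := by
  have e1 : (past p : (ℤ → A) → ℕ → A) = past 0 ∘ shN p := by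
    funext x k; simp only [past, shN, Function.comp]; congr 1; ring
  have e2 : (fut p : (ℤ → A) → ℕ → A) = fut 0 ∘ shN p := by
    funext x k; simp only [fut, shN, Function.comp]; congr 1; ring
  have e3 : {x : ℤ → A | x p = a} = shN p ⁻¹' {x | x 0 = a} := by
    ext x; simp [shN]
  rw [e1, e2, e3, Set.preimage_comp, Set.preimage_comp, ← Set.preimage_inter,
    ← Set.preimage_inter, ← Set.preimage_inter, ← Set.preimage_inter,
    measure_shN hs, measure_shN hs, measure_shN hs]
  exact renewal_zero h E F hE hF

/-- The coordinates of `x` in `[α, α + n]`. -/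
def mid (α : ℤ) (n : ℕ) (x : ℤ → A) : ℕ → A := fun k => x (α + (min k n : ℕ))

omit [Fintype A] [DecidableEq A] [MeasurableSingletonClass A] in
theorem measurable_mid (α : ℤ) (n : ℕ) : Measurable (mid α n : (ℤ → A) → ℕ → A) :=
  measurable_pi_lambda _ fun _ => measurable_pi_apply _

/-- Between two occurrences of the renewal state, the process is independent of the rest. -/
theorem renewal_mid {μ : Measure (ℤ → A)} [IsProbabilityMeasure μ] {a : A}
    (hs : MeasurePreserving shift μ μ) (h : IsRenewalState μ a) (ha : μ {x | x 0 = a} ≠ 0)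
    (α : ℤ) (n : ℕ) (W : Set (ℕ → A)) (hW : MeasurableSet W)
    (Z : Set ((ℕ → A) × (ℕ → A))) (hZ : MeasurableSet Z) :
    μ (mid α n ⁻¹' W ∩ ({x | x α = a} ∩ {x | x (α + n) = a}) ∩
        (fun x => (past α x, fut (α + n) x)) ⁻¹' Z) *
        μ ({x | x α = a} ∩ {x | x (α + n) = a}) =
      μ (mid α n ⁻¹' W ∩ ({x | x α = a} ∩ {x | x (α + n) = a})) *
        μ (({x | x α = a} ∩ {x | x (α + n) = a}) ∩
          (fun x => (past α x, fut (α + n) x)) ⁻¹' Z) := by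
  set M : Set (ℤ → A) := {x | x α = a} ∩ {x | x (α + n) = a} with hM
  have hMm : MeasurableSet M := (measurableSet_apply_eq _ _).inter (measurableSet_apply_eq _ _)
  have hpf : Measurable (fun x : ℤ → A => (past α x, fut (α + n) x)) :=
    (measurable_past _).prodMk (measurable_fut _)
  have hWm : MeasurableSet (mid α n ⁻¹' W ∩ M) := (measurable_mid α n hW).inter hMm
  -- Renewal is used at `α`, where the middle belongs to the future, and at `α + n`, where it
  -- belongs to the past. Comparing `W` with `univ` and cancelling the squared probability of `a`
  -- gives the claim on rectangles.
  have rect : ∀ (W : Set (ℕ → A)), MeasurableSet W → ∀ E F : Set (ℕ → A), MeasurableSet E →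
      MeasurableSet F →
      μ (mid α n ⁻¹' W ∩ M ∩ (past α ⁻¹' E ∩ fut (α + n) ⁻¹' F)) *
        (μ {x | x 0 = a} * μ {x | x 0 = a}) =
      μ (past α ⁻¹' E ∩ {x | x α = a}) * μ (mid α n ⁻¹' W ∩ M) *
        μ (fut (α + n) ⁻¹' F ∩ {x | x (α + n) = a}) := by
    intro W hW E F hE hF
    let F1 : Set (ℕ → A) := {f | (fun k => f (min k n)) ∈ W ∧ f n = a ∧ (fun k => f (n + k)) ∈ F}
    have hF1 : MeasurableSet F1 := by
      refine MeasurableSet.inter ?_ (MeasurableSet.inter ?_ ?_)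
      · exact (measurable_pi_lambda (fun (f : ℕ → A) k => f (min k n))
          fun k => measurable_pi_apply _) hW
      · exact measurableSet_apply_eq n a
      · exact (measurable_pi_lambda (fun (f : ℕ → A) k => f (n + k))
          fun k => measurable_pi_apply _) hF
    let E1 : Set (ℕ → A) := {f | (fun k => f (n - min k n)) ∈ W ∧ f n = a}
    have hE1 : MeasurableSet E1 := by
      refine MeasurableSet.inter ?_ ?_
      · exact (measurable_pi_lambda (fun (f : ℕ → A) k => f (n - min k n))
          fun k => measurable_pi_apply _) hW
      · exact measurableSet_apply_eq n a
    have r1 := renewal_at hs h α E F1 hE hF1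
    have r2 := renewal_at hs h (α + n) E1 F hE1 hF
    have x1 : fut α ⁻¹' F1 ∩ {x : ℤ → A | x α = a} =
        mid α n ⁻¹' W ∩ M ∩ fut (α + n) ⁻¹' F := by
      ext x
      have e1 : (fun k => fut α x (min k n)) = mid α n x := rfl
      have e2 : (fun k => fut α x (n + k)) = fut (α + n) x := by
        funext k; simp only [fut]; congr 1; push_cast; ring
      simp only [F1, Set.mem_inter_iff, Set.mem_preimage, Set.mem_ofPred_eq, e1, e2, hM]
      simp only [fut]
      tauto
    have x2 : past (α + n) ⁻¹' E1 ∩ {x : ℤ → A | x (α + n) = a} = mid α n ⁻¹' W ∩ M := by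
      ext x
      have e1 : (fun k => past (α + n) x (n - min k n)) = mid α n x := by
        funext k; simp only [past, mid]; congr 1
        rw [Nat.cast_sub (min_le_right _ _)]; ring
      have e2 : past (α + n) x n = x α := by simp [past]
      simp only [E1, Set.mem_inter_iff, Set.mem_preimage, Set.mem_ofPred_eq, e1, e2, hM]
      tauto
    have x3 : past α ⁻¹' E ∩ fut α ⁻¹' F1 ∩ {x : ℤ → A | x α = a} =
        mid α n ⁻¹' W ∩ M ∩ (past α ⁻¹' E ∩ fut (α + n) ⁻¹' F) := by
      rw [Set.inter_assoc, x1]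
      ext x; simp only [Set.mem_inter_iff]; tauto
    have x4 : past (α + n) ⁻¹' E1 ∩ fut (α + n) ⁻¹' F ∩ {x : ℤ → A | x (α + n) = a} =
        mid α n ⁻¹' W ∩ M ∩ fut (α + n) ⁻¹' F := by
      rw [← x2]; ext x; simp only [Set.mem_inter_iff]; tauto
    rw [x1, x3] at r1
    rw [x2, x4] at r2
    rw [← mul_assoc, r1, mul_assoc, r2, mul_assoc]
  have hm : (μ M) • ((μ.restrict (mid α n ⁻¹' W ∩ M)).map fun x => (past α x, fut (α + n) x)) =
      (μ (mid α n ⁻¹' W ∩ M)) • ((μ.restrict M).map fun x => (past α x, fut (α + n) x)) := by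
    have : IsFiniteMeasure ((μ M) •
        ((μ.restrict (mid α n ⁻¹' W ∩ M)).map fun x => (past α x, fut (α + n) x))) :=
      Measure.smul_finite _ (measure_ne_top _ _)
    refine Measure.ext_prod fun {E F} hE hF => ?_
    have hEF := hE.prod hF
    have e : (fun x : ℤ → A => (past α x, fut (α + n) x)) ⁻¹' (E ×ˢ F) =
        past α ⁻¹' E ∩ fut (α + n) ⁻¹' F := rfl
    rw [Measure.smul_apply, Measure.smul_apply, Measure.map_apply hpf hEF,
      Measure.map_apply hpf hEF, Measure.restrict_apply (hpf hEF),
      Measure.restrict_apply (hpf hEF), e, smul_eq_mul, smul_eq_mul]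
    have r1 := rect W hW E F hE hF
    have r2 := rect Set.univ MeasurableSet.univ E F hE hF
    simp only [Set.preimage_univ, Set.univ_inter] at r2
    have hp0 : μ {x | x 0 = a} * μ {x | x 0 = a} ≠ 0 := mul_ne_zero ha ha
    have hpt : μ {x | x 0 = a} * μ {x | x 0 = a} ≠ ∞ :=
      ENNReal.mul_ne_top (measure_ne_top _ _) (measure_ne_top _ _)
    rw [Set.inter_comm (past α ⁻¹' E ∩ fut (α + n) ⁻¹' F) (mid α n ⁻¹' W ∩ M),
      Set.inter_comm (past α ⁻¹' E ∩ fut (α + n) ⁻¹' F) M]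
    refine (ENNReal.mul_left_inj hp0 hpt).1 ?_
    rw [mul_assoc, r1, mul_assoc (μ (mid α n ⁻¹' W ∩ M)), r2]
    ring
  have := congrArg (fun m => m Z) hm
  rw [Measure.smul_apply, Measure.smul_apply, Measure.map_apply hpf hZ,
    Measure.map_apply hpf hZ, Measure.restrict_apply (hpf hZ),
    Measure.restrict_apply (hpf hZ), smul_eq_mul, smul_eq_mul,
    Set.inter_comm ((fun x => (past α x, fut (α + n) x)) ⁻¹' Z) (mid α n ⁻¹' W ∩ M),
    Set.inter_comm ((fun x => (past α x, fut (α + n) x)) ⁻¹' Z) M] at this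
  rw [mul_comm, this]

end Renewal
end
end KSCoding

open MeasureTheory Filter Asymptotics
open scoped ENNReal
namespace KSCoding
noncomputable section

/-! ### The law of fillers -/

section Law
variable {A : Type*} [Fintype A] [DecidableEq A] [MeasurableSpace A] [MeasurableSingletonClass A]

/-- `F` depends on the first `n` letters only. -/
def DepN {A β : Type*} (F : (ℕ → A) → β) (n : ℕ) : Prop :=
  ∀ f g : ℕ → A, (∀ k < n, f k = g k) → F f = F g

/-- A word as a sequence. -/
def wext {A : Type*} (a : A) {n : ℕ} (w : Fin n → A) : ℕ → A :=
  fun k => if h : k < n then w ⟨k, h⟩ else a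

omit [DecidableEq A] in
theorem measurableSet_of_depN (n : ℕ) (s : Set (ℕ → A)) (a : A)
    (hs : DepN (fun f => f ∈ s) n) : MeasurableSet s := by
  have e : s = (fun (f : ℕ → A) (i : Fin n) => f i) ⁻¹' {w | wext a w ∈ s} := by
    ext f
    change f ∈ s ↔ wext a (fun i : Fin n => f i) ∈ s
    exact iff_of_eq (hs _ _ fun k hk => by simp [wext, hk])
  rw [e]
  exact (measurable_pi_lambda (fun (f : ℕ → A) (i : Fin n) => f i)
    fun _ => measurable_pi_apply _) (Set.toFinite _).measurableSet

/-- The event that `x` has the skeleton `S` on `[α, α + |S|)`, followed by the renewal state. -/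
def Fit (a : A) (S : Skel) (α : ℤ) (x : ℤ → A) : Prop :=
  (∀ k < S.len, hat a x (α + k) = S.stx k) ∧ x (α + S.len) = a

/-- The event on which `fillerMeasure` is conditioned. -/
def HS (a : A) (S : Skel) : Set (ℤ → A) :=
  {x | (∀ j : Fin S.len, hat a x ((j : ℕ) : ℤ) = S.st j) ∧ x (S.len : ℤ) = a}

omit [Fintype A] [MeasurableSpace A] [MeasurableSingletonClass A] in
theorem mem_HS_iff (a : A) (S : Skel) (x : ℤ → A) : x ∈ HS a S ↔ Fit a S 0 x := by
  unfold HS Fit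
  simp only [Set.mem_ofPred_eq, zero_add]
  refine and_congr ?_ Iff.rfl
  constructor
  · intro h k hk
    rw [h ⟨k, hk⟩]; simp [Skel.stx, hk]
  · intro h j
    have := h j j.2
    rw [this]; simp [Skel.stx]

omit [Fintype A] [MeasurableSpace A] [MeasurableSingletonClass A] in
theorem fit_shN (a : A) (S : Skel) (α n : ℤ) (x : ℤ → A) :
    Fit a S α (shN n x) ↔ Fit a S (α + n) x := by
  unfold Fit
  have e1 : ∀ k : ℤ, hat a (shN n x) (α + k) = hat a x (α + n + k) := by
    intro k; rw [hat_shN]; simp only [shN]; congr 1; ring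
  have e2 : ∀ k : ℤ, shN n x (α + k) = x (α + n + k) := by
    intro k; simp only [shN]; congr 1; ring
  simp only [e1, e2]

omit [Fintype A] in
theorem measurableSet_fit (a : A) (S : Skel) (α : ℤ) : MeasurableSet {x | Fit a S α x} := by
  have : {x | Fit a S α x} =
      (⋂ k ∈ Set.Iio S.len, (hat a) ⁻¹' {y | y (α + (k : ℕ)) = S.stx k}) ∩
        {x | x (α + S.len) = a} := by
    ext x; simp [Fit]
  rw [this]
  refine MeasurableSet.inter (MeasurableSet.biInter (Set.to_countable _) fun k _ => ?_)
    (measurableSet_apply_eq _ _)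
  exact measurable_hat a (measurableSet_apply_eq _ _)

omit [Fintype A] in
theorem measurableSet_HS (a : A) (S : Skel) : MeasurableSet (HS a S) := by
  have : HS a S = {x | Fit a S 0 x} := by ext x; exact mem_HS_iff a S x
  rw [this]; exact measurableSet_fit a S 0

omit [Fintype A] [MeasurableSingletonClass A] [DecidableEq A] in
theorem measurable_word (n : ℕ) :
    Measurable (fun (x : ℤ → A) (j : Fin n) => x ((j : ℕ) : ℤ)) :=
  measurable_pi_lambda _ fun _ => measurable_pi_apply _

omit [Fintype A] in
theorem isProbabilityMeasure_fillerMeasure {μ : Measure (ℤ → A)} [IsProbabilityMeasure μ]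
    {a : A} {S : Skel} (h : μ (HS a S) ≠ 0) : IsProbabilityMeasure (fillerMeasure μ a S) := by
  have : IsProbabilityMeasure (ProbabilityTheory.cond μ (HS a S)) :=
    ProbabilityTheory.cond_isProbabilityMeasure h
  unfold fillerMeasure
  exact @Measure.isProbabilityMeasure_map _ _ _ _ _ this _ (measurable_word S.len).aemeasurable

theorem fillerMeasure_apply {μ : Measure (ℤ → A)} [IsProbabilityMeasure μ] (a : A) (S : Skel)
    (T : Set (Fin S.len → A)) : fillerMeasure μ a S T =
      (μ (HS a S))⁻¹ * μ (HS a S ∩ {x | (fun j : Fin S.len => x ((j : ℕ) : ℤ)) ∈ T}) := by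
  have hT : MeasurableSet T := (Set.toFinite _).measurableSet
  rw [fillerMeasure, Measure.map_apply (measurable_word S.len) hT]
  exact ProbabilityTheory.cond_apply (measurableSet_HS a S) _ _

open Classical in
/-- The law of a filler of `S`. -/
def lawW (μ : Measure (ℤ → A)) [IsProbabilityMeasure μ] (a : A) (S : Skel) :
    PMF (Fin S.len → A) :=
  if h : μ (HS a S) ≠ 0 then
    have := isProbabilityMeasure_fillerMeasure h
    (fillerMeasure μ a S).toPMF
  else PMF.pure fun _ => a

/-- The law of a function of a filler of `S`. -/
def lawF (μ : Measure (ℤ → A)) [IsProbabilityMeasure μ] (a : A) (S : Skel) {β : Type*}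
    (F : (ℕ → A) → β) : PMF β := (lawW μ a S).map fun w => F (wext a w)

variable {μ : Measure (ℤ → A)} [IsProbabilityMeasure μ] {a : A}

theorem lawW_toOuterMeasure {S : Skel} (h : μ (HS a S) ≠ 0) (T : Set (Fin S.len → A)) :
    (lawW μ a S).toOuterMeasure T = fillerMeasure μ a S T := by
  have := isProbabilityMeasure_fillerMeasure h
  rw [lawW, dif_pos h, ← PMF.toMeasure_apply_eq_toOuterMeasure_apply _
    (Set.toFinite _).measurableSet, Measure.toPMF_toMeasure]

theorem lawF_toOuterMeasure {S : Skel} (h : μ (HS a S) ≠ 0) {β : Type*} (F : (ℕ → A) → β)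
    (C : Set β) :
    (lawF μ a S F).toOuterMeasure C = fillerMeasure μ a S {w | F (wext a w) ∈ C} := by
  rw [lawF, PMF.toOuterMeasure_map_apply, lawW_toOuterMeasure h]
  rfl

theorem mul_lawF_toOuterMeasure {S : Skel} (h : μ (HS a S) ≠ 0) {β : Type*} (F : (ℕ → A) → β)
    (hF : DepN F S.len) (C : Set β) :
    μ (HS a S) * (lawF μ a S F).toOuterMeasure C =
      μ (HS a S ∩ {x | F (fun k : ℕ => x k) ∈ C}) := by
  rw [lawF_toOuterMeasure h, fillerMeasure_apply, ← mul_assoc,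
    ENNReal.mul_inv_cancel h (measure_ne_top _ _), one_mul]
  congr 2
  ext x
  simp only [Set.mem_ofPred_eq]
  rw [hF (wext a fun j : Fin S.len => x ((j : ℕ) : ℤ)) (fun k : ℕ => x k)
    (fun k hk => by simp [wext, hk])]

theorem pmf_toOuterMeasure_singleton {β : Type*} (p : PMF β) (b : β) :
    p.toOuterMeasure {b} = p b := by
  exact PMF.toOuterMeasure_apply_singleton p b

theorem mul_lawF_apply {S : Skel} (h : μ (HS a S) ≠ 0) {β : Type*} (F : (ℕ → A) → β)
    (hF : DepN F S.len) (c : β) :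
    μ (HS a S) * lawF μ a S F c = μ (HS a S ∩ {x | F (fun k : ℕ => x k) = c}) := by
  rw [← pmf_toOuterMeasure_singleton, mul_lawF_toOuterMeasure h F hF]
  rfl

theorem finite_support_lawF (S : Skel) {β : Type*} (F : (ℕ → A) → β) :
    (lawF μ a S F).support.Finite := by
  rw [lawF, PMF.support_map]
  exact (Set.toFinite _).image _

/-- The inverse of the restriction to the coordinates outside of an interval. -/
def glue (a : A) (α β : ℤ) (z : (ℕ → A) × (ℕ → A)) : ℤ → A := fun i =>
  if i ≤ α then z.1 (α - i).toNat else if β ≤ i then z.2 (i - β).toNat else a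

omit [Fintype A] [DecidableEq A] [MeasurableSingletonClass A] in
theorem measurable_glue (a : A) (α β : ℤ) : Measurable (glue a α β) := by
  refine measurable_pi_lambda _ fun i => ?_
  unfold glue
  by_cases h1 : i ≤ α
  · simp only [h1, if_true]; exact (measurable_pi_apply _).comp measurable_fst
  · by_cases h2 : β ≤ i
    · simp only [h1, h2, if_true, if_false]; exact (measurable_pi_apply _).comp measurable_snd
    · simp only [h1, h2, if_false]; exact measurable_const

/-- The skeleton starts with `a` and is followed by `a`, so `renewal_mid` applies. The event `Z`
ignores the coordinates strictly between; `glue` rewrites it as an event of the past and the future.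
-/
theorem fit_law (hs : MeasurePreserving shift μ μ) (hr : IsRenewalState μ a)
    (ha : μ {x | x 0 = a} ≠ 0) (S : Skel) (hlen : 0 < S.len) (hS : S.stx 0 = true)
    (hpos : μ (HS a S) ≠ 0) {β : Type*} (F : (ℕ → A) → β) (hF : DepN F S.len) (c : β) (α : ℤ)
    (Z : Set (ℤ → A)) (hZ : MeasurableSet Z)
    (hZd : ∀ x y : ℤ → A, (∀ i, i ≤ α ∨ α + S.len ≤ i → x i = y i) → (x ∈ Z ↔ y ∈ Z)) :
    μ {x | Fit a S α x ∧ F (fun k : ℕ => x (α + k)) = c ∧ x ∈ Z} =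
      lawF μ a S F c * μ {x | Fit a S α x ∧ x ∈ Z} := by
  set n := S.len with hn
  set M : Set (ℤ → A) := {x | x α = a} ∩ {x | x (α + n) = a} with hM
  set pf : (ℤ → A) → (ℕ → A) × (ℕ → A) := fun x => (past α x, fut (α + n) x) with hpf
  have hZ' : MeasurableSet (glue a α (α + n) ⁻¹' Z) := measurable_glue a α _ hZ
  have hZe : pf ⁻¹' (glue a α (α + n) ⁻¹' Z) = Z := by
    ext x
    change glue a α (α + n) (pf x) ∈ Z ↔ x ∈ Z
    refine hZd _ _ fun i hi => ?_
    unfold glue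
    by_cases h1 : i ≤ α
    · rw [if_pos h1]; simp only [hpf, past]; congr 1; omega
    · rw [if_neg h1, if_pos (hi.resolve_left h1)]; simp only [hpf, fut]; congr 1; omega
  have hmid : ∀ x : ℤ → A, ∀ k < n, mid α n x k = x (α + k) := by
    intro x k hk; simp only [mid, min_eq_left hk.le]
  let W1 : Set (ℕ → A) := {f | ∀ k < n, decide (f k = a) = S.stx k}
  let W2 : Set (ℕ → A) := {f | (∀ k < n, decide (f k = a) = S.stx k) ∧ F f = c}
  have hW1 : MeasurableSet W1 := by
    refine measurableSet_of_depN n _ a fun f g hfg => ?_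
    refine propext (forall_congr' fun k => forall_congr' fun hk => ?_)
    rw [hfg k hk]
  have hW2 : MeasurableSet W2 := by
    refine measurableSet_of_depN n _ a fun f g hfg => ?_
    refine propext (and_congr (forall_congr' fun k => forall_congr' fun hk => ?_) ?_)
    · rw [hfg k hk]
    · rw [hF f g hfg]
  have hfit : {x | Fit a S α x} = mid α n ⁻¹' W1 ∩ M := by
    ext x
    simp only [Set.mem_ofPred_eq, Set.mem_inter_iff, Set.mem_preimage, W1, Fit, hM]
    have e1 : (∀ k < n, decide (mid α n x k = a) = S.stx k) ↔
        ∀ k < n, hat a x (α + k) = S.stx k :=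
      forall_congr' fun k => forall_congr' fun hk => by rw [hmid x k hk]; rfl
    rw [e1]
    refine and_congr_right fun h => ?_
    have := h 0 hlen
    rw [hS] at this
    simp only [hat, decide_eq_true_eq, Nat.cast_zero, add_zero] at this
    simp [this, ← hn]
  have hfit2 : {x | Fit a S α x ∧ F (fun k : ℕ => x (α + k)) = c} = mid α n ⁻¹' W2 ∩ M := by
    have : mid α n ⁻¹' W2 = mid α n ⁻¹' W1 ∩ {x | F (fun k : ℕ => x (α + k)) = c} := by
      ext x
      simp only [Set.mem_inter_iff, Set.mem_preimage, W1, W2, Set.mem_ofPred_eq]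
      rw [hF (mid α n x) (fun k : ℕ => x (α + k)) (hmid x)]
    rw [this, Set.inter_assoc, Set.inter_comm _ M, ← Set.inter_assoc, ← hfit]
    rfl
  have r1 := renewal_mid hs hr ha α n W1 hW1 _ hZ'
  have r2 := renewal_mid hs hr ha α n W2 hW2 _ hZ'
  rw [← hpf, hZe, ← hM] at r1 r2
  rw [← hfit] at r1
  rw [← hfit2] at r2
  have s1 : μ {x | Fit a S α x} = μ (HS a S) := by
    rw [← measure_shN hs α (HS a S)]
    congr 1; ext x
    change Fit a S α x ↔ shN α x ∈ HS a S
    rw [mem_HS_iff, fit_shN, zero_add]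
  have s2 : μ {x | Fit a S α x ∧ F (fun k : ℕ => x (α + k)) = c} =
      μ (HS a S) * lawF μ a S F c := by
    rw [mul_lawF_apply hpos F hF,
      ← measure_shN hs α (HS a S ∩ {x | F (fun k : ℕ => x k) = c})]
    congr 1; ext x
    change _ ↔ shN α x ∈ HS a S ∧ F (fun k : ℕ => shN α x k) = c
    rw [mem_HS_iff, fit_shN, zero_add]
    have : (fun k : ℕ => shN α x k) = fun k : ℕ => x (α + k) := by
      funext k; simp only [shN, add_comm]
    rw [this]; rfl
  rw [s1] at r1
  rw [s2] at r2
  have hM0 : μ M ≠ 0 := by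
    intro h0
    refine hpos (le_antisymm ?_ bot_le)
    rw [← s1, hfit, ← h0]
    exact measure_mono Set.inter_subset_right
  have t1 : {x | Fit a S α x ∧ F (fun k : ℕ => x (α + k)) = c ∧ x ∈ Z} =
      {x | Fit a S α x ∧ F (fun k : ℕ => x (α + k)) = c} ∩ Z := by
    ext x; simp only [Set.mem_ofPred_eq, Set.mem_inter_iff, and_assoc]
  have t2 : {x | Fit a S α x ∧ x ∈ Z} = {x | Fit a S α x} ∩ Z := rfl
  rw [t1, t2]
  refine (ENNReal.mul_left_inj hM0 (measure_ne_top _ _)).1 ?_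
  rw [r2, mul_assoc (lawF μ a S F c), r1]
  ring

omit [DecidableEq A] in
theorem measurableSet_map_eq {β : Type*} (α : ℤ) (F : ℕ × ℕ → (ℕ → A) → β) (N : ℕ × ℕ → ℕ)
    (a : A) (l : List (ℕ × ℕ)) : (∀ z ∈ l, DepN (F z) (N z)) → ∀ q : List β,
    MeasurableSet {x : ℤ → A | l.map (fun z => F z fun k : ℕ => x (α + z.1 + k)) = q} := by
  induction l with
  | nil =>
    intro _ q
    by_cases h : q = []
    · subst h; simp
    · simp [Ne.symm h]
  | cons z l ih =>
    intro h q
    cases q with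
    | nil => simp
    | cons c q =>
      simp only [List.map_cons, List.cons.injEq]
      refine MeasurableSet.inter ?_ (ih (fun z hz => h z (by simp [hz])) q)
      have hd := h z (by simp)
      exact measurable_fut (α + z.1) (measurableSet_of_depN (N z) {f | F z f = c} a
        fun f g hfg => by
          change (F z f = c) = (F z g = c)
          rw [hd f g hfg])

/-- Given `X̂`, the fillers of consecutive skeletons are independent with the laws `μ_S`. -/
theorem chain_law (hs : MeasurePreserving shift μ μ) (hr : IsRenewalState μ a)
    (ha : μ {x | x 0 = a} ≠ 0) {β : Type*} (α : ℤ) (T : ℕ × ℕ → Skel)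
    (F : ℕ × ℕ → (ℕ → A) → β) (G : Set (ℤ → Bool)) (hG : MeasurableSet G)
    {u v : ℕ} {l : List (ℕ × ℕ)} (hl : Chn u v l) :
    (∀ z ∈ l, (T z).len = z.2 - z.1 ∧ (T z).stx 0 = true ∧ μ (HS a (T z)) ≠ 0 ∧
      DepN (F z) (T z).len) →
    (∀ x, hat a x ∈ G → ∀ z ∈ l, Fit a (T z) (α + z.1) x) → ∀ q : List β,
    μ {x | hat a x ∈ G ∧ l.map (fun z => F z fun k : ℕ => x (α + z.1 + k)) = q} =
      μ {x | hat a x ∈ G} * listProd (l.map fun z => lawF μ a (T z) (F z)) q := by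
  induction hl with
  | nil =>
    intro _ _ q
    cases q with
    | nil => simp [listProd_nil_nil]
    | cons c q => simp [listProd_nil_cons]
  | @cons u w v l huw hl ih =>
    intro hT hfit q
    cases q with
    | nil => simp [listProd_cons_nil]
    | cons c q =>
      obtain ⟨hlen, hst, hpos, hdep⟩ := hT (u, w) (by simp)
      simp only at hlen
      have ih' := ih (fun z hz => hT z (by simp [hz])) (fun x hx z hz => hfit x hx z (by simp [hz])) q
      let S := T (u, w)
      -- The event `G` sees the first interval, so it cannot serve as `Z` in `fit_law`. Overwriting
      -- that interval by the word of `S` removes the dependence, and changes nothing on samples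
      -- that fit `S`.
      let spl : (ℤ → Bool) → ℤ → Bool := fun ω i =>
        if α + u ≤ i ∧ i < α + w then S.stx (i - (α + u)).toNat else ω i
      have hspl : Measurable spl := by
        refine measurable_pi_lambda _ fun i => ?_
        by_cases hi : α + u ≤ i ∧ i < α + w
        · simp only [spl, hi, and_self, if_true]; exact measurable_const
        · simp only [spl, if_neg hi]; exact measurable_pi_apply i
      let Z : Set (ℤ → A) := {x | spl (hat a x) ∈ G ∧
        l.map (fun z => F z fun k : ℕ => x (α + z.1 + k)) = q}
      have hZ : MeasurableSet Z := by
        refine MeasurableSet.inter (hspl.comp (measurable_hat a) hG) ?_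
        exact measurableSet_map_eq α F (fun z => (T z).len) a l
          (fun z hz => (hT z (by simp [hz])).2.2.2) q
      have hsplfit : ∀ x, Fit a S (α + u) x → spl (hat a x) = hat a x := by
        intro x hx
        funext i
        by_cases hi : α + u ≤ i ∧ i < α + w
        · simp only [spl, hi, and_self, if_true]
          have hk : (i - (α + u)).toNat < S.len := by
            change _ < (T (u, w)).len; omega
          rw [← hx.1 _ hk]
          congr 1; omega
        · simp only [spl, if_neg hi]
      have hZd : ∀ x y : ℤ → A, (∀ i, i ≤ α + u ∨ α + u + S.len ≤ i → x i = y i) →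
          (x ∈ Z ↔ y ∈ Z) := by
        intro x y hxy
        have hSl : (S.len : ℤ) = w - u := by
          change ((T (u, w)).len : ℤ) = _; omega
        have e1 : spl (hat a x) = spl (hat a y) := by
          funext i
          by_cases hi : α + u ≤ i ∧ i < α + w
          · simp only [spl, hi, and_self, if_true]
          · simp only [spl, if_neg hi, hat]
            rw [hxy i (by omega)]
        have e2 : l.map (fun z => F z fun k : ℕ => x (α + z.1 + k)) =
            l.map (fun z => F z fun k : ℕ => y (α + z.1 + k)) := by
          refine List.map_congr_left fun z hz => ?_
          have hzm := (hl.mem z hz).1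
          congr 1
          funext k
          exact hxy _ (by omega)
        change (spl (hat a x) ∈ G ∧ _ = q) ↔ (spl (hat a y) ∈ G ∧ _ = q)
        rw [e1, e2]
      have hSlen : 0 < S.len := by change 0 < (T (u, w)).len; omega
      have key := fit_law hs hr ha S hSlen hst hpos (F (u, w)) hdep c (α + u) Z hZ hZd
      have e1 : {x | hat a x ∈ G ∧
          ((u, w) :: l).map (fun z => F z fun k : ℕ => x (α + z.1 + k)) = c :: q} =
          {x | Fit a S (α + u) x ∧ F (u, w) (fun k : ℕ => x (α + u + k)) = c ∧ x ∈ Z} := by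
        ext x
        simp only [List.map_cons, List.cons.injEq, Set.mem_ofPred_eq, Z]
        constructor
        · rintro ⟨h1, h2, h3⟩
          have hx := hfit x h1 (u, w) (by simp)
          exact ⟨hx, h2, by rw [hsplfit x hx]; exact h1, h3⟩
        · rintro ⟨hx, h2, h1, h3⟩
          rw [hsplfit x hx] at h1
          exact ⟨h1, h2, h3⟩
      have e2 : {x | Fit a S (α + u) x ∧ x ∈ Z} = {x | hat a x ∈ G ∧
          l.map (fun z => F z fun k : ℕ => x (α + z.1 + k)) = q} := by
        ext x
        simp only [Set.mem_ofPred_eq, Z]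
        constructor
        · rintro ⟨hx, h1, h3⟩
          rw [hsplfit x hx] at h1
          exact ⟨h1, h3⟩
        · rintro ⟨h1, h3⟩
          have hx := hfit x h1 (u, w) (by simp)
          exact ⟨hx, by rw [hsplfit x hx]; exact h1, h3⟩
      rw [e1, key, e2, ih', List.map_cons, listProd_cons_apply]
      ring

end Law
end
end KSCoding

open MeasureTheory Filter Asymptotics
open scoped ENNReal
namespace KSCoding
noncomputable section

set_option linter.unusedSectionVars false

/-! ### Codes of classes of fillers -/

instance countable_skel : Countable Skel := by
  have : Function.Injective
      (fun S : Skel => (⟨S.len, S.st, S.lab⟩ : Σ n : ℕ, (Fin n → Bool) × (Fin n → ℕ))) := by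
    rintro ⟨n, s, l⟩ ⟨n', s', l'⟩ h
    simp only [Sigma.mk.injEq] at h
    obtain ⟨rfl, h⟩ := h
    have := eq_of_heq h
    simp only [Prod.mk.injEq] at this
    rw [this.1, this.2]
  exact this.countable

section Codes
variable {A : Type*} [Fintype A] [DecidableEq A] [MeasurableSpace A] [MeasurableSingletonClass A]
variable {a : A}

instance finite_filler (a : A) (S : Skel) : Finite (Filler a S) := by
  unfold Filler; infer_instance

/-- `f` starts with a filler of `S`. -/
def Vld (a : A) (S : Skel) (f : ℕ → A) : Prop := ∀ k < S.len, decide (f k = a) = S.stx k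

/-- The filler with which `f` starts. -/
def toFil {S : Skel} {f : ℕ → A} (h : Vld a S f) : Filler a S :=
  ⟨fun j => f j, fun j => by
    have := h j j.2
    rw [this]; simp [Skel.stx]⟩

theorem Vld.congr {S : Skel} {f g : ℕ → A} (h : ∀ k < S.len, f k = g k) (hf : Vld a S f) :
    Vld a S g := fun k hk => by rw [← h k hk]; exact hf k hk

/-- `f` and `g` start with equivalent fillers of `S`. -/
def Rl (rel : (S : Skel) → Setoid (Filler a S)) (S : Skel) (f g : ℕ → A) : Prop :=
  ∃ (hf : Vld a S f) (hg : Vld a S g), rel S (toFil hf) (toFil hg)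

theorem exists_enc (rel : (S : Skel) → Setoid (Filler a S)) :
    ∃ e : (Σ S : Skel, Option (Quotient (rel S))) → ℕ, Function.Injective e :=
  have : ∀ S, Countable (Option (Quotient (rel S))) := fun _ => Finite.to_countable
  Countable.exists_injective_nat _

open Classical in
/-- A code of the class of the filler of `S` with which `f` starts. Classes are not distinguished
on skeletons of length less than `N`. -/
def code (rel : (S : Skel) → Setoid (Filler a S)) (N : ℕ) (S : Skel) (f : ℕ → A) : ℕ :=
  -- The number of classes is controlled only on long skeletons; short ones get a single symbol, so
  -- that they contribute nothing to the counting.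
  if h : Vld a S f ∧ N ≤ S.len then (exists_enc rel).choose ⟨S, some (Quotient.mk (rel S) (toFil h.1))⟩
  else (exists_enc rel).choose ⟨S, none⟩

variable {rel : (S : Skel) → Setoid (Filler a S)} {N : ℕ}

theorem code_depN (S : Skel) : DepN (code rel N S) S.len := by
  intro f g hfg
  by_cases h : Vld a S f ∧ N ≤ S.len
  · have h' : Vld a S g ∧ N ≤ S.len := ⟨h.1.congr hfg, h.2⟩
    rw [code, code, dif_pos h, dif_pos h']
    have e : toFil h.1 = toFil h'.1 := Subtype.ext (funext fun j => hfg j j.2)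
    rw [e]
  · have h' : ¬ (Vld a S g ∧ N ≤ S.len) := fun h' => h ⟨h'.1.congr fun k hk => (hfg k hk).symm, h'.2⟩
    rw [code, code, dif_neg h, dif_neg h']

theorem rl_of_code_eq {S : Skel} {f g : ℕ → A} (hf : Vld a S f) (hg : Vld a S g)
    (hN : N ≤ S.len) (h : code rel N S f = code rel N S g) : Rl rel S f g := by
  have hinj := (exists_enc rel).choose_spec
  rw [code, code, dif_pos ⟨hf, hN⟩, dif_pos ⟨hg, hN⟩] at h
  have := hinj h
  simp only [Sigma.mk.injEq, heq_eq_eq, true_and, Option.some.injEq] at this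
  exact ⟨hf, hg, Quotient.exact this⟩

theorem code_eq_of_rl {S : Skel} {f g : ℕ → A} (hf : Vld a S f) (hg : Vld a S g)
    (h : N ≤ S.len → Rl rel S f g) : code rel N S f = code rel N S g := by
  by_cases hN : N ≤ S.len
  · obtain ⟨h1, h2, h3⟩ := h hN
    rw [code, code, dif_pos ⟨hf, hN⟩, dif_pos ⟨hg, hN⟩, Quotient.sound h3]
  · rw [code, code, dif_neg (fun h => hN h.2), dif_neg (fun h => hN h.2)]

theorem vld_of_hat {ω : ℤ → Bool} {x : ℤ → A} (hx : hat a x = ω) (τ : ℕ → ℕ) (m : ℤ → ℕ)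
    (α β : ℤ) : Vld a (skelOn τ ω m α β) (fun k => x (α + k)) := by
  intro k hk
  have : (k : ℤ) < β - α := by
    have : k < (β - α).toNat := hk
    omega
  rw [skelOn_stx _ _ _ _ _ _ this, ← hx]
  rfl

theorem rl_skelOn {ω : ℤ → Bool} {x y : ℤ → A} (hx : hat a x = ω) (hy : hat a y = ω)
    (τ : ℕ → ℕ) (m : ℤ → ℕ) (α β : ℤ) :
    Rl rel (skelOn τ ω m α β) (fun k => x (α + k)) (fun k => y (α + k)) ↔
      (rel _) (fillerOn a τ m ω x hx α β) (fillerOn a τ m ω y hy α β) :=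
  ⟨fun ⟨_, _, h⟩ => h, fun h => ⟨vld_of_hat hx τ m α β, vld_of_hat hy τ m α β, h⟩⟩

/-- The refinement property of a system of fillers at `ω`. -/
def RefinesAt (rel : (S : Skel) → Setoid (Filler a S)) (ξ : (ℤ → Bool) → ℤ → ℕ) (τ : ℕ → ℕ)
    (ω : ℤ → Bool) : Prop :=
  ∀ α γ α' γ' : ℤ,
    IsSkeleton (ξ ω) α γ → IsSkeleton (ξ ω) α' γ' → α ≤ α' → γ' ≤ γ →
    ∀ (x y : ℤ → A) (hx : hat a x = ω) (hy : hat a y = ω),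
      (rel _) (fillerOn a τ (ξ ω) ω x hx α γ) (fillerOn a τ (ξ ω) ω y hy α γ) →
      (rel _) (fillerOn a τ (ξ ω) ω x hx α' γ') (fillerOn a τ (ξ ω) ω y hy α' γ')

/-- The refinement property speaks of bi-infinite samples with the given marked states. The words
are spliced into the reference sample `x₀`, which supplies the coordinates outside. -/
theorem RefinesAt.rl {ξ : (ℤ → Bool) → ℤ → ℕ} {τ : ℕ → ℕ} {ω : ℤ → Bool}
    (h : RefinesAt rel ξ τ ω) {x₀ : ℤ → A} (hx₀ : hat a x₀ = ω) {α β : ℤ} {u v : ℕ}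
    (h1 : IsSkeleton (ξ ω) α β) (h2 : IsSkeleton (ξ ω) (α + u) (α + v)) (hv : α + v ≤ β)
    {f g : ℕ → A} (hfg : Rl rel (skelOn τ ω (ξ ω) α β) f g) :
    Rl rel ((skelOn τ ω (ξ ω) α β).sub τ u v) (fun k => f (u + k)) (fun k => g (u + k)) := by
  have huv : u < v := by have := h2.1; omega
  rw [skelOn_sub _ _ _ _ _ _ _ huv (by omega)]
  let spl : (ℕ → A) → ℤ → A := fun f i => if α ≤ i ∧ i < β then f (i - α).toNat else x₀ i
  have hs1 : ∀ f : ℕ → A, ∀ k : ℕ, (k : ℤ) < β - α → spl f (α + k) = f k := by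
    intro f k hk
    have : α ≤ α + (k : ℤ) ∧ α + (k : ℤ) < β := ⟨by omega, by omega⟩
    simp only [spl, this, and_self, if_true]
    congr 1; omega
  have hs2 : ∀ f : ℕ → A, Vld a (skelOn τ ω (ξ ω) α β) f → hat a (spl f) = ω := by
    intro f hf
    funext i
    by_cases hi : α ≤ i ∧ i < β
    · obtain ⟨k, hk⟩ := Int.eq_ofNat_of_zero_le (show 0 ≤ i - α by omega)
      have hi' : i = α + (k : ℤ) := by omega
      rw [hi', hat, hs1 f k (by omega)]
      have hkl : k < (skelOn τ ω (ξ ω) α β).len := by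
        change k < (β - α).toNat; omega
      rw [hf k hkl, skelOn_stx _ _ _ _ _ _ (by omega)]
    · simp only [hat, spl, if_neg hi]
      rw [← hx₀]; rfl
  obtain ⟨hf, hg, hr⟩ := hfg
  have key := h α β (α + u) (α + v) h1 h2 (by omega) hv (spl f) (spl g) (hs2 f hf) (hs2 g hg) (by
    have e1 : fillerOn a τ (ξ ω) ω (spl f) (hs2 f hf) α β = toFil hf := by
      refine Subtype.ext (funext fun j => ?_)
      have : (j : ℕ) < (β - α).toNat := j.2
      exact hs1 f j (by omega)
    have e2 : fillerOn a τ (ξ ω) ω (spl g) (hs2 g hg) α β = toFil hg := by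
      refine Subtype.ext (funext fun j => ?_)
      have : (j : ℕ) < (β - α).toNat := j.2
      exact hs1 g j (by omega)
    rw [e1, e2]; exact hr)
  have key2 := (rl_skelOn (rel := rel) (hs2 f hf) (hs2 g hg) τ (ξ ω) (α + u) (α + v)).2 key
  have e : ∀ f : ℕ → A, ∀ k < (skelOn τ ω (ξ ω) (α + u) (α + v)).len,
      spl f (α + u + k) = f (u + k) := by
    intro f k hk
    have : k < (α + v - (α + u)).toNat := hk
    have e' := hs1 f (u + k) (by push_cast; omega)
    rw [← e']; congr 1; push_cast; ring
  obtain ⟨k1, k2, k3⟩ := key2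
  refine ⟨k1.congr (e f), k2.congr (e g), ?_⟩
  have e1 : toFil (k1.congr (e f)) = toFil k1 :=
    Subtype.ext (funext fun j => (e f j j.2).symm)
  have e2 : toFil (k2.congr (e g)) = toFil k2 :=
    Subtype.ext (funext fun j => (e g j j.2).symm)
  rw [e1, e2]; exact k3

/-! ### Products of laws over the pieces -/

/-- Marks of a skeleton: labels are carried by renewal times. -/
structure Mk (S : Skel) : Prop where
  pos : 0 < S.len
  zero : S.stx 0 = true
  -- The coordinate `0` is left to the previous field, since its label is known only through `τ`.
  mark : ∀ k < S.len, k ≠ 0 → 1 ≤ S.labx k → S.stx k = true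

theorem sub_stx (τ : ℕ → ℕ) (S : Skel) (u v k : ℕ) (hk : k < v - u) :
    (S.sub τ u v).stx k = S.stx (u + k) := by
  have : (S.sub τ u v).len = v - u := rfl
  rw [Skel.stx, dif_pos (by rw [this]; exact hk)]
  rfl

theorem sub_labx (τ : ℕ → ℕ) (S : Skel) (u v k : ℕ) (hk : k < v - u) (hk0 : k ≠ 0) :
    (S.sub τ u v).labx k = S.labx (u + k) := by
  have : (S.sub τ u v).len = v - u := rfl
  rw [Skel.labx, dif_pos (by rw [this]; exact hk)]
  change (if k = 0 ∧ u ≠ 0 then _ else _) = _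
  rw [if_neg (by tauto)]

theorem Mk.sub {S : Skel} (h : Mk S) (τ : ℕ → ℕ) {r : ℕ} (hr : 1 ≤ r) {z : ℕ × ℕ}
    (hz : z ∈ pcs r S) : Mk (S.sub τ z.1 z.2) := by
  obtain ⟨-, h2, h3⟩ := (pcs_chn r S).mem z hz
  obtain ⟨h4, -, -⟩ := pcs_mem r S z hz
  refine ⟨?_, ?_, ?_⟩
  · change 0 < z.2 - z.1; omega
  · rw [sub_stx _ _ _ _ _ (by omega), add_zero]
    by_cases h0 : z.1 = 0
    · rw [h0]; exact h.zero
    · exact h.mark _ (by omega) h0 (hr.trans (h4.resolve_left h0))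
  · intro k hk hk0 hl
    have hk' : k < z.2 - z.1 := hk
    rw [sub_stx _ _ _ _ _ hk']
    rw [sub_labx _ _ _ _ _ hk' hk0] at hl
    exact h.mark _ (by omega) (by omega) hl

variable {μ : Measure (ℤ → A)} [IsProbabilityMeasure μ]

theorem Mk.fit_sub {S : Skel} (h : Mk S) (τ : ℕ → ℕ) {r : ℕ} (hr : 1 ≤ r) {z : ℕ × ℕ}
    (hz : z ∈ pcs r S) {α : ℤ} {x : ℤ → A} (hx : Fit a S α x) :
    Fit a (S.sub τ z.1 z.2) (α + z.1) x := by
  obtain ⟨-, h2, h3⟩ := (pcs_chn r S).mem z hz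
  obtain ⟨-, h5, -⟩ := pcs_mem r S z hz
  have hl : (S.sub τ z.1 z.2).len = z.2 - z.1 := rfl
  refine ⟨fun k hk => ?_, ?_⟩
  · rw [hl] at hk
    rw [sub_stx _ _ _ _ _ hk, ← hx.1 _ (by omega)]
    congr 1; push_cast; ring
  · have e : α + z.1 + ((S.sub τ z.1 z.2).len : ℤ) = α + z.2 := by rw [hl]; omega
    rw [e]
    by_cases h0 : z.2 = S.len
    · rw [h0]; exact hx.2
    · have h1 := h.mark z.2 (by omega) (by omega) (hr.trans (h5.resolve_left h0))
      rw [← hx.1 z.2 (by omega)] at h1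
      simpa [hat] using h1

theorem measure_HS_eq (hs : MeasurePreserving shift μ μ) (S : Skel) (α : ℤ) :
    μ {x | Fit a S α x} = μ (HS a S) := by
  rw [← measure_shN hs α (HS a S)]
  congr 1; ext x
  change Fit a S α x ↔ shN α x ∈ HS a S
  rw [mem_HS_iff, fit_shN, zero_add]

theorem Mk.HS_sub_ne_zero (hs : MeasurePreserving shift μ μ) {S : Skel} (h : Mk S) (τ : ℕ → ℕ)
    {r : ℕ} (hr : 1 ≤ r) {z : ℕ × ℕ} (hz : z ∈ pcs r S) (hpos : μ (HS a S) ≠ 0) :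
    μ (HS a (S.sub τ z.1 z.2)) ≠ 0 := by
  rw [← measure_HS_eq hs _ (0 + (z.1 : ℤ))]
  intro h0
  refine hpos (le_antisymm ?_ bot_le)
  rw [← h0, ← measure_HS_eq hs _ 0]
  exact measure_mono fun x hx => h.fit_sub τ hr hz hx

/-- The law of a list of functions of the fillers of the pieces of `S`. -/
theorem lawF_pieces (hs : MeasurePreserving shift μ μ) (hr : IsRenewalState μ a)
    (ha : μ {x | x 0 = a} ≠ 0) {S : Skel} (h : Mk S) (hpos : μ (HS a S) ≠ 0) (τ : ℕ → ℕ)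
    {r : ℕ} (hr1 : 1 ≤ r) {β : Type*} (F : ℕ × ℕ → (ℕ → A) → β)
    (hF : ∀ z ∈ pcs r S, DepN (F z) (z.2 - z.1)) :
    lawF μ a S (fun f => (pcs r S).map fun z => F z fun k => f (z.1 + k)) =
      listProd ((pcs r S).map fun z => lawF μ a (S.sub τ z.1 z.2) (F z)) := by
  let G : Set (ℤ → Bool) := {ω | (∀ k < S.len, ω k = S.stx k) ∧ ω S.len = true}
  have hG : MeasurableSet G := by
    have : G = (⋂ k ∈ Set.Iio S.len, {y : ℤ → Bool | y (k : ℕ) = S.stx k}) ∩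
        {x | x (S.len : ℤ) = true} := by
      ext x; simp [G]
    rw [this]
    exact (MeasurableSet.biInter (Set.to_countable _) fun k _ => measurableSet_apply_eq _ _).inter
      (measurableSet_apply_eq _ _)
  have hGe : {x | hat a x ∈ G} = HS a S := by
    ext x
    rw [mem_HS_iff]
    simp [G, Fit, hat]
  have hfit : ∀ x, hat a x ∈ G → ∀ z ∈ pcs r S, Fit a (S.sub τ z.1 z.2) (0 + z.1) x := by
    intro x hx z hz
    refine h.fit_sub τ hr1 hz ?_
    rw [← mem_HS_iff, ← hGe]; exact hx
  ext q
  have key := chain_law hs hr ha 0 (fun z => S.sub τ z.1 z.2) F G hG (pcs_chn r S)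
    (fun z hz => ⟨rfl, (h.sub τ hr1 hz).zero, h.HS_sub_ne_zero hs τ hr1 hz hpos, hF z hz⟩) hfit q
  rw [hGe] at key
  refine (ENNReal.mul_right_inj hpos (measure_ne_top _ _)).1 ?_
  rw [← key, mul_lawF_apply hpos]
  · congr 1
    ext x
    rw [← hGe]
    simp
  · intro f g hfg
    refine List.map_congr_left fun z hz => hF z hz _ _ fun k hk => ?_
    obtain ⟨-, h2, h3⟩ := (pcs_chn r S).mem z hz
    exact hfg _ (by omega)

theorem vld_of_lawW_ne_zero {S : Skel} (hpos : μ (HS a S) ≠ 0) {w : Fin S.len → A}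
    (hw : lawW μ a S w ≠ 0) : Vld a S (wext a w) := by
  rw [← pmf_toOuterMeasure_singleton, lawW_toOuterMeasure hpos, fillerMeasure_apply] at hw
  have h2 := right_ne_zero_of_mul hw
  obtain ⟨x, hx1, hx2⟩ := nonempty_of_measure_ne_zero h2
  rw [mem_HS_iff] at hx1
  intro k hk
  rw [← hx1.1 k hk]
  have : (fun j : Fin S.len => x ((j : ℕ) : ℤ)) = w := hx2
  simp only [wext, hk, dif_pos, ← this, hat, zero_add]

/-- Functions that agree on valid words have the same law. -/
theorem lawF_congr {S : Skel} (hpos : μ (HS a S) ≠ 0) {β : Type*} {F F' : (ℕ → A) → β}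
    (h : ∀ f, Vld a S f → F f = F' f) : lawF μ a S F = lawF μ a S F' := by
  classical
  ext c
  rw [lawF, lawF, PMF.map_apply, PMF.map_apply]
  refine tsum_congr fun w => ?_
  by_cases hw : lawW μ a S w = 0
  · simp [hw]
  · rw [h _ (vld_of_lawW_ne_zero hpos hw)]

theorem exists_vld_of_lawF_ne_zero {S : Skel} (hpos : μ (HS a S) ≠ 0) {β : Type*}
    {F : (ℕ → A) → β} {c : β} (h : lawF μ a S F c ≠ 0) :
    ∃ w : Fin S.len → A, lawW μ a S w ≠ 0 ∧ Vld a S (wext a w) ∧ F (wext a w) = c := by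
  have : c ∈ (lawF μ a S F).support := h
  rw [lawF, PMF.support_map] at this
  obtain ⟨w, hw, rfl⟩ := this
  exact ⟨w, hw, vld_of_lawW_ne_zero hpos hw, rfl⟩

theorem lawF_map {S : Skel} {β γ : Type*} (F : (ℕ → A) → β) (g : β → γ) :
    (lawF μ a S F).map g = lawF μ a S (fun f => g (F f)) := by
  rw [lawF, PMF.map_comp]; rfl

end Codes
end
end KSCoding

open MeasureTheory Filter Asymptotics
open scoped ENNReal
namespace KSCoding
noncomputable section

set_option linter.unusedSectionVars false

/-! ### Generic samples and their skeletons -/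

/-- Regular samples of the marked-state process. -/
structure Gen (ξ : (ℤ → Bool) → ℤ → ℕ) (ω : ℤ → Bool) : Prop where
  eqv : ∀ n, ξ (shN n ω) = shN n (ξ ω)
  marks : ∀ i, 0 < ξ ω i → ω i = true
  reg : Reg (ξ ω)

theorem Gen.shN {ξ : (ℤ → Bool) → ℤ → ℕ} {ω : ℤ → Bool} (h : Gen ξ ω) (n : ℤ) :
    Gen ξ (shN n ω) := by
  refine ⟨fun k => ?_, fun i hi => ?_, fun r N => ?_⟩
  · rw [shN_shN, h.eqv, h.eqv, shN_shN]
  · rw [h.eqv] at hi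
    exact h.marks _ hi
  · rw [h.eqv]
    obtain ⟨⟨i, hi, hi'⟩, k, hk, hk'⟩ := h.reg r (N + n)
    exact ⟨⟨i - n, by omega, by simpa [KSCoding.shN] using hi'⟩,
      k - n, by omega, by simpa [KSCoding.shN] using hk'⟩

theorem measurableSet_gen {ξ : (ℤ → Bool) → ℤ → ℕ} (hξ : Measurable ξ) :
    MeasurableSet {ω | Gen ξ ω} := by
  have hc : ∀ i (s : Set ℕ), MeasurableSet {ω | ξ ω i ∈ s} := fun i s =>
    (measurable_pi_apply i).comp hξ (MeasurableSet.of_discrete (s := s))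
  have e : {ω | Gen ξ ω} = (⋂ n, {ω | ξ (KSCoding.shN n ω) = KSCoding.shN n (ξ ω)}) ∩
      ((⋂ i, ({ω | ξ ω i ∈ Set.Ioi 0}ᶜ ∪ {ω | ω i = true})) ∩
        ⋂ r : ℕ, ⋂ N : ℤ, ((⋃ i ∈ Set.Iic N, {ω | ξ ω i ∈ Set.Ici r}) ∩
          ⋃ i ∈ Set.Ici N, {ω | ξ ω i ∈ Set.Ici r})) := by
    ext ω
    simp only [Set.mem_inter_iff, Set.mem_iInter, Set.mem_iUnion, Set.mem_union, Set.mem_ofPred_eq,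
      Set.mem_compl_iff, Set.mem_Ioi, Set.mem_Ici, Set.mem_Iic, exists_prop]
    constructor
    · rintro ⟨h1, h2, h3⟩
      exact ⟨h1, fun i => by have := h2 i; tauto, h3⟩
    · rintro ⟨h1, h2, h3⟩
      exact ⟨h1, fun i => by have := h2 i; tauto, h3⟩
  rw [e]
  refine (MeasurableSet.iInter fun n => ?_).inter ((MeasurableSet.iInter fun i => ?_).inter
    (MeasurableSet.iInter fun r => MeasurableSet.iInter fun N => ?_))
  · exact measurableSet_eq_fun (hξ.comp (measurable_shN n)) ((measurable_shN n).comp hξ)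
  · exact (hc i _).compl.union (measurableSet_apply_eq i true)
  · exact (MeasurableSet.biUnion (Set.to_countable _) fun i _ => hc i _).inter
      (MeasurableSet.biUnion (Set.to_countable _) fun i _ => hc i _)

/-- The positioned skeleton of rank `r` that covers `0`. -/
def pos (ξ : (ℤ → Bool) → ℤ → ℕ) (τ : ℕ → ℕ) (r : ℕ) (ω : ℤ → Bool) : ℤ × Skel :=
  (leftEnd (ξ ω) r, skelOn τ ω (ξ ω) (leftEnd (ξ ω) r) (rightEnd (ξ ω) r))

/-- The positioned skeleton `s` is the `r`-skeleton of `ω` at its position. -/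
def At (ξ : (ℤ → Bool) → ℤ → ℕ) (τ : ℕ → ℕ) (r : ℕ) (s : ℤ × Skel) (ω : ℤ → Bool) : Prop :=
  Sk (ξ ω) r s.1 (s.1 + s.2.len) ∧ skelOn τ ω (ξ ω) s.1 (s.1 + s.2.len) = s.2

variable {ξ : (ℤ → Bool) → ℤ → ℕ} {τ : ℕ → ℕ} {r r' : ℕ} {ω : ℤ → Bool}

theorem measurableSet_at (hξ : Measurable ξ) (s : ℤ × Skel) :
    MeasurableSet {ω | At ξ τ r s ω} := by
  have hc : ∀ i (s : Set ℕ), MeasurableSet {ω | ξ ω i ∈ s} := fun i s =>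
    (measurable_pi_apply i).comp hξ (MeasurableSet.of_discrete (s := s))
  have e : {ω | At ξ τ r s ω} = {ω | Sk (ξ ω) r s.1 (s.1 + s.2.len)} ∩
      ((⋂ k ∈ Set.Iio s.2.len, {ω : ℤ → Bool | ω (s.1 + (k : ℕ)) = s.2.stx k}) ∩
        ⋂ k ∈ Set.Iio s.2.len, {ω | ξ ω (s.1 + (k : ℕ)) ∈
          {t | (if k = 0 then τ t else t) = s.2.labx k}}) := by
    ext ω
    simp only [Set.mem_inter_iff, Set.mem_iInter, Set.mem_ofPred_eq, Set.mem_Iio, At]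
    refine and_congr_right fun h => ?_
    have h1 := h.1
    have hl : (skelOn τ ω (ξ ω) s.1 (s.1 + s.2.len)).len = s.2.len := by
      simp [skelOn]
    constructor
    · intro he
      constructor
      · intro k hk
        rw [← he, skelOn_stx _ _ _ _ _ _ (by omega)]
      · intro k hk
        by_cases hk0 : k = 0
        · subst hk0
          rw [← he, skelOn_labx_zero _ _ _ _ _ h1]; simp
        · rw [← he, skelOn_labx _ _ _ _ _ _ (by omega) hk0, if_neg hk0]
    · rintro ⟨h2, h3⟩
      refine Skel.ext' hl (fun k hk => ?_) (fun k hk => ?_)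
      · rw [hl] at hk
        rw [skelOn_stx _ _ _ _ _ _ (by omega), h2 k hk]
      · rw [hl] at hk
        rw [← h3 k hk]
        by_cases hk0 : k = 0
        · subst hk0
          rw [skelOn_labx_zero _ _ _ _ _ h1]; simp
        · rw [skelOn_labx _ _ _ _ _ _ (by omega) hk0, if_neg hk0]
  rw [e]
  refine MeasurableSet.inter ?_ (MeasurableSet.inter ?_ ?_)
  · by_cases h : s.1 < s.1 + s.2.len
    · have e2 : {ω | Sk (ξ ω) r s.1 (s.1 + s.2.len)} = {ω | ξ ω s.1 ∈ Set.Ici r} ∩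
          ({ω | ξ ω (s.1 + s.2.len) ∈ Set.Ici r} ∩
            ⋂ i ∈ Set.Ioo s.1 (s.1 + s.2.len), {ω | ξ ω i ∈ Set.Iio r}) := by
        ext ω
        simp only [Set.mem_inter_iff, Set.mem_iInter, Set.mem_ofPred_eq, Sk, h, true_and,
          Set.mem_Ici, Set.mem_Iio]
      rw [e2]
      exact (hc _ _).inter ((hc _ _).inter
        (MeasurableSet.biInter (Set.to_countable _) fun i _ => hc i _))
    · convert MeasurableSet.empty
      ext ω
      simp only [Set.mem_ofPred_eq, Set.mem_empty_iff_false, iff_false]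
      exact fun h' => h h'.1
  · exact MeasurableSet.biInter (Set.to_countable _) fun k _ => measurableSet_apply_eq _ _
  · exact MeasurableSet.biInter (Set.to_countable _) fun k _ => hc _ _

theorem Gen.at_pos (h : Gen ξ ω) (τ : ℕ → ℕ) (r : ℕ) :
    At ξ τ r (pos ξ τ r ω) ω ∧ (pos ξ τ r ω).1 ≤ 0 ∧
      0 < (pos ξ τ r ω).1 + (pos ξ τ r ω).2.len := by
  obtain ⟨h1, h2, h3⟩ := h.reg.sk r
  have e : (pos ξ τ r ω).1 + ((pos ξ τ r ω).2.len : ℤ) = rightEnd (ξ ω) r := by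
    simp only [pos, skelOn]; have := h1.1; omega
  refine ⟨⟨?_, ?_⟩, h2, ?_⟩
  · rw [e]; exact h1
  · rw [e]; rfl
  · rw [e]; exact h3

theorem At.pos_eq {s : ℤ × Skel} (h : At ξ τ r s ω) (h0 : s.1 ≤ 0) (h1 : 0 < s.1 + s.2.len) :
    pos ξ τ r ω = s := by
  obtain ⟨e1, e2⟩ := h.1.ends h0 h1
  rw [pos, e1, e2, h.2]

theorem At.sub {s : ℤ × Skel} (h : At ξ τ r' s ω) (hr : r ≤ r') {z : ℕ × ℕ}
    (hz : z ∈ pcs r s.2) : At ξ τ r (s.1 + z.1, s.2.sub τ z.1 z.2) ω := by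
  have hz' := hz
  rw [← h.2] at hz'
  obtain ⟨h1, -, h3⟩ := h.1.piece hr τ ω z hz'
  obtain ⟨-, h4, -⟩ := (pcs_chn r _).mem z hz
  have e : s.1 + (z.1 : ℤ) + ((s.2.sub τ z.1 z.2).len : ℤ) = s.1 + z.2 := by
    change s.1 + (z.1 : ℤ) + ((z.2 - z.1 : ℕ) : ℤ) = s.1 + z.2
    omega
  rw [h.2] at h3
  refine ⟨?_, ?_⟩
  · simp only [e]; exact h1
  · simp only [e]; exact h3.symm

theorem exists_piece {s : ℤ × Skel} (r : ℕ) (n : ℤ) (h0 : s.1 ≤ n)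
    (h1 : n < s.1 + s.2.len) : ∃ z ∈ pcs r s.2, s.1 + z.1 ≤ n ∧ n < s.1 + z.2 := by
  obtain ⟨z, hz, hz1, hz2⟩ := (pcs_chn r s.2).cover (n - s.1).toNat (Nat.zero_le _) (by omega)
  exact ⟨z, hz, by omega, by omega⟩

theorem Gen.at_shN (h : Gen ξ ω) (s : ℤ × Skel) (n : ℤ) :
    At ξ τ r s (KSCoding.shN n ω) ↔ At ξ τ r (s.1 + n, s.2) ω := by
  unfold At
  have e : s.1 + n + (s.2.len : ℤ) = s.1 + s.2.len + n := by ring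
  rw [h.eqv, sk_shN, skelOn_shN]
  simp only [e]

theorem At.mk (hr : 1 ≤ r) (hm : Gen ξ ω) {s : ℤ × Skel} (h : At ξ τ r s ω) : Mk s.2 := by
  have hlt := h.1.1
  refine ⟨by omega, ?_, fun k hk hk0 hl => ?_⟩
  · rw [← h.2, skelOn_stx _ _ _ _ _ _ (by omega)]
    exact hm.marks _ (by have := h.1.2.1; simpa using by omega)
  · rw [← h.2, skelOn_stx _ _ _ _ _ _ (by omega)]
    rw [← h.2, skelOn_labx _ _ _ _ _ _ (by omega) hk0] at hl
    exact hm.marks _ hl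

section
variable {A : Type*} [Fintype A] [DecidableEq A] [MeasurableSpace A] [MeasurableSingletonClass A]
variable {μ : Measure (ℤ → A)} [IsProbabilityMeasure μ] {a : A}

theorem At.fit (hr : 1 ≤ r) {x : ℤ → A} (hm : Gen ξ (hat a x)) {s : ℤ × Skel}
    (h : At ξ τ r s (hat a x)) : Fit a s.2 s.1 x := by
  refine ⟨fun k hk => ?_, ?_⟩
  · conv_rhs => rw [← h.2]
    rw [skelOn_stx _ _ _ _ _ _ (by omega)]
  · have := hm.marks (s.1 + s.2.len) (by have := h.1.2.2.1; omega)
    simpa [hat] using this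

theorem At.vld {x : ℤ → A} {s : ℤ × Skel} (h : At ξ τ r s (hat a x)) :
    Vld a s.2 (fun k => x (s.1 + k)) := by
  have := vld_of_hat (a := a) (x := x) rfl τ (ξ (hat a x)) s.1 (s.1 + s.2.len)
  rwa [h.2] at this

/-- Given the `r`-skeleton at a position, the filler has the law `μ_S`. -/
theorem at_law (hξ : Measurable ξ) (hs : MeasurePreserving shift μ μ) (hr : IsRenewalState μ a)
    (ha : μ {x | x 0 = a} ≠ 0) (hr1 : 1 ≤ r) (s : ℤ × Skel) (hpos : μ (HS a s.2) ≠ 0)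
    (hmk : Mk s.2) {β : Type*} (F : (ℕ → A) → β) (hF : DepN F s.2.len) (C : Set β) :
    μ {x | (Gen ξ (hat a x) ∧ At ξ τ r s (hat a x)) ∧ F (fun k => x (s.1 + k)) ∈ C} =
      μ {x | Gen ξ (hat a x) ∧ At ξ τ r s (hat a x)} *
        (lawF μ a s.2 F).toOuterMeasure C := by
  -- A chain with one link, whose symbol is the proposition that the value lies in `C`.
  have key := chain_law hs hr ha s.1 (fun _ => s.2) (fun _ f => (F f ∈ C))
    {ω | Gen ξ ω ∧ At ξ τ r s ω} ((measurableSet_gen hξ).inter (measurableSet_at hξ s))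
    (Chn.cons hmk.pos (Chn.nil s.2.len)) (by
      intro z hz
      rw [List.mem_singleton] at hz
      subst hz
      exact ⟨rfl, hmk.zero, hpos, fun f g hfg => by
        change (F f ∈ C) = (F g ∈ C)
        rw [hF f g hfg]⟩) (by
      rintro x ⟨h1, h2⟩ z hz
      rw [List.mem_singleton] at hz
      subst hz
      simpa using h2.fit hr1 h1) [True]
  simp only [List.map_cons, List.map_nil, listProd_cons_apply, listProd_nil_nil, mul_one,
    List.cons.injEq, and_true, Nat.cast_zero, add_zero] at key
  have e : lawF μ a s.2 (fun f => (F f ∈ C)) True = (lawF μ a s.2 F).toOuterMeasure C := by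
    rw [← lawF_map F (fun b => b ∈ C), ← pmf_toOuterMeasure_singleton,
      PMF.toOuterMeasure_map_apply]
    congr 1
    ext b; simp
  rw [e] at key
  refine Eq.trans ?_ key
  congr 1
  ext x
  simp

end

/-! ### The levels -/

/-- The pieces of a skeleton of level `j`: skeletons of level `j - 1`. -/
def pcsL (R : ℕ → ℕ) : ℕ → Skel → List (ℕ × ℕ)
  | 0, _ => []
  | j + 1, S => pcs (R j) S

/-- The list of codes of the pieces of level `j - 1`. -/
def lst {A : Type*} (τ : ℕ → ℕ) (R : ℕ → ℕ) (cd : Skel → (ℕ → A) → ℕ) (j : ℕ) (S : Skel)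
    (f : ℕ → A) : List ℕ :=
  (pcsL R j S).map fun z => cd (S.sub τ z.1 z.2) fun k => f (z.1 + k)

/-- The children of a skeleton of level `j`. -/
def chS (τ : ℕ → ℕ) (R : ℕ → ℕ) (j : ℕ) (S : Skel) : List Skel :=
  (pcsL R j S).map fun z => S.sub τ z.1 z.2

open Classical in
/-- The codes of the pieces of level `j - 1`, as a function of the code on level `j + 1`. -/
def rfS {A : Type*} [DecidableEq A] (a : A) (τ : ℕ → ℕ) (R : ℕ → ℕ) (cd : Skel → (ℕ → A) → ℕ) :
    ℕ → Skel → ℕ → List (List ℕ)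
  | 0, _, _ => []
  -- The result does not depend on the chosen representative; this is the field `refine` of `Side`.
  | j + 1, S, c => if h : ∃ f, Vld a S f ∧ cd S f = c then
      (pcs (R j) S).map fun z => lst τ R cd j (S.sub τ z.1 z.2) fun k => h.choose (z.1 + k)
    else []

/-- Skeletons that occur with positive probability on level `j`. -/
def Adm (ρ : Measure (ℤ → Bool)) (ξ : (ℤ → Bool) → ℤ → ℕ) (τ : ℕ → ℕ) (R : ℕ → ℕ) (j : ℕ)
    (S : Skel) : Prop := ∃ α : ℤ, ρ {ω | At ξ τ (R j) (α, S) ω} ≠ 0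

theorem Adm.exists_at {ρ : Measure (ℤ → Bool)} {R : ℕ → ℕ} {j : ℕ} {S : Skel}
    (h : Adm ρ ξ τ R j S) {p : (ℤ → Bool) → Prop} (hp : ∀ᵐ ω ∂ρ, p ω) :
    ∃ α ω, p ω ∧ At ξ τ (R j) (α, S) ω := by
  obtain ⟨α, hα⟩ := h
  by_contra! hc
  refine hα (measure_mono_null (fun ω hω hpω => hc α ω hpω hω) hp)

theorem Adm.sub {ρ : Measure (ℤ → Bool)} {R : ℕ → ℕ} (hR : Monotone R) {j : ℕ} {S : Skel}
    (h : Adm ρ ξ τ R (j + 1) S) {z : ℕ × ℕ} (hz : z ∈ pcs (R j) S) :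
    Adm ρ ξ τ R j (S.sub τ z.1 z.2) := by
  obtain ⟨α, hα⟩ := h
  refine ⟨α + z.1, fun h0 => hα (measure_mono_null (fun ω hω => ?_) h0)⟩
  exact At.sub (s := (α, S)) hω (hR (Nat.le_succ j)) hz

/-- A process with its codes of fillers. -/
structure Side {A : Type*} [Fintype A] [DecidableEq A] [MeasurableSpace A]
    [MeasurableSingletonClass A] (ρ : Measure (ℤ → Bool)) (ξ : (ℤ → Bool) → ℤ → ℕ) (τ : ℕ → ℕ)
    (R : ℕ → ℕ) (μ : Measure (ℤ → A)) (a : A) (cd : Skel → (ℕ → A) → ℕ) : Prop where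
  meas : Measurable ξ
  law : μ.map (hat a) = ρ
  stat : MeasurePreserving shift μ μ
  renewal : IsRenewalState μ a
  apos : μ {x | x 0 = a} ≠ 0
  gen : ∀ᵐ x ∂μ, Gen ξ (hat a x)
  mono : Monotone R
  one_le : ∀ j, 1 ≤ R j
  depN : ∀ S, DepN (cd S) S.len
  -- Two levels are crossed at once: codes are read on every second level, and the one between
  -- carries the codes of the other process.
  refine : ∀ j S, Adm ρ ξ τ R (j + 1) S → ∀ f g, Vld a S f → Vld a S g → cd S f = cd S g →
    ∀ z ∈ pcs (R j) S, lst τ R cd j (S.sub τ z.1 z.2) (fun k => f (z.1 + k)) =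
      lst τ R cd j (S.sub τ z.1 z.2) fun k => g (z.1 + k)

/-! ### Laws of the codes of a single process. -/

section Sides
variable {A : Type*} [Fintype A] [DecidableEq A] [MeasurableSpace A] [MeasurableSingletonClass A]
variable {ρ : Measure (ℤ → Bool)} {R : ℕ → ℕ}
variable {μ : Measure (ℤ → A)} [IsProbabilityMeasure μ] {a : A} {cd : Skel → (ℕ → A) → ℕ}

theorem Side.ae_map (h : Side ρ ξ τ R μ a cd) {p : (ℤ → Bool) → Prop}
    (hp : ∀ᵐ ω ∂ρ, p ω) : ∀ᵐ x ∂μ, p (hat a x) := by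
  rw [← h.law] at hp
  exact ae_of_ae_map (measurable_hat a).aemeasurable hp

theorem Side.ae_gen (h : Side ρ ξ τ R μ a cd) : ∀ᵐ ω ∂ρ, Gen ξ ω := by
  rw [← h.law]
  exact (ae_map_iff (measurable_hat a).aemeasurable (measurableSet_gen h.meas)).2 h.gen

theorem Side.mk_of_adm (h : Side ρ ξ τ R μ a cd) {j : ℕ} {S : Skel} (hS : Adm ρ ξ τ R j S) : Mk S := by
  obtain ⟨α, ω, h1, h2⟩ := hS.exists_at h.ae_gen
  exact At.mk (h.one_le j) h1 h2

theorem Side.HS_ne_zero (h : Side ρ ξ τ R μ a cd) {j : ℕ} {S : Skel} (hS : Adm ρ ξ τ R j S) :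
    μ (HS a S) ≠ 0 := by
  obtain ⟨α, hα⟩ := hS
  intro h0
  refine hα ?_
  rw [← h.law, Measure.map_apply (measurable_hat a) (measurableSet_at h.meas _)]
  rw [← measure_HS_eq h.stat S α] at h0
  refine measure_mono_null_ae ?_ h0
  filter_upwards [h.gen] with x hx hx2
  exact At.fit (h.one_le j) hx hx2

theorem Side.rfS_code (h : Side ρ ξ τ R μ a cd) {j : ℕ} {S : Skel} (hS : Adm ρ ξ τ R (j + 1) S)
    {f : ℕ → A} (hf : Vld a S f) : rfS a τ R cd (j + 1) S (cd S f) =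
      (pcs (R j) S).map fun z => lst τ R cd j (S.sub τ z.1 z.2) fun k => f (z.1 + k) := by
  have hex : ∃ g, Vld a S g ∧ cd S g = cd S f := ⟨f, hf, rfl⟩
  rw [rfS, dif_pos hex]
  exact List.map_congr_left fun z hz =>
    h.refine j S hS _ f hex.choose_spec.1 hf hex.choose_spec.2 z hz

theorem lst_depN (hcd : ∀ S, DepN (cd S) S.len) (τ : ℕ → ℕ) (R : ℕ → ℕ) (j : ℕ) (S : Skel) :
    DepN (lst τ R cd j S) S.len := by
  intro f g hfg
  refine List.map_congr_left fun z hz => ?_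
  refine hcd _ _ _ fun k hk => hfg _ ?_
  have hk' : k < z.2 - z.1 := hk
  cases j with
  | zero => simp [pcsL] at hz
  | succ j =>
    obtain ⟨-, h2, h3⟩ := (pcs_chn (R j) S).mem z hz
    omega

/-- The law of the list of codes of the children. -/
theorem Side.lawF_lst (h : Side ρ ξ τ R μ a cd) (D : ChainData Skel) (hch : D.ch = chS τ R)
    {j : ℕ} (hpi : ∀ i, j = i + 1 → ∀ S, D.pi i S = lawF μ a S (cd S)) {S : Skel}
    (hmk : Mk S) (hpos : μ (HS a S) ≠ 0) : lawF μ a S (lst τ R cd j S) = D.PR j S := by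
  cases j with
  | zero =>
    have e1 : D.PR 0 S = PMF.pure [] := by
      rw [ChainData.PR, hch]; rfl
    have e2 : lst τ R cd 0 S = fun _ => [] := rfl
    rw [e1, e2, lawF]
    exact PMF.map_const _ _
  | succ j =>
    have e1 := lawF_pieces h.stat h.renewal h.apos hmk hpos τ (h.one_le j)
      (fun z => cd (S.sub τ z.1 z.2)) (fun z _ => h.depN _)
    rw [ChainData.PR, hch]
    simp only [chS, pcsL, List.map_map, Nat.add_sub_cancel]
    refine Eq.trans ?_ (e1.trans ?_)
    · rfl
    · congr 1
      exact List.map_congr_left fun z _ => (hpi j rfl _).symm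

end Sides
end
end KSCoding

open MeasureTheory Filter Asymptotics
open scoped ENNReal
namespace KSCoding
noncomputable section

/-! ### Two linked processes -/

/-- The word of `x` that starts at `α`. -/
def wd {A : Type*} (x : ℤ → A) (α : ℤ) : ℕ → A := fun k => x (α + k)

/-- The positioned skeleton covers the coordinate `n`. -/
def Cov (s : ℤ × Skel) (n : ℤ) : Prop := s.1 ≤ n ∧ n < s.1 + s.2.len

/-- Samples whose skeletons all have positive probability. -/
def Gd (ρ : Measure (ℤ → Bool)) (ξ : (ℤ → Bool) → ℤ → ℕ) (τ : ℕ → ℕ) (R : ℕ → ℕ)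
    (ω : ℤ → Bool) : Prop :=
  Gen ξ ω ∧ ∀ j s, At ξ τ (R j) s ω → ρ {ω | At ξ τ (R j) s ω} ≠ 0

/-- Two processes with the same marked states, with codes of fillers, and the data of a chain that
uses the codes of the first process on the levels of `p`, and those of the second on the others. -/
structure Link {A B : Type*} [Fintype A] [DecidableEq A] [MeasurableSpace A]
    [MeasurableSingletonClass A] [Fintype B] [DecidableEq B] [MeasurableSpace B]
    [MeasurableSingletonClass B] (ρ : Measure (ℤ → Bool)) (ξ : (ℤ → Bool) → ℤ → ℕ) (τ : ℕ → ℕ)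
    (R : ℕ → ℕ) (μ : Measure (ℤ → A)) [IsProbabilityMeasure μ] (a : A)
    (cd1 : Skel → (ℕ → A) → ℕ) (ν : Measure (ℤ → B)) [IsProbabilityMeasure ν] (b : B)
    (cd2 : Skel → (ℕ → B) → ℕ) (D : ChainData Skel) (p : ℕ → Prop) : Prop where
  sx : Side ρ ξ τ R μ a cd1
  sy : Side ρ ξ τ R ν b cd2
  alt : ∀ j, p (j + 1) ↔ ¬ p j
  ch : D.ch = chS τ R
  pix : ∀ j, p j → ∀ S, D.pi j S = lawF μ a S (cd1 S)
  piy : ∀ j, ¬ p j → ∀ S, D.pi j S = lawF ν b S (cd2 S)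
  rfx : ∀ j, p j → D.rf j = rfS a τ R cd1 j
  rfy : ∀ j, ¬ p j → D.rf j = rfS b τ R cd2 j

variable {A B : Type*} [Fintype A] [DecidableEq A] [MeasurableSpace A]
  [MeasurableSingletonClass A] [Fintype B] [DecidableEq B] [MeasurableSpace B]
  [MeasurableSingletonClass B] {ρ : Measure (ℤ → Bool)} {ξ : (ℤ → Bool) → ℤ → ℕ} {τ : ℕ → ℕ}
  {R : ℕ → ℕ} {μ : Measure (ℤ → A)} [IsProbabilityMeasure μ] {a : A}
  {cd1 : Skel → (ℕ → A) → ℕ} {ν : Measure (ℤ → B)} [IsProbabilityMeasure ν] {b : B}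
  {cd2 : Skel → (ℕ → B) → ℕ} {D : ChainData Skel} {p : ℕ → Prop}

set_option linter.unusedSectionVars false

/-- The chain `D` is kept and only the roles are exchanged. Everything proved for `phi` therefore
holds for the inverse map, which is built from the same couplings. -/
theorem Link.symm (H : Link ρ ξ τ R μ a cd1 ν b cd2 D p) :
    Link ρ ξ τ R ν b cd2 μ a cd1 D (fun j => ¬ p j) where
  sx := H.sy
  sy := H.sx
  alt j := not_congr (H.alt j)
  ch := H.ch
  pix := H.piy
  piy j hj := H.pix j (not_not.1 hj)
  rfx := H.rfy
  rfy j hj := H.rfx j (not_not.1 hj)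

theorem Gd.adm {ω : ℤ → Bool} (h : Gd ρ ξ τ R ω) {j : ℕ} {s : ℤ × Skel}
    (hs : At ξ τ (R j) s ω) : Adm ρ ξ τ R j s.2 := ⟨s.1, h.2 j s hs⟩

theorem Gen.exists_at {ω : ℤ → Bool} (h : Gen ξ ω) (τ : ℕ → ℕ) (r : ℕ) (n : ℤ) :
    ∃ s, At ξ τ r s ω ∧ Cov s n := by
  obtain ⟨h1, h2, h3⟩ := (h.shN n).at_pos τ r
  rw [h.at_shN] at h1
  exact ⟨_, h1, by dsimp only; omega, by dsimp only; omega⟩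

theorem Gen.at_unique {ω : ℤ → Bool} (h : Gen ξ ω) {r : ℕ} {n : ℤ} {s s' : ℤ × Skel}
    (h1 : At ξ τ r s ω) (h2 : Cov s n) (h3 : At ξ τ r s' ω) (h4 : Cov s' n) : s = s' := by
  have e : ∀ t : ℤ × Skel, At ξ τ r t ω → Cov t n →
      pos ξ τ r (KSCoding.shN n ω) = (t.1 - n, t.2) := by
    intro t ht hc
    refine At.pos_eq ((h.at_shN _ n).2 (by simpa using ht)) ?_ ?_
    · have := hc.1; dsimp only; omega
    · have := hc.2; dsimp only; omega
  have e1 := e s h1 h2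
  rw [e s' h3 h4] at e1
  have e2 := congrArg Prod.fst e1
  have e3 := congrArg Prod.snd e1
  dsimp only at e2 e3
  exact Prod.ext (by omega) e3.symm

theorem Side.ae_gd (h : Side ρ ξ τ R μ a cd1) : ∀ᵐ ω ∂ρ, Gd ρ ξ τ R ω := by
  have : ∀ᵐ ω ∂ρ, ∀ (j : ℕ) (s : ℤ × Skel), At ξ τ (R j) s ω → ρ {ω | At ξ τ (R j) s ω} ≠ 0 := by
    rw [ae_all_iff]; intro j
    have := countable_skel
    rw [ae_all_iff]; intro s
    by_cases h0 : ρ {ω | At ξ τ (R j) s ω} = 0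
    · have : ∀ᵐ ω ∂ρ, ¬ At ξ τ (R j) s ω := by
        rw [ae_iff]; simpa using h0
      filter_upwards [this] with ω h1 h2 using absurd h2 h1
    · exact Eventually.of_forall fun _ _ => h0
  filter_upwards [h.ae_gen, this] with ω h1 h2 using ⟨h1, h2⟩

/-- The data of the linked processes form a chain. -/
theorem Link.refine_aux (H : Link ρ ξ τ R μ a cd1 ν b cd2 D p) (j : ℕ) (hj : p (j + 1)) (S : Skel)
    (hS : Adm ρ ξ τ R (j + 1) S) :
    (D.pi (j + 1) S).map (D.rf (j + 1) S) = listProd ((D.ch (j + 1) S).map (D.PR j)) := by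
  have hmk := H.sx.mk_of_adm hS
  have hpos := H.sx.HS_ne_zero hS
  rw [H.pix _ hj, H.rfx _ hj, lawF_map,
    lawF_congr hpos (F' := fun f => (pcs (R j) S).map fun z =>
      lst τ R cd1 j (S.sub τ z.1 z.2) fun k => f (z.1 + k))
      (fun f hf => H.sx.rfS_code hS hf),
    lawF_pieces H.sx.stat H.sx.renewal H.sx.apos hmk hpos τ (H.sx.one_le j)
      (fun z => lst τ R cd1 j (S.sub τ z.1 z.2)) (fun z _ => lst_depN H.sx.depN τ R j _), H.ch]
  simp only [chS, pcsL, List.map_map]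
  congr 1
  refine List.map_congr_left fun z hz => ?_
  refine H.sx.lawF_lst D H.ch (fun i hi => ?_) (hmk.sub τ (H.sx.one_le j) hz)
    (hmk.HS_sub_ne_zero H.sx.stat τ (H.sx.one_le j) hz hpos)
  subst hi
  exact H.pix i (by have := H.alt i; have := H.alt (i + 1); tauto)

theorem Link.isChain (H : Link ρ ξ τ R μ a cd1 ν b cd2 D p) : D.IsChain (Adm ρ ξ τ R) where
  ch_zero t := by rw [H.ch]; rfl
  adm_ch j t ht t' ht' := by
    rw [H.ch] at ht'
    obtain ⟨z, hz, rfl⟩ := List.mem_map.1 ht'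
    exact ht.sub H.sx.mono hz
  finite j t _ := by
    by_cases hj : p j
    · rw [H.pix j hj]; exact finite_support_lawF _ _
    · rw [H.piy j hj]; exact finite_support_lawF _ _
  refine j t ht := by
    by_cases hj : p (j + 1)
    · exact H.refine_aux j hj t ht
    · exact H.symm.refine_aux j hj t ht

/-- Compatible words on the skeleton `s` of level `j`. -/
def Cmp (τ : ℕ → ℕ) (R : ℕ → ℕ) (cd1 : Skel → (ℕ → A) → ℕ) (cd2 : Skel → (ℕ → B) → ℕ)
    (D : ChainData Skel) (p : ℕ → Prop) (j : ℕ) (s : ℤ × Skel) (x : ℤ → A) (y : ℤ → B) : Prop :=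
  (p j → D.kap j s.2 (lst τ R cd2 j s.2 (wd y s.1), cd1 s.2 (wd x s.1)) ≠ 0) ∧
    (¬ p j → D.kap j s.2 (lst τ R cd1 j s.2 (wd x s.1), cd2 s.2 (wd y s.1)) ≠ 0)

theorem wd_add (x : ℤ → A) (α : ℤ) (u : ℕ) : (fun k => wd x α (u + k)) = wd x (α + u) := by
  funext k; simp only [wd]; congr 1; push_cast; ring

/-- An atom charged by the coupling on a node projects to charged atoms on its pieces. The code of
`x` on the node gives its codes two levels below, and the codes of `y` on the pieces become the
codes of the nodes there. -/
theorem Link.child_aux (H : Link ρ ξ τ R μ a cd1 ν b cd2 D p) {j : ℕ} (hj : p (j + 1))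
    {s : ℤ × Skel} (hs : Adm ρ ξ τ R (j + 1) s.2) {x : ℤ → A} {y : ℤ → B}
    (hx : At ξ τ (R (j + 1)) s (hat a x))
    (h : D.kap (j + 1) s.2 (lst τ R cd2 (j + 1) s.2 (wd y s.1), cd1 s.2 (wd x s.1)) ≠ 0)
    {z : ℕ × ℕ} (hz : z ∈ pcs (R j) s.2) :
    D.kap j (s.2.sub τ z.1 z.2) (lst τ R cd1 j (s.2.sub τ z.1 z.2) (wd x (s.1 + z.1)),
      cd2 (s.2.sub τ z.1 z.2) (wd y (s.1 + z.1))) ≠ 0 := by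
  refine kap_child_ne_zero H.isChain j s.2 hs (cd1 s.2 (wd x s.1)) (pcs (R j) s.2)
    (fun z => s.2.sub τ z.1 z.2) ?_
    (fun z => lst τ R cd1 j (s.2.sub τ z.1 z.2) (wd x (s.1 + z.1)))
    (fun z => cd2 (s.2.sub τ z.1 z.2) (wd y (s.1 + z.1))) ?_ ?_ z hz
  · rw [H.ch]; rfl
  · rw [H.rfx _ hj, H.sx.rfS_code hs (show Vld a s.2 (wd x s.1) from hx.vld)]
    simp only [← wd_add]
  · simp only [← wd_add]; exact h

theorem Link.cmp_child (H : Link ρ ξ τ R μ a cd1 ν b cd2 D p) {j : ℕ}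
    {s : ℤ × Skel} (hs : Adm ρ ξ τ R (j + 1) s.2) {x : ℤ → A} {y : ℤ → B}
    (hx : At ξ τ (R (j + 1)) s (hat a x)) (hy : At ξ τ (R (j + 1)) s (hat b y))
    (h : Cmp τ R cd1 cd2 D p (j + 1) s x y) {z : ℕ × ℕ} (hz : z ∈ pcs (R j) s.2) :
    Cmp τ R cd1 cd2 D p j (s.1 + z.1, s.2.sub τ z.1 z.2) x y := by
  by_cases hj : p (j + 1)
  · have hj' : ¬ p j := (H.alt j).1 hj
    exact ⟨fun h => absurd h hj', fun _ => H.child_aux hj hs hx (h.1 hj) hz⟩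
  · have hj' : p j := by have := H.alt j; tauto
    exact ⟨fun _ => H.symm.child_aux hj hs hy (h.2 hj) hz, fun h => absurd hj' h⟩

/-- Compatibility descends through the pieces that cover `n`. Only the large skeleton of `y` is
assumed to be that of `x`; the smaller ones inside it then coincide as well. -/
theorem Link.cmp_down (H : Link ρ ξ τ R μ a cd1 ν b cd2 D p) {j j' : ℕ} (hjj : j ≤ j')
    {x : ℤ → A} {y : ℤ → B} (hgx : Gd ρ ξ τ R (hat a x)) {n : ℤ} {s s' : ℤ × Skel}
    (hs : At ξ τ (R j) s (hat a x)) (hsn : Cov s n)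
    (hs' : At ξ τ (R j') s' (hat a x)) (hsn' : Cov s' n) (hy : At ξ τ (R j') s' (hat b y))
    (h : Cmp τ R cd1 cd2 D p j' s' x y) :
    Cmp τ R cd1 cd2 D p j s x y ∧ At ξ τ (R j) s (hat b y) := by
  induction j', hjj using Nat.le_induction generalizing s' with
  | base =>
    obtain rfl := hgx.1.at_unique hs hsn hs' hsn'
    exact ⟨h, hy⟩
  | succ i hi ih =>
    obtain ⟨z, hz, hz1, hz2⟩ := exists_piece (s := s') (R i) n hsn'.1 hsn'.2
    have hm : R i ≤ R (i + 1) := H.sx.mono (Nat.le_succ i)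
    have hlt := ((pcs_chn (R i) s'.2).mem z hz).2.1
    refine ih (hs'.sub hm hz) ⟨hz1, ?_⟩ (hy.sub hm hz) (H.cmp_child (hgx.adm hs') hs' hy h hz)
    change n < s'.1 + (z.1 : ℤ) + ((z.2 - z.1 : ℕ) : ℤ)
    omega

/-- Lists of codes of positive probability are seen in generic samples. -/
theorem Link.exists_generic (H : Link ρ ξ τ R μ a cd1 ν b cd2 D p) {j : ℕ} (hj : p j)
    {s : ℤ × Skel} (hs : ρ {ω | At ξ τ (R j) s ω} ≠ 0) {c : ℕ} {q : List ℕ}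
    (hq : D.kap j s.2 (q, c) ≠ 0) {P : (ℤ → B) → Prop} (hP : ∀ᵐ y ∂ν, P y) :
    ∃ y, P y ∧ Gd ρ ξ τ R (hat b y) ∧ At ξ τ (R j) s (hat b y) ∧
      lst τ R cd2 j s.2 (wd y s.1) = q := by
  have hadm : Adm ρ ξ τ R j s.2 := ⟨s.1, hs⟩
  have hmk := H.sy.mk_of_adm hadm
  have hpos := H.sy.HS_ne_zero hadm
  have hlaw := at_law (τ := τ) H.sy.meas H.sy.stat H.sy.renewal H.sy.apos (H.sy.one_le j) s hpos hmk
    (lst τ R cd2 j s.2) (lst_depN H.sy.depN τ R j _) {q}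
  -- A list charged by the coupling is charged by its marginal, which is the law of the codes of Y
  -- on the pieces.
  have hPR : (lawF ν b s.2 (lst τ R cd2 j s.2)).toOuterMeasure {q} ≠ 0 := by
    rw [pmf_toOuterMeasure_singleton, H.sy.lawF_lst D H.ch (fun i hi => H.piy i (by
      subst hi; exact (H.alt i).1 hj)) hmk hpos, ← (kap_spec H.isChain j _ hadm).2.1]
    rw [← PMF.mem_support_iff, PMF.support_map]
    exact ⟨(q, c), hq, rfl⟩
  have h0 : ν {x | Gen ξ (hat b x) ∧ At ξ τ (R j) s (hat b x)} ≠ 0 := by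
    intro h0
    refine hs ?_
    rw [← H.sy.law, Measure.map_apply (measurable_hat b) (measurableSet_at H.sy.meas _)]
    refine measure_mono_null_ae ?_ h0
    filter_upwards [H.sy.gen] with x hx hx2 using ⟨hx, hx2⟩
  have h1 := mul_ne_zero h0 hPR
  rw [← hlaw] at h1
  by_contra! hc
  refine h1 (measure_mono_null_ae ?_ measure_empty)
  filter_upwards [hP, H.sy.ae_map H.sy.ae_gd] with y hy1 hy2 hy3
  exact hc y hy1 hy2 hy3.1.2 hy3.2

/-! ### The map -/

/-- The codes on a skeleton of a level of `p` that covers `n` determine the symbol `c` at `n`. -/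
def Val (ξ : (ℤ → Bool) → ℤ → ℕ) (τ : ℕ → ℕ) (R : ℕ → ℕ) (a : A) (cd1 : Skel → (ℕ → A) → ℕ)
    (ν : Measure (ℤ → B)) (b : B) (cd2 : Skel → (ℕ → B) → ℕ) (D : ChainData Skel) (p : ℕ → Prop)
    (x : ℤ → A) (n : ℤ) (c : B) : Prop :=
  Gen ξ (hat a x) ∧ ∃ (j : ℕ) (q : List ℕ) (s : ℤ × Skel), At ξ τ (R j) s (hat a x) ∧
    D.Uns j s.2 (cd1 s.2 (wd x s.1)) q ∧ p j ∧ Cov s n ∧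
    ∀ᵐ y ∂ν, At ξ τ (R j) s (hat b y) → lst τ R cd2 j s.2 (wd y s.1) = q → y n = c

theorem val_shN (hξ : MeasurePreserving shift ν ν) (hg : ∀ᵐ y ∂ν, Gen ξ (hat b y)) (x : ℤ → A)
    (n k : ℤ) (c : B) (h : Val ξ τ R a cd1 ν b cd2 D p x n c) :
    Val ξ τ R a cd1 ν b cd2 D p (shN k x) (n - k) c := by
  obtain ⟨h1, j, q, s, h2, h3, h4, h5, h6⟩ := h
  refine ⟨h1.shN k, j, q, (s.1 - k, s.2), ?_, ?_, h4, ?_, ?_⟩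
  · rw [hat_shN, h1.at_shN]; simpa using h2
  · have : wd (shN k x) (s.1 - k) = wd x s.1 := by
      funext i; simp only [wd, shN]; congr 1; ring
    dsimp only
    rw [this]; exact h3
  · refine ⟨?_, ?_⟩
    · have := h5.1; dsimp only; omega
    · have := h5.2; dsimp only; omega
  · filter_upwards [ae_shN hξ h6, hg] with y hy hy2 hy3 hy4
    have := hy (-k) (by
      rw [hat_shN, hy2.at_shN]; simpa [sub_eq_add_neg] using hy3) (by
      rw [← hy4]
      congr 1
      funext i; simp only [wd, shN]; congr 1; ring)
    rw [← this]; simp only [shN]; congr 1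

open Classical in
/-- A symbol that satisfies `v`, if there is one. -/
def pick (b : B) (v : B → Prop) : B := if h : ∃ c, v c then h.choose else b

theorem pick_spec (b : B) {v : B → Prop} {c : B} (h : v c) : v (pick b v) := by
  have hex : ∃ c, v c := ⟨c, h⟩
  rw [pick, dif_pos hex]
  exact hex.choose_spec

/-- The factor map given by the chain. -/
def phi (ξ : (ℤ → Bool) → ℤ → ℕ) (τ : ℕ → ℕ) (R : ℕ → ℕ) (a : A) (cd1 : Skel → (ℕ → A) → ℕ)
    (ν : Measure (ℤ → B)) (b : B) (cd2 : Skel → (ℕ → B) → ℕ) (D : ChainData Skel) (p : ℕ → Prop)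
    (x : ℤ → A) (n : ℤ) : B :=
  pick b (Val ξ τ R a cd1 ν b cd2 D p x n)

/-- Genericity of the sample is part of `Val`, so equivariance holds for every sample, without an
exceptional set. -/
theorem Link.phi_shN (H : Link ρ ξ τ R μ a cd1 ν b cd2 D p) (x : ℤ → A) (k : ℤ) :
    phi ξ τ R a cd1 ν b cd2 D p (shN k x) = shN k (phi ξ τ R a cd1 ν b cd2 D p x) := by
  funext n
  have e : Val ξ τ R a cd1 ν b cd2 D p (shN k x) n = Val ξ τ R a cd1 ν b cd2 D p x (n + k) := by
    funext c
    refine propext ⟨fun h => ?_, fun h => ?_⟩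
    · have := val_shN H.sy.stat H.sy.gen _ _ (-k) _ h
      rw [shN_shN] at this
      simpa [shN_zero] using this
    · have := val_shN H.sy.stat H.sy.gen _ _ k _ h
      simpa using this
  exact congrArg (pick b) e

theorem measurableSet_wd (n : ℕ) (F : (ℕ → A) → Prop) (hF : DepN F n) (a : A) (α : ℤ) :
    MeasurableSet {x : ℤ → A | F (wd x α)} := by
  have h := measurableSet_of_depN n {f | F f} a hF
  exact h.preimage (measurable_fut α)

theorem Link.measurable_phi (H : Link ρ ξ τ R μ a cd1 ν b cd2 D p) :
    Measurable (phi ξ τ R a cd1 ν b cd2 D p) := by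
  classical
  have hv : ∀ n c, MeasurableSet {x | Val ξ τ R a cd1 ν b cd2 D p x n c} := by
    intro n c
    have := countable_skel
    have e : {x | Val ξ τ R a cd1 ν b cd2 D p x n c} = {x | Gen ξ (hat a x)} ∩
        ⋃ (j : ℕ) (q : List ℕ) (s : ℤ × Skel), ({x | At ξ τ (R j) s (hat a x)} ∩
          ({x | D.Uns j s.2 (cd1 s.2 (wd x s.1)) q} ∩ {_x | p j ∧ Cov s n ∧
            ∀ᵐ y ∂ν, At ξ τ (R j) s (hat b y) → lst τ R cd2 j s.2 (wd y s.1) = q → y n = c})) := by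
      ext x; simp [Val]
    rw [e]
    refine ((measurableSet_gen H.sx.meas).preimage (measurable_hat a)).inter
      (MeasurableSet.iUnion fun j => MeasurableSet.iUnion fun q => MeasurableSet.iUnion fun s =>
        ((measurableSet_at H.sx.meas s).preimage (measurable_hat a)).inter
          (MeasurableSet.inter ?_ (MeasurableSet.const _)))
    exact measurableSet_wd s.2.len (fun f => D.Uns j s.2 (cd1 s.2 f) q)
      (fun f g h => by simp only [H.sx.depN _ f g h]) a s.1
  refine measurable_pi_lambda _ fun n => ?_
  have e : (fun x => phi ξ τ R a cd1 ν b cd2 D p x n) =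
      pick b ∘
        fun x c => Val ξ τ R a cd1 ν b cd2 D p x n c := rfl
  rw [e]
  refine Measurable.comp (Measurable.of_discrete) (measurable_pi_lambda _ fun c => ?_)
  exact measurable_to_prop (by
    convert hv n c using 1
    ext x; simp)

/-- The symbol at `n` is unique. -/
theorem Link.val_unique (H : Link ρ ξ τ R μ a cd1 ν b cd2 D p) {x : ℤ → A}
    (hx : Gd ρ ξ τ R (hat a x)) {n : ℤ} {c c' : B}
    (h : Val ξ τ R a cd1 ν b cd2 D p x n c) (h' : Val ξ τ R a cd1 ν b cd2 D p x n c') :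
    c = c' := by
  obtain ⟨-, j, q, s, h1, h2, h3, h4, h5⟩ := h
  obtain ⟨-, j', q', s', h1', h2', h3', h4', h5'⟩ := h'
  wlog hjj : j ≤ j' generalizing c c' j j' q q' s s'
  · exact (this j' q' s' h1' h2' h3' h4' h5' j q s h1 h2 h3 h4 h5 (by omega)).symm
  -- A generic `y` compatible with `x` on the higher level is, by projection, compatible on the
  -- lower level too; there the list is forced, so the two readings are both the symbol of this `y`.
  obtain ⟨y, ⟨hy5, hy5'⟩, hy1, hy2, hy3⟩ := H.exists_generic h3' (hx.2 _ _ h1') h2'.1 (h5.and h5')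
  obtain ⟨k1, k2⟩ := H.cmp_down hjj hx h1 h4 h1' h4' hy2
    ⟨fun _ => by rw [hy3]; exact h2'.1, fun h => absurd h3' h⟩
  have k3 := h2.2 _ (k1.1 h3)
  rw [← hy5 k2 k3, ← hy5' hy2 hy3]

theorem Link.phi_eq (H : Link ρ ξ τ R μ a cd1 ν b cd2 D p) {x : ℤ → A}
    (hx : Gd ρ ξ τ R (hat a x)) {n : ℤ} {c : B} (h : Val ξ τ R a cd1 ν b cd2 D p x n c) :
    phi ξ τ R a cd1 ν b cd2 D p x n = c := by
  exact H.val_unique hx (pick_spec b h) h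

end
end KSCoding

open MeasureTheory Filter Asymptotics
open scoped ENNReal
namespace KSCoding
noncomputable section

variable {A B : Type*} [Fintype A] [DecidableEq A] [MeasurableSpace A]
  [MeasurableSingletonClass A] [Fintype B] [DecidableEq B] [MeasurableSpace B]
  [MeasurableSingletonClass B] {ρ : Measure (ℤ → Bool)} {ξ : (ℤ → Bool) → ℤ → ℕ} {τ : ℕ → ℕ}
  {R : ℕ → ℕ} {μ : Measure (ℤ → A)} [IsProbabilityMeasure μ] {a : A}
  {cd1 : Skel → (ℕ → A) → ℕ} {ν : Measure (ℤ → B)} [IsProbabilityMeasure ν] {b : B}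
  {cd2 : Skel → (ℕ → B) → ℕ} {D : ChainData Skel} {p : ℕ → Prop}

set_option linter.unusedSectionVars false

/-! ### Transfer of events between the linked processes -/

/-- The event that the code of the skeleton of level `j` that covers `0` is in `C`. -/
def codeEv (ξ : (ℤ → Bool) → ℤ → ℕ) (τ : ℕ → ℕ) (R : ℕ → ℕ) (a : A) (cd : Skel → (ℕ → A) → ℕ)
    (j : ℕ) (C : ℤ × Skel → Set ℕ) : Set (ℤ → A) :=
  {x | Gen ξ (hat a x) ∧ ∃ s, At ξ τ (R j) s (hat a x) ∧ Cov s 0 ∧ cd s.2 (wd x s.1) ∈ C s}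

theorem measurableSet_code_at (hξ : Measurable ξ) {β : Type*} {F : (ℕ → A) → β} {s : ℤ × Skel}
    (hF : DepN F s.2.len) (r : ℕ) (C : Set β) (a : A) :
    MeasurableSet {x : ℤ → A | (Gen ξ (hat a x) ∧ At ξ τ r s (hat a x)) ∧ F (wd x s.1) ∈ C} := by
  refine MeasurableSet.inter (MeasurableSet.inter ?_ ?_) ?_
  · exact (measurableSet_gen hξ).preimage (measurable_hat a)
  · exact (measurableSet_at hξ s).preimage (measurable_hat a)
  · exact measurableSet_wd s.2.len (fun f => F f ∈ C) (fun f g h => by simp only [hF f g h]) a s.1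

theorem codeEv_eq (a : A) (cd : Skel → (ℕ → A) → ℕ) (j : ℕ) (C : ℤ × Skel → Set ℕ) :
    codeEv ξ τ R a cd j C = ⋃ s : {s : ℤ × Skel // Cov s 0},
      {x | (Gen ξ (hat a x) ∧ At ξ τ (R j) s.1 (hat a x)) ∧ cd s.1.2 (wd x s.1.1) ∈ C s.1} := by
  ext x
  simp only [codeEv, Set.mem_iUnion, Subtype.exists, Set.mem_ofPred_eq]
  constructor
  · rintro ⟨h1, s, h2, h3, h4⟩
    exact ⟨s, h3, ⟨h1, h2⟩, h4⟩
  · rintro ⟨s, h3, ⟨h1, h2⟩, h4⟩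
    exact ⟨h1, s, h2, h3, h4⟩

theorem Side.measurableSet_codeEv (h : Side ρ ξ τ R μ a cd1) (j : ℕ) (C : ℤ × Skel → Set ℕ) :
    MeasurableSet (codeEv ξ τ R a cd1 j C) := by
  have := countable_skel
  rw [codeEv_eq]
  exact MeasurableSet.iUnion fun s => measurableSet_code_at h.meas (h.depN _) _ _ _

theorem Side.measure_codeEv (h : Side ρ ξ τ R μ a cd1) (j : ℕ) (C : ℤ × Skel → Set ℕ) :
    μ (codeEv ξ τ R a cd1 j C) = ∑' s : {s : ℤ × Skel // Cov s 0},
      μ {x | (Gen ξ (hat a x) ∧ At ξ τ (R j) s.1 (hat a x)) ∧ cd1 s.1.2 (wd x s.1.1) ∈ C s.1} := by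
  have := countable_skel
  rw [codeEv_eq, measure_iUnion]
  · intro s s' hss
    rw [Function.onFun, Set.disjoint_left]
    rintro x ⟨⟨h1, h2⟩, -⟩ ⟨⟨-, h4⟩, -⟩
    exact hss (Subtype.ext (h1.at_unique h2 s.2 h4 s'.2))
  · exact fun s => measurableSet_code_at h.meas (h.depN _) _ _ _

/-- The event that the symbols of the covering skeleton do not determine those of its children. -/
def splitEv (ξ : (ℤ → Bool) → ℤ → ℕ) (τ : ℕ → ℕ) (R : ℕ → ℕ) (a : A) (cd : Skel → (ℕ → A) → ℕ)
    (D : ChainData Skel) (j : ℕ) : Set (ℤ → A) :=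
  codeEv ξ τ R a cd j fun s => D.split j s.2

/-- The event that the symbols of the covering skeleton determine those of its children, with a
value in `Q`. -/
def unsEv (ξ : (ℤ → Bool) → ℤ → ℕ) (τ : ℕ → ℕ) (R : ℕ → ℕ) (a : A) (cd : Skel → (ℕ → A) → ℕ)
    (D : ChainData Skel) (j : ℕ) (Q : ℤ × Skel → Set (List ℕ)) : Set (ℤ → A) :=
  codeEv ξ τ R a cd j fun s => {c | ∃ q ∈ Q s, D.Uns j s.2 c q}

theorem Side.measure_at_eq (h : Side ρ ξ τ R μ a cd1) (r : ℕ) (s : ℤ × Skel) :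
    μ {x | Gen ξ (hat a x) ∧ At ξ τ r s (hat a x)} = ρ {ω | Gen ξ ω ∧ At ξ τ r s ω} := by
  rw [← h.law, Measure.map_apply (measurable_hat a)]
  · rfl
  · exact (measurableSet_gen h.meas).inter (measurableSet_at h.meas s)

/-- The skeleton covering `0` has the same law for both processes. On each skeleton the coupling
compares the classes of Y on the pieces with the class of X on the whole (`PR_le_uns_add_split`);
the comparison is then summed over skeletons. -/
theorem Link.transfer (H : Link ρ ξ τ R μ a cd1 ν b cd2 D p) {j : ℕ} (hj : p j)
    (Q : ℤ × Skel → Set (List ℕ)) :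
    ν {y | ∃ s, At ξ τ (R j) s (hat b y) ∧ Cov s 0 ∧ lst τ R cd2 j s.2 (wd y s.1) ∈ Q s} ≤
      μ (unsEv ξ τ R a cd1 D j Q) + μ (splitEv ξ τ R a cd1 D j) := by
  have := countable_skel
  rw [unsEv, splitEv, H.sx.measure_codeEv, H.sx.measure_codeEv, ← ENNReal.tsum_add]
  refine le_trans ?_ (le_trans (measure_iUnion_le (μ := ν) fun s : {s : ℤ × Skel // Cov s 0} =>
    {y | (Gen ξ (hat b y) ∧ At ξ τ (R j) s.1 (hat b y)) ∧
      lst τ R cd2 j s.1.2 (wd y s.1.1) ∈ Q s.1}) ?_)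
  · refine measure_mono_ae ?_
    filter_upwards [H.sy.gen] with y hy
    rintro ⟨s, h1, h2, h3⟩
    exact Set.mem_iUnion.2 ⟨⟨s, h2⟩, ⟨hy, h1⟩, h3⟩
  · refine ENNReal.tsum_le_tsum fun s => ?_
    by_cases h0 : ρ {ω | Gen ξ ω ∧ At ξ τ (R j) s.1 ω} = 0
    · refine le_trans (le_of_eq (measure_mono_null ?_ (h0 ▸ H.sy.measure_at_eq (R j) s.1)))
        zero_le
      exact fun y hy => hy.1
    have hadm : Adm ρ ξ τ R j s.1.2 :=
      ⟨s.1.1, fun h => h0 (measure_mono_null (fun ω hω => hω.2) h)⟩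
    have hmk := H.sx.mk_of_adm hadm
    have ey := at_law (τ := τ) H.sy.meas H.sy.stat H.sy.renewal H.sy.apos (H.sy.one_le j) s.1
      (H.sy.HS_ne_zero hadm) hmk (lst τ R cd2 j s.1.2) (lst_depN H.sy.depN τ R j _) (Q s.1)
    have ex := fun C : Set ℕ => at_law (τ := τ) H.sx.meas H.sx.stat H.sx.renewal H.sx.apos
      (H.sx.one_le j) s.1 (H.sx.HS_ne_zero hadm) hmk (cd1 s.1.2) (H.sx.depN _) C
    rw [H.sy.lawF_lst D H.ch (fun i hi => H.piy i (by
      subst hi; exact (H.alt i).1 hj)) hmk (H.sy.HS_ne_zero hadm), H.sy.measure_at_eq] at ey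
    simp only [← H.pix j hj, H.sx.measure_at_eq] at ex
    refine le_trans (le_of_eq ey) (le_trans (mul_le_mul_right (PR_le_uns_add_split H.isChain j _
      hadm (Q s.1)) _) ?_)
    rw [mul_add]
    exact le_of_eq (congrArg₂ _ (ex _).symm (ex _).symm)

/-! ### Determination of windows -/

/-- The list `q` of symbols on the children of `s` determines the symbol `c` at `n`. -/
def Dt (ξ : (ℤ → Bool) → ℤ → ℕ) (τ : ℕ → ℕ) (R : ℕ → ℕ) (ν : Measure (ℤ → B)) (b : B)
    (cd2 : Skel → (ℕ → B) → ℕ) (j : ℕ) (s : ℤ × Skel) (q : List ℕ) (n : ℤ) (c : B) : Prop :=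
  ∀ᵐ y ∂ν, At ξ τ (R j) s (hat b y) → lst τ R cd2 j s.2 (wd y s.1) = q → y n = c

theorem ae_dt (ξ : (ℤ → Bool) → ℤ → ℕ) (τ : ℕ → ℕ) (R : ℕ → ℕ) (ν : Measure (ℤ → B)) (b : B)
    (cd2 : Skel → (ℕ → B) → ℕ) : ∀ᵐ y ∂ν, ∀ j s q n c, Dt ξ τ R ν b cd2 j s q n c →
      At ξ τ (R j) s (hat b y) → lst τ R cd2 j s.2 (wd y s.1) = q → y n = c := by
  have := countable_skel
  rw [ae_all_iff]; intro j
  rw [ae_all_iff]; intro s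
  rw [ae_all_iff]; intro q
  rw [ae_all_iff]; intro n
  rw [ae_all_iff]; intro c
  by_cases h : Dt ξ τ R ν b cd2 j s q n c
  · filter_upwards [h] with y hy _ using hy
  · exact Eventually.of_forall fun y h' => absurd h' h

/-- The list `q` of symbols on the children of `s` determines the word `w` on `[-M, M]`. -/
def WD (ξ : (ℤ → Bool) → ℤ → ℕ) (τ : ℕ → ℕ) (R : ℕ → ℕ) (ν : Measure (ℤ → B)) (b : B)
    (cd2 : Skel → (ℕ → B) → ℕ) (M : ℕ) (j : ℕ) (s : ℤ × Skel) (q : List ℕ) (w : ℤ → B) : Prop :=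
  ∀ n ∈ Set.Icc (-(M : ℤ)) M, Cov s n ∧ Dt ξ τ R ν b cd2 j s q n (w n)

/-- The code of the skeleton of level `j` that covers `n` determines the symbol at `n`. -/
def DetP (ξ : (ℤ → Bool) → ℤ → ℕ) (τ : ℕ → ℕ) (R : ℕ → ℕ) (ν : Measure (ℤ → B)) (b : B)
    (cd2 : Skel → (ℕ → B) → ℕ) (j : ℕ) (n : ℤ) (y : ℤ → B) : Prop :=
  ∃ s, At ξ τ (R j) s (hat b y) ∧ Cov s n ∧ ∃ c, ∀ᵐ y' ∂ν, At ξ τ (R j) s (hat b y') →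
    cd2 s.2 (wd y' s.1) = cd2 s.2 (wd y s.1) → y' n = c

theorem DetP.of_shN (hs : MeasurePreserving shift ν ν) (hg : ∀ᵐ y ∂ν, Gen ξ (hat b y)) {j : ℕ}
    {n : ℤ} {y : ℤ → B} (hy : Gen ξ (hat b y)) (h : DetP ξ τ R ν b cd2 j 0 (shN n y)) :
    DetP ξ τ R ν b cd2 j n y := by
  obtain ⟨s, h1, h2, c, h3⟩ := h
  have e : ∀ (y : ℤ → B), wd y (s.1 + n) = wd (shN n y) s.1 := by
    intro y; funext i; simp only [wd, shN]; congr 1; ring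
  rw [hat_shN, hy.at_shN] at h1
  refine ⟨(s.1 + n, s.2), h1, ?_, c, ?_⟩
  · refine ⟨?_, ?_⟩
    · have := h2.1; dsimp only; omega
    · have := h2.2; dsimp only; omega
  · filter_upwards [ae_shN hs h3, hg] with y' hy' hgy' h4 h5
    rw [e, e] at h5
    have := hy' n (by rw [hat_shN, hgy'.at_shN]; exact h4) h5
    simpa [shN] using this

/-- Every window is eventually covered. -/
theorem Side.uncovered (h : Side ρ ξ τ R μ a cd1) (hR : Tendsto R atTop atTop) (M : ℕ) :
    ∀ ε : ℝ≥0∞, ε ≠ 0 → ∃ J, ∀ j ≥ J, μ {x | ∃ s, At ξ τ (R j) s (hat a x) ∧ Cov s 0 ∧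
      ¬ ∀ n ∈ Set.Icc (-(M : ℤ)) M, Cov s n} ≤ ε := by
  have := countable_skel
  set U : ℕ → Set (ℤ → A) := fun J => {x | ∃ j ≥ J, ∃ s, At ξ τ (R j) s (hat a x) ∧ Cov s 0 ∧
      ¬ ∀ n ∈ Set.Icc (-(M : ℤ)) M, Cov s n} with hU
  have hm : ∀ J, MeasurableSet (U J) := by
    intro J
    have e : U J = ⋃ (j : ℕ) (s : ℤ × Skel), ({x | At ξ τ (R j) s (hat a x)} ∩
        {_x | J ≤ j ∧ Cov s 0 ∧ ¬ ∀ n ∈ Set.Icc (-(M : ℤ)) M, Cov s n}) := by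
      ext x
      simp only [hU, Set.mem_ofPred_eq, Set.mem_iUnion, Set.mem_inter_iff, ge_iff_le]
      constructor
      · rintro ⟨j, h1, s, h2, h3⟩; exact ⟨j, s, h2, h1, h3⟩
      · rintro ⟨j, s, h2, h1, h3⟩; exact ⟨j, h1, s, h2, h3⟩
    rw [e]
    exact MeasurableSet.iUnion fun j => MeasurableSet.iUnion fun s =>
      ((measurableSet_at h.meas s).preimage (measurable_hat a)).inter (MeasurableSet.const _)
  have hanti : Antitone U := fun J J' hJ x ⟨j, h1, h2⟩ => ⟨j, hJ.trans h1, h2⟩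
  have hlim := tendsto_measure_iInter_atTop (μ := μ) (fun J => (hm J).nullMeasurableSet) hanti
    ⟨0, measure_ne_top _ _⟩
  have h0 : μ (⋂ J, U J) = 0 := by
    refine measure_mono_null_ae ?_ measure_empty
    filter_upwards [h.gen] with x hx hxU
    obtain ⟨r0, hr0⟩ := hx.reg.eventually_cover M
    obtain ⟨J, hJ⟩ := (tendsto_atTop.1 hR r0).exists_forall_of_atTop
    obtain ⟨j, hj, s, h1, h2, h3⟩ := Set.mem_iInter.1 hxU J
    obtain ⟨e1, e2⟩ := h1.1.ends h2.1 h2.2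
    have := hr0 _ (hJ j hj)
    rw [e1, e2] at this
    exact h3 fun n hn => ⟨by have := hn.1; omega, by have := hn.2; omega⟩
  rw [h0] at hlim
  intro ε hε
  obtain ⟨J, hJ⟩ := (hlim.eventually_le_const (pos_iff_ne_zero.2 hε)).exists_forall_of_atTop
  refine ⟨J, fun j hj => le_trans (measure_mono ?_) (hJ J le_rfl)⟩
  rintro x ⟨s, hs⟩
  exact ⟨j, hj, s, hs⟩

/-- The symbols on the children determine every window, up to small probability. -/
theorem Side.det_window (h : Side ρ ξ τ R ν b cd2) (hR : Tendsto R atTop atTop)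
    (hD : ∀ ε : ℝ≥0∞, ε ≠ 0 → ∃ J, ∀ j ≥ J, ν {y | ¬ DetP ξ τ R ν b cd2 j 0 y} ≤ ε) (M : ℕ)
    (ε : ℝ≥0∞) (hε : ε ≠ 0) : ∃ J, ∀ j ≥ J, ν {y | ¬ ∃ s, At ξ τ (R j) s (hat b y) ∧ Cov s 0 ∧
      ∃ w, WD ξ τ R ν b cd2 M j s (lst τ R cd2 j s.2 (wd y s.1)) w} ≤ ε := by
  have hε2 : ε / 2 ≠ 0 := by simpa using hε
  have hε3 : ε / 2 / (2 * M + 1 : ℕ) ≠ 0 := by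
    rw [Ne, ENNReal.div_eq_zero_iff]; push Not
    exact ⟨hε2, ENNReal.natCast_ne_top _⟩
  obtain ⟨J1, hJ1⟩ := h.uncovered hR M _ hε2
  obtain ⟨J2, hJ2⟩ := hD _ hε3
  -- The shift by one is there because the list on a node of level `j` consists of codes of level `j
  -- - 1`.
  refine ⟨max J1 (J2 + 1), fun j hj => ?_⟩
  have hj1 : J1 ≤ j := le_trans (le_max_left _ _) hj
  have hj2 : J2 + 1 ≤ j := le_trans (le_max_right _ _) hj
  obtain ⟨i, rfl⟩ : ∃ i, j = i + 1 := ⟨j - 1, by omega⟩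
  set U1 := {x | ∃ s, At ξ τ (R (i + 1)) s (hat b x) ∧ Cov s 0 ∧
      ¬ ∀ n ∈ Set.Icc (-(M : ℤ)) M, Cov s n} with hU1
  set U2 : ℤ → Set (ℤ → B) := fun n => shN n ⁻¹' {y | ¬ DetP ξ τ R ν b cd2 i 0 y} with hU2
  have hsub : ν {y | ¬ ∃ s, At ξ τ (R (i + 1)) s (hat b y) ∧ Cov s 0 ∧
      ∃ w, WD ξ τ R ν b cd2 M (i + 1) s (lst τ R cd2 (i + 1) s.2 (wd y s.1)) w} ≤
      ν (U1 ∪ ⋃ n ∈ Finset.Icc (-(M : ℤ)) M, U2 n) := by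
    refine measure_mono_ae ?_
    filter_upwards [h.gen] with y hy hbad
    by_contra hcon
    refine hbad ?_
    obtain ⟨s, h1, h2⟩ := hy.exists_at τ (R (i + 1)) 0
    have hcov : ∀ n ∈ Set.Icc (-(M : ℤ)) M, Cov s n := by
      by_contra hc
      exact hcon (Or.inl ⟨s, h1, h2, hc⟩)
    refine ⟨s, h1, h2, ?_⟩
    have hex : ∀ n : ℤ, n ∈ Set.Icc (-(M : ℤ)) M → ∃ c : B,
        Dt ξ τ R ν b cd2 (i + 1) s (lst τ R cd2 (i + 1) s.2 (wd y s.1)) n c := by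
      intro n hn
      have hdet : DetP ξ τ R ν b cd2 i n y := by
        refine DetP.of_shN h.stat h.gen hy ?_
        by_contra hc
        refine hcon (Or.inr ?_)
        simp only [Set.mem_iUnion]
        exact ⟨n, Finset.mem_Icc.2 hn, hc⟩
      obtain ⟨s', k1, k2, c, k3⟩ := hdet
      have hcn := hcov n hn
      obtain ⟨z, hz, hz1, hz2⟩ := exists_piece (s := s) (R i) n hcn.1 hcn.2
      have hm : R i ≤ R (i + 1) := h.mono (Nat.le_succ i)
      have hlt := ((pcs_chn (R i) s.2).mem z hz).2.1
      obtain rfl : s' = (s.1 + z.1, s.2.sub τ z.1 z.2) := by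
        refine hy.at_unique k1 k2 (h1.sub hm hz) ⟨hz1, ?_⟩
        change n < s.1 + (z.1 : ℤ) + ((z.2 - z.1 : ℕ) : ℤ)
        omega
      refine ⟨c, ?_⟩
      filter_upwards [k3] with y' hy' hy2 hy3
      refine hy' (hy2.sub hm hz) ?_
      have := List.map_inj_left.1 hy3 z hz
      simpa only [wd_add] using this
    have : Nonempty B := ⟨b⟩
    choose! w hw using hex
    exact ⟨w, fun n hn => ⟨hcov n hn, hw n hn⟩⟩
  refine hsub.trans ((measure_union_le _ _).trans ?_)
  refine le_trans (add_le_add (hJ1 _ hj1) (measure_biUnion_finset_le _ _)) ?_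
  have hb : ∀ n ∈ Finset.Icc (-(M : ℤ)) M, ν (U2 n) ≤ ε / 2 / (2 * M + 1 : ℕ) := by
    intro n _
    rw [hU2, measure_shN h.stat]
    exact hJ2 i (by omega)
  refine le_trans (add_le_add le_rfl (Finset.sum_le_sum hb)) ?_
  rw [Finset.sum_const, Int.card_Icc, nsmul_eq_mul]
  have : ((M : ℤ) + 1 - -(M : ℤ)).toNat = 2 * M + 1 := by omega
  rw [this, ENNReal.mul_div_cancel (Nat.cast_ne_zero.2 (Nat.succ_ne_zero _))
    (ENNReal.natCast_ne_top _), ENNReal.add_halves]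

end
end KSCoding

open MeasureTheory Filter Asymptotics
open scoped ENNReal
namespace KSCoding
noncomputable section

variable {A B : Type*} [Fintype A] [DecidableEq A] [MeasurableSpace A]
  [MeasurableSingletonClass A] [Fintype B] [DecidableEq B] [MeasurableSpace B]
  [MeasurableSingletonClass B] {ρ : Measure (ℤ → Bool)} {ξ : (ℤ → Bool) → ℤ → ℕ} {τ : ℕ → ℕ}
  {R : ℕ → ℕ} {μ : Measure (ℤ → A)} [IsProbabilityMeasure μ] {a : A}
  {cd1 : Skel → (ℕ → A) → ℕ} {ν : Measure (ℤ → B)} [IsProbabilityMeasure ν] {b : B}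
  {cd2 : Skel → (ℕ → B) → ℕ} {D : ChainData Skel} {p : ℕ → Prop}

set_option linter.unusedSectionVars false

/-! ### The isomorphism -/

/-- The codes of both processes are asymptotically determining. -/
structure Good (ξ : (ℤ → Bool) → ℤ → ℕ) (τ : ℕ → ℕ) (R : ℕ → ℕ) (μ : Measure (ℤ → A)) (a : A)
    (cd1 : Skel → (ℕ → A) → ℕ) (ν : Measure (ℤ → B)) (b : B)
    (cd2 : Skel → (ℕ → B) → ℕ) (D : ChainData Skel) (p : ℕ → Prop) : Prop where
  tendsto : Tendsto R atTop atTop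
  split : ∀ ε : ℝ≥0∞, ε ≠ 0 → ∃ J, ∀ j ≥ J, p j → μ (splitEv ξ τ R a cd1 D j) ≤ ε
  det : ∀ ε : ℝ≥0∞, ε ≠ 0 → ∃ J, ∀ j ≥ J, ν {y | ¬ DetP ξ τ R ν b cd2 j 0 y} ≤ ε

theorem Link.exists_level (H : Link ρ ξ τ R μ a cd1 ν b cd2 D p) (J : ℕ) : ∃ j ≥ J, p j := by
  by_cases h : p J
  · exact ⟨J, le_rfl, h⟩
  · exact ⟨J + 1, Nat.le_succ J, (H.alt J).2 h⟩

/-- Up to `ε`, the ν-probability of `T` is carried by samples of X whose class on a high level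
forces a word on `[-M, M]` that some point of `T` shows. The error comes from the split classes and
from the windows that the classes of Y leave undetermined. -/
theorem Link.large_level (H : Link ρ ξ τ R μ a cd1 ν b cd2 D p)
    (G : Good ξ τ R μ a cd1 ν b cd2 D p) (M J : ℕ) (ε : ℝ≥0∞) (hε : ε ≠ 0)
    (T : Set (ℤ → B)) : ∃ j ≥ J, p j ∧ ν T ≤
      μ (unsEv ξ τ R a cd1 D j fun s => {q | ∃ w : ℤ → B, WD ξ τ R ν b cd2 M j s q w ∧
        ∃ y ∈ T, ∀ n ∈ Set.Icc (-(M : ℤ)) M, y n = w n}) + ε := by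
  have hε2 : ε / 2 ≠ 0 := by simpa using hε
  obtain ⟨J1, hJ1⟩ := G.split _ hε2
  obtain ⟨J2, hJ2⟩ := H.sy.det_window G.tendsto G.det M _ hε2
  obtain ⟨j, hj, hpj⟩ := H.exists_level (max J (max J1 J2))
  simp only [ge_iff_le, max_le_iff] at hj
  refine ⟨j, hj.1, hpj, ?_⟩
  have h1 := H.transfer hpj fun s => {q | ∃ w : ℤ → B, WD ξ τ R ν b cd2 M j s q w ∧
        ∃ y ∈ T, ∀ n ∈ Set.Icc (-(M : ℤ)) M, y n = w n}
  have h2 : ν T ≤ ν ({y | ∃ s, At ξ τ (R j) s (hat b y) ∧ Cov s 0 ∧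
      lst τ R cd2 j s.2 (wd y s.1) ∈ {q | ∃ w : ℤ → B, WD ξ τ R ν b cd2 M j s q w ∧
        ∃ y ∈ T, ∀ n ∈ Set.Icc (-(M : ℤ)) M, y n = w n}} ∪
      {y | ¬ ∃ s, At ξ τ (R j) s (hat b y) ∧ Cov s 0 ∧
        ∃ w, WD ξ τ R ν b cd2 M j s (lst τ R cd2 j s.2 (wd y s.1)) w}) := by
    refine measure_mono_ae ?_
    filter_upwards [ae_dt ξ τ R ν b cd2] with y hy hyT
    by_cases h : ∃ s, At ξ τ (R j) s (hat b y) ∧ Cov s 0 ∧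
        ∃ w, WD ξ τ R ν b cd2 M j s (lst τ R cd2 j s.2 (wd y s.1)) w
    · obtain ⟨s, k1, k2, w, k3⟩ := h
      exact Or.inl ⟨s, k1, k2, w, k3, y, hyT, fun n hn => hy _ _ _ _ _ (k3 n hn).2 k1 rfl⟩
    · exact Or.inr h
  refine h2.trans ((measure_union_le _ _).trans ((add_le_add h1 (hJ2 j hj.2.2)).trans ?_))
  rw [add_assoc]
  exact add_le_add le_rfl ((add_le_add (hJ1 j hj.2.1 hpj) le_rfl).trans
    (le_of_eq (ENNReal.add_halves ε)))

/-- Almost every sample has good skeletons of high level. -/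
theorem Link.ae_level (H : Link ρ ξ τ R μ a cd1 ν b cd2 D p)
    (G : Good ξ τ R μ a cd1 ν b cd2 D p) : ∀ᵐ x ∂μ, ∀ M J : ℕ, ∃ j ≥ J, p j ∧ ∃ s q w,
      At ξ τ (R j) s (hat a x) ∧ D.Uns j s.2 (cd1 s.2 (wd x s.1)) q ∧
        WD ξ τ R ν b cd2 M j s q w := by
  rw [ae_all_iff]; intro M
  rw [ae_all_iff]; intro J
  set Q : ℕ → ℤ × Skel → Set (List ℕ) := fun j s => {q | ∃ w : ℤ → B,
    WD ξ τ R ν b cd2 M j s q w ∧ ∃ y ∈ (Set.univ : Set (ℤ → B)),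
      ∀ n ∈ Set.Icc (-(M : ℤ)) M, y n = w n} with hQ
  set E : Set (ℤ → A) := ⋃ (j : ℕ) (_ : J ≤ j ∧ p j), unsEv ξ τ R a cd1 D j (Q j) with hE
  have hm : MeasurableSet E := MeasurableSet.iUnion fun j => MeasurableSet.iUnion fun _ =>
    H.sx.measurableSet_codeEv _ _
  -- With `T` the whole space, one level at least `J` already gives probability `1 - ε`.
  have h1 : 1 ≤ μ E := by
    refine ENNReal.le_of_forall_pos_le_add fun ε hε _ => ?_
    obtain ⟨j, hj, hpj, h⟩ := H.large_level G M J ε (by simpa using hε.ne') Set.univ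
    rw [measure_univ] at h
    refine h.trans (add_le_add (measure_mono ?_) le_rfl)
    exact Set.subset_iUnion₂ (s := fun j (_ : J ≤ j ∧ p j) => unsEv ξ τ R a cd1 D j (Q j)) j
      ⟨hj, hpj⟩
  have h2 : ∀ᵐ x ∂μ, x ∈ E := (mem_ae_iff_prob_eq_one hm).2 (le_antisymm prob_le_one h1)
  filter_upwards [h2] with x hx
  obtain ⟨j, hj, hx⟩ := Set.mem_iUnion₂.1 hx
  obtain ⟨-, s, h3, -, q, ⟨w, h4, -⟩, h5⟩ := hx
  exact ⟨j, hj.1, hj.2, s, q, w, h3, h5, h4⟩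

theorem Link.phi_eq_of_wd (H : Link ρ ξ τ R μ a cd1 ν b cd2 D p) {x : ℤ → A}
    (hx : Gd ρ ξ τ R (hat a x)) {j M : ℕ} (hj : p j) {s : ℤ × Skel} {q : List ℕ} {w : ℤ → B}
    (hs : At ξ τ (R j) s (hat a x)) (hq : D.Uns j s.2 (cd1 s.2 (wd x s.1)) q)
    (hw : WD ξ τ R ν b cd2 M j s q w) {n : ℤ} (hn : n ∈ Set.Icc (-(M : ℤ)) M) :
    phi ξ τ R a cd1 ν b cd2 D p x n = w n :=
  H.phi_eq hx ⟨hx.1, j, q, s, hs, hq, hj, (hw n hn).1, (hw n hn).2⟩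

/-- For events of a finite window, the transfer gives `ν T ≤ μ (φ⁻¹ T)`. Applied also to the
complement it gives equality, as both are probability measures. -/
theorem Link.measurePreserving_phi (H : Link ρ ξ τ R μ a cd1 ν b cd2 D p)
    (G : Good ξ τ R μ a cd1 ν b cd2 D p) :
    MeasurePreserving (phi ξ τ R a cd1 ν b cd2 D p) μ ν := by
  have hφ := H.measurable_phi
  refine ⟨hφ, ?_⟩
  have hprob : IsProbabilityMeasure (μ.map (phi ξ τ R a cd1 ν b cd2 D p)) :=
    Measure.isProbabilityMeasure_map hφ.aemeasurable
  have key : ∀ (M : ℕ) (T : Set (ℤ → B)), MeasurableSet T → (∀ y y' : ℤ → B,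
      (∀ n ∈ Set.Icc (-(M : ℤ)) M, y n = y' n) → y ∈ T → y' ∈ T) →
      ν T ≤ μ.map (phi ξ τ R a cd1 ν b cd2 D p) T := by
    intro M T hT hTM
    refine ENNReal.le_of_forall_pos_le_add fun ε hε _ => ?_
    obtain ⟨j, -, hpj, h⟩ := H.large_level G M 0 ε (by simpa using hε.ne') T
    refine h.trans (add_le_add ?_ le_rfl)
    rw [Measure.map_apply hφ hT]
    refine measure_mono_ae ?_
    filter_upwards [H.sx.ae_map H.sx.ae_gd] with x hx
    rintro ⟨-, s, h3, -, q, ⟨w, h4, y, hy, hyw⟩, h5⟩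
    refine hTM y _ (fun n hn => ?_) hy
    rw [hyw n hn, H.phi_eq_of_wd hx hpj h3 h5 h4 hn]
  refine ext_of_windows (fun M : ℕ => Set.Icc (-(M : ℤ)) M)
    (fun M M' h => Set.Icc_subset_Icc (by omega) (by omega)) (fun M => Set.finite_Icc _ _)
    (fun i => ⟨i.natAbs, by rw [Set.mem_Icc]; omega⟩) _ _ fun M w => ?_
  have hT : MeasurableSet {f : ℤ → B | ∀ i ∈ Set.Icc (-(M : ℤ)) M, f i = w i} := by
    have e : {f : ℤ → B | ∀ i ∈ Set.Icc (-(M : ℤ)) M, f i = w i} =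
        ⋂ i ∈ Set.Icc (-(M : ℤ)) M, {f : ℤ → B | f i = w i} := by ext f; simp
    rw [e]
    exact MeasurableSet.biInter (Set.to_countable _) fun i _ => measurableSet_apply_eq _ _
  have h1 := key M _ hT (fun y y' h hy n hn => by rw [← h n hn, hy n hn])
  have h2 := key M _ hT.compl (fun y y' h hy hy' => hy fun n hn => by rw [h n hn, hy' n hn])
  rw [prob_compl_eq_one_sub hT, prob_compl_eq_one_sub hT] at h2
  refine le_antisymm ?_ h1
  exact (ENNReal.sub_le_sub_iff_left prob_le_one ENNReal.one_ne_top).1 h2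

theorem At.hat_eq {r : ℕ} {s : ℤ × Skel} {ω ω' : ℤ → Bool} (h : At ξ τ r s ω)
    (h' : At ξ τ r s ω') {n : ℤ} (hn : Cov s n) : ω n = ω' n := by
  have e : ∀ ω : ℤ → Bool, At ξ τ r s ω → ω n = s.2.stx (n - s.1).toNat := by
    intro ω h
    have h1 := hn.1
    have h2 := hn.2
    conv_rhs => rw [← h.2]
    rw [skelOn_stx _ _ _ _ _ _ (by omega)]
    congr 1; omega
  rw [e ω h, e ω' h']

/-- At each coordinate the image agrees with a generic `y` that has the skeleton of `x` there. -/
theorem Link.ae_hat_phi (H : Link ρ ξ τ R μ a cd1 ν b cd2 D p)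
    (G : Good ξ τ R μ a cd1 ν b cd2 D p) :
    ∀ᵐ x ∂μ, hat b (phi ξ τ R a cd1 ν b cd2 D p x) = hat a x := by
  filter_upwards [H.ae_level G, H.sx.ae_map H.sx.ae_gd] with x hx hg
  funext n
  obtain ⟨j, -, hj, s, q, w, h1, h2, h3⟩ := hx n.natAbs 0
  have hn : n ∈ Set.Icc (-(n.natAbs : ℤ)) n.natAbs := by rw [Set.mem_Icc]; omega
  obtain ⟨y, hy1, -, hy2, hy3⟩ := H.exists_generic hj (hg.2 _ _ h1) h2.1 (h3 n hn).2
  rw [← hy2.hat_eq h1 (h3 n hn).1, hat, hat, H.phi_eq_of_wd hg hj h1 h2 h3 hn, hy1 hy2 hy3]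

theorem Cmp.congr (hd2 : ∀ S, DepN (cd2 S) S.len) {j : ℕ}
    {s : ℤ × Skel} {x : ℤ → A} {y y' : ℤ → B} (h : Cmp τ R cd1 cd2 D p j s x y)
    (hy : ∀ n, Cov s n → y n = y' n) : Cmp τ R cd1 cd2 D p j s x y' := by
  have hw : ∀ k < s.2.len, wd y s.1 k = wd y' s.1 k := fun k hk =>
    hy _ ⟨by omega, by omega⟩
  have e1 := lst_depN hd2 τ R j s.2 _ _ hw
  have e2 := hd2 s.2 _ _ hw
  rw [Cmp, e1, e2] at h
  exact h

/-- Almost every sample is compatible with its image on all levels. -/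
theorem Link.ae_cmp (H : Link ρ ξ τ R μ a cd1 ν b cd2 D p)
    (G : Good ξ τ R μ a cd1 ν b cd2 D p) : ∀ᵐ x ∂μ, ∀ j s, At ξ τ (R j) s (hat a x) →
      Cmp τ R cd1 cd2 D p j s x (phi ξ τ R a cd1 ν b cd2 D p x) := by
  filter_upwards [H.ae_level G, H.sx.ae_map H.sx.ae_gd] with x hx hg j s hs
  -- The window contains the whole of `s`, so the image and the compatible `y` agree on `s`, and
  -- compatibility on `s` depends on nothing else.
  set M : ℕ := s.1.natAbs + s.2.len with hM
  obtain ⟨j', hjj, hj', s', q, w, h1, h2, h3⟩ := hx M j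
  have hgen : ∀ᵐ y ∂ν, ∀ n, n ∈ Set.Icc (-(M : ℤ)) M →
      At ξ τ (R j') s' (hat b y) → lst τ R cd2 j' s'.2 (wd y s'.1) = q → y n = w n := by
    rw [ae_all_iff]; intro n
    by_cases hn : n ∈ Set.Icc (-(M : ℤ)) M
    · filter_upwards [(h3 n hn).2] with y hy _ using hy
    · exact Eventually.of_forall fun y h => absurd h hn
  obtain ⟨y, hy1, -, hy2, hy3⟩ := H.exists_generic hj' (hg.2 _ _ h1) h2.1 hgen
  have hlt := hs.1.1
  have hs1 : s.1 ∈ Set.Icc (-(M : ℤ)) M := by rw [Set.mem_Icc]; omega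
  have hc := (H.cmp_down hjj hg hs (n := s.1) ⟨le_rfl, hlt⟩ h1 (h3 _ hs1).1 hy2
    ⟨fun _ => by rw [hy3]; exact h2.1, fun h => absurd hj' h⟩).1
  refine hc.congr H.sy.depN fun n hn => ?_
  have hn' : n ∈ Set.Icc (-(M : ℤ)) M := by
    have h4 := hn.1; have h5 := hn.2
    rw [Set.mem_Icc]; omega
  rw [hy1 n hn' hy2 hy3, H.phi_eq_of_wd hg hj' h1 h2 h3 hn']

/-- The image `y` of `x` has, on high levels of Y, a class that is not split and so forces the
classes of X on the pieces. By `Link.ae_cmp` those of `x` are compatible with it; hence they are the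
forced ones, and they determine the symbols of `x`. -/
theorem Link.ae_phi_phi (H : Link ρ ξ τ R μ a cd1 ν b cd2 D p)
    (G : Good ξ τ R μ a cd1 ν b cd2 D p)
    (G' : Good ξ τ R ν b cd2 μ a cd1 D (fun j => ¬ p j)) :
    ∀ᵐ x ∂μ, phi ξ τ R b cd2 μ a cd1 D (fun j => ¬ p j)
      (phi ξ τ R a cd1 ν b cd2 D p x) = x := by
  have hy := (H.measurePreserving_phi G).quasiMeasurePreserving.ae
    ((H.symm.ae_level G').and (H.symm.sx.ae_map H.symm.sx.ae_gd))
  filter_upwards [H.ae_cmp G, H.ae_hat_phi G, hy, ae_dt ξ τ R μ a cd1] with x h1 h2 h3 h4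
  obtain ⟨h3, hg⟩ := h3
  funext n
  have hn : n ∈ Set.Icc (-(n.natAbs : ℤ)) n.natAbs := by rw [Set.mem_Icc]; omega
  obtain ⟨j, -, hj, s, q, w, k1, k2, k3⟩ := h3 n.natAbs 0
  rw [H.symm.phi_eq_of_wd hg hj k1 k2 k3 hn]
  rw [h2] at k1
  exact (h4 _ _ _ _ _ (k3 n hn).2 k1 (k2.2 _ ((h1 j s k1).2 hj))).symm

theorem Link.isIsomorphism (H : Link ρ ξ τ R μ a cd1 ν b cd2 D p)
    (G : Good ξ τ R μ a cd1 ν b cd2 D p)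
    (G' : Good ξ τ R ν b cd2 μ a cd1 D (fun j => ¬ p j)) :
    IsIsomorphism μ ν (phi ξ τ R a cd1 ν b cd2 D p)
      (phi ξ τ R b cd2 μ a cd1 D (fun j => ¬ p j)) where
  preserving := H.measurePreserving_phi G
  preserving_inv := H.symm.measurePreserving_phi G'
  equivariant := Eventually.of_forall fun x => H.phi_shN x 1
  equivariant_inv := Eventually.of_forall fun y => H.symm.phi_shN y 1
  left_inv := H.ae_phi_phi G G'
  right_inv := by
    have h1 := (H.measurePreserving_phi G).map_eq
    have hm1 := H.measurable_phi
    have hm2 := H.symm.measurable_phi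
    have hS : MeasurableSet {y | phi ξ τ R a cd1 ν b cd2 D p
        (phi ξ τ R b cd2 μ a cd1 D (fun j => ¬ p j) y) = y} :=
      measurableSet_eq_fun (hm1.comp hm2) measurable_id
    -- The right inverse follows from the left one, since Y has the law of the image of X.
    have h2 : ∀ᵐ y ∂(μ.map (phi ξ τ R a cd1 ν b cd2 D p)), phi ξ τ R a cd1 ν b cd2 D p
        (phi ξ τ R b cd2 μ a cd1 D (fun j => ¬ p j) y) = y := by
      rw [ae_map_iff hm1.aemeasurable hS]
      filter_upwards [H.ae_phi_phi G G'] with x hx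
      rw [hx]
    rwa [h1] at h2

/-- The probability that the class on a level does not determine the class of the image on the
preceding level. -/
theorem Link.measure_not_determines_le (H : Link ρ ξ τ R μ a cd1 ν b cd2 D p)
    (G : Good ξ τ R μ a cd1 ν b cd2 D p) {j : ℕ} (hj : p (j + 1)) {V W : Type*}
    (F : (ℤ → A) → V) (F' : (ℤ → B) → W) (N : ℕ)
    (hF : ∀ x x', Gen ξ (hat a x) → Gen ξ (hat a x') → F x' = F x → ∀ s,
      At ξ τ (R (j + 1)) s (hat a x) → Cov s 0 →
        At ξ τ (R (j + 1)) s (hat a x') ∧ cd1 s.2 (wd x' s.1) = cd1 s.2 (wd x s.1))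
    (hF' : ∀ y y' s, At ξ τ (R j) s (hat b y) → At ξ τ (R j) s (hat b y') → Cov s 0 →
      N ≤ s.2.len → cd2 s.2 (wd y' s.1) = cd2 s.2 (wd y s.1) → F' y' = F' y) :
    μ {x | ¬ Determines μ F (fun x => F' (phi ξ τ R a cd1 ν b cd2 D p x)) x} ≤
      μ (splitEv ξ τ R a cd1 D (j + 1)) +
        μ {x | ∃ s, At ξ τ (R j) s (hat a x) ∧ Cov s 0 ∧ s.2.len < N} := by
  refine le_trans (measure_mono_ae ?_) (measure_union_le _ _)
  have hall := ((H.ae_cmp G).and (H.ae_hat_phi G)).and (H.sx.ae_map H.sx.ae_gd)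
  filter_upwards [hall] with x hx hbad
  obtain ⟨⟨hx1, hx2⟩, hg⟩ := hx
  by_contra hcon
  refine hbad ?_
  obtain ⟨s, h1, h2⟩ := hg.1.exists_at τ (R (j + 1)) 0
  have huns : ∃ q, D.Uns (j + 1) s.2 (cd1 s.2 (wd x s.1)) q := by
    by_contra hno
    refine hcon (Or.inl ⟨hg.1, s, h1, h2, ?_, hno⟩)
    have hk := (hx1 _ s h1).1 hj
    rw [← (kap_spec H.isChain _ _ (hg.adm h1)).1, ← PMF.mem_support_iff, PMF.support_map]
    exact ⟨_, hk, rfl⟩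
  obtain ⟨q, hq⟩ := huns
  obtain ⟨z, hz, hz1, hz2⟩ := exists_piece (s := s) (R j) 0 h2.1 h2.2
  have hm : R j ≤ R (j + 1) := H.sx.mono (Nat.le_succ j)
  have hlt := ((pcs_chn (R j) s.2).mem z hz).2.1
  have hc : Cov (s.1 + z.1, s.2.sub τ z.1 z.2) 0 := by
    refine ⟨hz1, ?_⟩
    change 0 < s.1 + (z.1 : ℤ) + ((z.2 - z.1 : ℕ) : ℤ)
    omega
  have hlen : N ≤ (s.2.sub τ z.1 z.2).len := by
    by_contra hl
    exact hcon (Or.inr ⟨_, h1.sub hm hz, hc, not_le.1 hl⟩)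
  filter_upwards [hall] with x' hx' hFx
  obtain ⟨⟨hx1', hx2'⟩, hg'⟩ := hx'
  obtain ⟨k1, k2⟩ := hF x x' hg.1 hg'.1 hFx s h1 h2
  -- Both samples have the same code, which is not split, and both are compatible with their images.
  -- So the images have the same list of codes on the pieces.
  have e1 := hq.2 _ ((hx1 _ s h1).1 hj)
  have e2 := hq.2 _ (k2 ▸ (hx1' _ s k1).1 hj)
  refine hF' _ _ _ (hx2.symm ▸ h1.sub hm hz) (hx2'.symm ▸ k1.sub hm hz) hc hlen ?_
  have := List.map_inj_left.1 (e2.trans e1.symm) z hz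
  simpa only [wd_add] using this

end
end KSCoding

open MeasureTheory Filter Asymptotics
open scoped ENNReal
namespace KSCoding
noncomputable section

set_option linter.unusedSectionVars false

/-! ### Regularity of nice marker factors -/

theorem SuperPoly.tendsto_zero {f L : ℕ → ℝ} (h : SuperPoly f L) (hL : Tendsto L atTop atTop) :
    Tendsto f atTop (nhds 0) := by
  refine (h 1).trans_tendsto ?_
  simp only [pow_one]
  exact tendsto_inv_atTop_zero.comp hL

theorem shN_iterate {A : Type*} (k : ℤ) (n : ℕ) (x : ℤ → A) :
    (shN k)^[n] x = shN (n * k) x := by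
  induction n with
  | zero => simp [shN_zero]
  | succ n ih =>
    rw [Function.iterate_succ_apply', ih, shN_shN]
    congr 1; push_cast; ring

section
variable {A : Type*} [Fintype A] [DecidableEq A] [MeasurableSpace A] [MeasurableSingletonClass A]
variable {μ : Measure (ℤ → A)} [IsProbabilityMeasure μ] {a : A}
  {ξ : (ℤ → Bool) → ℤ → ℕ} {τ : ℕ → ℕ} {L : ℕ → ℝ}

theorem measurePreserving_hat (hs : MeasurePreserving shift μ μ) (a : A) :
    MeasurePreserving shift (μ.map (hat a)) (μ.map (hat a)) := by
  have hh := measurable_hat a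
  have hsh : Measurable (shift : (ℤ → Bool) → ℤ → Bool) := measurable_shN 1
  refine ⟨hsh, ?_⟩
  rw [Measure.map_map hsh hh]
  conv_rhs => rw [← hs.map_eq, Measure.map_map hh hs.measurable]
  rfl

theorem IsMarkerFactor.ae_eqv {ρ : Measure (ℤ → Bool)} (hs : MeasurePreserving shift ρ ρ)
    (h : IsMarkerFactor ρ ξ) : ∀ᵐ ω ∂ρ, ∀ n, ξ (shN n ω) = shN n (ξ ω) := by
  filter_upwards [ae_shN hs h.equivariant] with ω hω n
  have hstep : ∀ n, ξ (shN (n + 1) ω) = shN 1 (ξ (shN n ω)) := by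
    intro n
    have := hω n
    rw [shift_eq_shN, shN_shN, add_comm] at this
    exact this
  induction n using Int.induction_on with
  | zero => simp [shN_zero]
  | succ n ih => rw [hstep, ih, shN_shN, add_comm]
  | pred n ih =>
    have := hstep (-(n : ℤ) - 1)
    rw [sub_add_cancel, ih] at this
    have h2 := congrArg (shN (-1)) this
    rw [shN_shN, shN_shN] at h2
    simp only [neg_add_cancel, shN_zero] at h2
    rw [← h2]; congr 1; ring

theorem IsNice.tendsto_bad_sizes (h : IsNice μ a ξ L) : ∃ c : ℝ, 0 < c ∧
    Tendsto (fun r => μ.real {x | ¬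
      (L r / Real.log (L r) ^ c ≤ ((rightEnd (ξ (hat a x)) r - leftEnd (ξ (hat a x)) r : ℤ) : ℝ) ∧
        ((rightEnd (ξ (hat a x)) r - leftEnd (ξ (hat a x)) r : ℤ) : ℝ) ≤ L r)})
      atTop (nhds 0) := by
  obtain ⟨c, hc, -, h2⟩ := h.sizes
  exact ⟨c, hc, h2.tendsto_zero h.tendsto⟩

/-- Labels of every rank occur. -/
theorem IsNice.ae_exists_mark (h : IsNice μ a ξ L) (r : ℕ) :
    ∀ᵐ x ∂μ, ∃ i, r ≤ ξ (hat a x) i := by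
  obtain ⟨c, hc, hlim⟩ := h.tendsto_bad_sizes
  have h1 : ∀ᶠ r' in atTop, μ.real {x | ¬ ∃ i, r ≤ ξ (hat a x) i} ≤ μ.real {x | ¬
      (L r' / Real.log (L r') ^ c ≤
        ((rightEnd (ξ (hat a x)) r' - leftEnd (ξ (hat a x)) r' : ℤ) : ℝ) ∧
        ((rightEnd (ξ (hat a x)) r' - leftEnd (ξ (hat a x)) r' : ℤ) : ℝ) ≤ L r')} := by
    filter_upwards [eventually_ge_atTop r, h.tendsto.eventually_gt_atTop 1] with r' hr hL
    refine measureReal_mono ?_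
    intro x hx hx2
    have hx' : ∀ i, ¬ r' ≤ ξ (hat a x) i := fun i hi => hx ⟨i, hr.trans hi⟩
    -- Without labels of rank `r'` the supremum and the infimum of the empty set take the default
    -- value `0`. The skeleton then has length `0`, against the lower bound on lengths, which fails
    -- with vanishing probability.
    have e1 : leftEnd (ξ (hat a x)) r' = 0 := by
      have e : {i : ℤ | i ≤ 0 ∧ r' ≤ ξ (hat a x) i} = ∅ :=
        Set.eq_empty_iff_forall_notMem.2 fun i hi => hx' i hi.2
      rw [leftEnd, e, Int.csSup_empty]
    have e2 : rightEnd (ξ (hat a x)) r' = 0 := by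
      have e : {i : ℤ | 0 < i ∧ r' ≤ ξ (hat a x) i} = ∅ :=
        Set.eq_empty_iff_forall_notMem.2 fun i hi => hx' i hi.2
      rw [rightEnd, e, Int.csInf_empty]
    rw [e1, e2] at hx2
    have := hx2.1
    have hpos : 0 < L r' / Real.log (L r') ^ c :=
      div_pos (by linarith) (Real.rpow_pos_of_pos (Real.log_pos hL) _)
    simp at this
    linarith
  have h2 := ge_of_tendsto hlim h1
  have h3 : μ.real {x | ¬ ∃ i, r ≤ ξ (hat a x) i} = 0 := le_antisymm h2 measureReal_nonneg
  rw [measureReal_eq_zero_iff] at h3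
  exact h3

/-- One occurrence of a label of rank `r` is known to exist; Poincaré recurrence for the shift and
for its inverse, started there, yields infinitely many on both sides. -/
theorem ae_reg (hs : MeasurePreserving shift μ μ) (hξ : IsMarkerFactor (μ.map (hat a)) ξ)
    (h : IsNice μ a ξ L) : ∀ᵐ x ∂μ, Reg (ξ (hat a x)) := by
  have heqv := ae_of_ae_map (measurable_hat a).aemeasurable
    (hξ.ae_eqv (measurePreserving_hat hs a))
  have hrec : ∀ᵐ x ∂μ, ∀ (r : ℕ), (∃ i, r ≤ ξ (hat a x) i) ∧ ∀ n : ℤ,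
      r ≤ ξ (hat a (shN n x)) 0 →
      (∃ᶠ k : ℕ in atTop, r ≤ ξ (hat a (shN (k * 1) (shN n x))) 0) ∧
      (∃ᶠ k : ℕ in atTop, r ≤ ξ (hat a (shN (k * (-1)) (shN n x))) 0) := by
    rw [ae_all_iff]; intro r
    have hm : MeasurableSet {x : ℤ → A | r ≤ ξ (hat a x) 0} :=
      ((measurable_pi_apply 0).comp (hξ.measurable.comp (measurable_hat a)))
        (measurableSet_Ici (a := r))
    have hk : ∀ n : ℤ, ∀ᵐ x ∂μ, r ≤ ξ (hat a x) 0 →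
        ∃ᶠ k : ℕ in atTop, r ≤ ξ (hat a (shN (k * n) x)) 0 := by
      intro n
      have := ((measurePreserving_shN hs n).conservative).ae_mem_imp_frequently_image_mem
        hm.nullMeasurableSet
      simpa only [Set.mem_ofPred_eq, shN_iterate] using this
    filter_upwards [h.ae_exists_mark r, ae_shN hs (hk 1), ae_shN hs (hk (-1))] with x h1 h2 h3
    exact ⟨h1, fun n hn => ⟨h2 n hn, h3 n hn⟩⟩
  filter_upwards [heqv, hrec] with x h1 h2 r N
  obtain ⟨⟨i, hi⟩, h3⟩ := h2 r
  have e : ∀ n, ξ (hat a (shN n x)) 0 = ξ (hat a x) n := by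
    intro n
    rw [hat_shN, h1]; simp [shN]
  obtain ⟨h4, h5⟩ := h3 i (by rw [e]; exact hi)
  simp only [shN_shN, e] at h4 h5
  constructor
  · obtain ⟨k, hk, hk2⟩ := (frequently_atTop.1 h5) (i - N).natAbs
    exact ⟨_, by omega, hk2⟩
  · obtain ⟨k, hk, hk2⟩ := (frequently_atTop.1 h4) (i - N).natAbs
    exact ⟨_, by omega, hk2⟩

theorem ae_gen (hs : MeasurePreserving shift μ μ) (hξ : IsMarkerFactor (μ.map (hat a)) ξ)
    (h : IsNice μ a ξ L) : ∀ᵐ x ∂μ, Gen ξ (hat a x) := by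
  have hs' := measurePreserving_hat hs a
  have heqv := ae_of_ae_map (measurable_hat a).aemeasurable (hξ.ae_eqv hs')
  have hmk := ae_of_ae_map (measurable_hat a).aemeasurable (ae_shN hs' hξ.marks)
  filter_upwards [heqv, hmk, ae_reg hs hξ h] with x h1 h2 h3
  refine ⟨h1, fun i hi => ?_, h3⟩
  have := h2 i
  rw [h1] at this
  simpa [shN] using this (by simpa [shN] using hi)

theorem Vld.sub {S : Skel} {f : ℕ → A} (h : Vld a S f) (τ : ℕ → ℕ) {u v : ℕ} (hv : v ≤ S.len) :
    Vld a (S.sub τ u v) fun k => f (u + k) := by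
  intro k hk
  have hk' : k < v - u := hk
  rw [sub_stx _ _ _ _ _ hk']
  exact h _ (by omega)

/-- The point is the refinement of codes across two levels: a piece of a piece of `S` is a skeleton
inside `S`, so equivalent fillers of `S` restrict to equivalent ones there. Positivity of the marked
state comes from irreducibility. -/
theorem side_of_sof (hX : IsMarkedProcess μ a) (hξ : IsMarkerFactor (μ.map (hat a)) ξ)
    (h : IsNice μ a ξ L) (𝒜 : SOF μ a ξ τ) (N : ℕ) {R : ℕ → ℕ} (hR : Monotone R)
    (hR1 : ∀ j, 1 ≤ R j) : Side (μ.map (hat a)) ξ τ R μ a (code 𝒜.rel N) where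
  meas := hξ.measurable
  law := rfl
  stat := hX.markov.stationary
  renewal := hX.renewal
  apos := by
    obtain ⟨n, hn⟩ := hX.markov.irreducible a a
    exact fun h0 => hn.ne' (measure_mono_null (fun x hx => hx.1) h0)
  gen := ae_gen hX.markov.stationary hξ h
  mono := hR
  one_le := hR1
  depN S := code_depN S
  refine j S hS f g hf hg hc z hz := by
    cases j with
    | zero => rfl
    | succ i =>
      obtain ⟨α, hα⟩ := hS
      rw [Measure.map_apply (measurable_hat a) (measurableSet_at hξ.measurable _)] at hα
      obtain ⟨x, hx, href⟩ : ∃ x, At ξ τ (R (i + 1 + 1)) (α, S) (hat a x) ∧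
          RefinesAt 𝒜.rel ξ τ (hat a x) := by
        by_contra! hcon
        refine hα (measure_mono_null_ae ?_ measure_empty)
        filter_upwards [ae_of_ae_map (measurable_hat a).aemeasurable 𝒜.refines] with x h1 h2
        exact hcon x h2 h1
      obtain ⟨h1, h2⟩ := hx
      dsimp only at h1 h2
      have hzm := (pcs_chn (R (i + 1)) S).mem z hz
      refine List.map_congr_left fun z' hz' => ?_
      have hz'' : z' ∈ pcs (R i) (S.sub τ z.1 z.2) := hz'
      have hzm' := (pcs_chn (R i) (S.sub τ z.1 z.2)).mem z' hz''
      have hl : (S.sub τ z.1 z.2).len = z.2 - z.1 := rfl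
      rw [hl] at hzm'
      -- A piece shorter than `N` has only one code. Otherwise `S` is also at least `N` long, and
      -- equal codes on `S` mean equivalent fillers.
      refine code_eq_of_rl ((hf.sub τ hzm.2.2).sub τ hzm'.2.2) ((hg.sub τ hzm.2.2).sub τ hzm'.2.2)
        fun hN => ?_
      have hN' : N ≤ z'.2 - z'.1 := hN
      have hrl := rl_of_code_eq hf hg (by omega) hc
      obtain ⟨k1, -, k3⟩ := h1.piece (hR (Nat.le_succ (i + 1))) τ (hat a x) z (by rw [h2]; exact hz)
      rw [h2] at k3
      obtain ⟨l1, -, l3⟩ := k1.piece (hR (Nat.le_succ i)) τ (hat a x) z' (by rw [← k3]; exact hz'')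
      rw [← h2] at hrl
      have hr := href.rl rfl (u := z.1 + z'.1) (v := z.1 + z'.2) (h1.isSkeleton (hR1 _))
        (by
          have := l1.isSkeleton (hR1 i)
          convert this using 1 <;> push_cast <;> ring) (by omega) hrl
      rw [skelOn_sub _ _ _ _ _ _ _ (by omega) (by omega)] at hr
      rw [k3, l3]
      convert hr using 1
      · congr 1 <;> push_cast <;> ring
      · funext k; rw [add_assoc]
      · funext k; rw [add_assoc]

end
end
end KSCoding

open MeasureTheory Filter Asymptotics
open scoped ENNReal
namespace KSCoding
noncomputable section

set_option linter.unusedSectionVars false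

/-! ### Classes and codes -/

section
variable {A : Type*} [Fintype A] [DecidableEq A] [MeasurableSpace A] [MeasurableSingletonClass A]
variable {μ : Measure (ℤ → A)} [IsProbabilityMeasure μ] {a : A}
  {ξ : (ℤ → Bool) → ℤ → ℕ} {τ : ℕ → ℕ} {L : ℕ → ℝ} {r : ℕ} {s : ℤ × Skel}
  {rel : (S : Skel) → Setoid (Filler a S)} {x y : ℤ → A}

theorem At.vld_wd (h : At ξ τ r s (hat a x)) : Vld a s.2 (wd x s.1) := h.vld

theorem At.classAt_eq (h : At ξ τ r s (hat a x)) (h0 : Cov s 0) :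
    classAt a ξ τ rel r x = (s.1, ⟨s.2, Quotient.mk (rel s.2) (toFil h.vld_wd)⟩) := by
  obtain ⟨α, S⟩ := s
  have e := h.pos_eq h0.1 h0.2
  simp only [pos, Prod.mk.injEq] at e
  obtain ⟨rfl, rfl⟩ := e
  rfl

theorem At.classAt_eq_iff (h : At ξ τ r s (hat a x)) (h' : At ξ τ r s (hat a y))
    (h0 : Cov s 0) :
    classAt a ξ τ rel r x = classAt a ξ τ rel r y ↔ Rl rel s.2 (wd x s.1) (wd y s.1) := by
  rw [h.classAt_eq h0, h'.classAt_eq h0]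
  simp only [Prod.mk.injEq, true_and, Sigma.mk.injEq, heq_eq_eq]
  rw [Quotient.eq]
  exact ⟨fun h1 => ⟨_, _, h1⟩, fun ⟨_, _, h1⟩ => h1⟩

theorem At.of_classAt_eq (h : At ξ τ r s (hat a x)) (hy : Gen ξ (hat a y))
    (h0 : Cov s 0) (he : classAt a ξ τ rel r y = classAt a ξ τ rel r x) :
    At ξ τ r s (hat a y) := by
  obtain ⟨h1, h2, h3⟩ := hy.at_pos τ r
  have e : pos ξ τ r (hat a y) = s := by
    rw [h1.classAt_eq ⟨h2, h3⟩, h.classAt_eq h0] at he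
    simp only [Prod.mk.injEq, Sigma.mk.injEq] at he
    exact Prod.ext he.1 he.2.1
  rw [← e]; exact h1

theorem At.code_eq_of_classAt_eq (h : At ξ τ r s (hat a x)) (h' : At ξ τ r s (hat a y))
    (h0 : Cov s 0) (he : classAt a ξ τ rel r y = classAt a ξ τ rel r x) (N : ℕ) :
    code rel N s.2 (wd y s.1) = code rel N s.2 (wd x s.1) :=
  code_eq_of_rl h'.vld_wd h.vld_wd fun _ => (h'.classAt_eq_iff h h0).1 he

theorem At.classAt_eq_of_code_eq (h : At ξ τ r s (hat a x)) (h' : At ξ τ r s (hat a y))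
    (h0 : Cov s 0) {N : ℕ} (hN : N ≤ s.2.len)
    (he : code rel N s.2 (wd y s.1) = code rel N s.2 (wd x s.1)) :
    classAt a ξ τ rel r y = classAt a ξ τ rel r x :=
  (h'.classAt_eq_iff h h0).2 (rl_of_code_eq h'.vld_wd h.vld_wd hN he)

/-! ### Mass transport -/

theorem measurableSet_detP (hξ : Measurable ξ) {cd : Skel → (ℕ → A) → ℕ}
    (hcd : ∀ S, DepN (cd S) S.len) (R : ℕ → ℕ) (j : ℕ) (n : ℤ) :
    MeasurableSet {y | DetP ξ τ R μ a cd j n y} := by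
  have := countable_skel
  have e : {y | DetP ξ τ R μ a cd j n y} = ⋃ (s : ℤ × Skel) (c : A) (k : ℕ),
      ({y | At ξ τ (R j) s (hat a y)} ∩ ({y | cd s.2 (wd y s.1) = k} ∩ {_y | Cov s n ∧
        ∀ᵐ y' ∂μ, At ξ τ (R j) s (hat a y') → cd s.2 (wd y' s.1) = k → y' n = c})) := by
    ext y
    simp only [DetP, Set.mem_ofPred_eq, Set.mem_iUnion, Set.mem_inter_iff]
    constructor
    · rintro ⟨s, h1, h2, c, h3⟩
      exact ⟨s, c, _, h1, rfl, h2, h3⟩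
    · rintro ⟨s, c, k, h1, rfl, h2, h3⟩
      exact ⟨s, h1, h2, c, h3⟩
  rw [e]
  refine MeasurableSet.iUnion fun s => MeasurableSet.iUnion fun c => MeasurableSet.iUnion fun k =>
    ((measurableSet_at hξ s).preimage (measurable_hat a)).inter
      (MeasurableSet.inter ?_ (MeasurableSet.const _))
  exact measurableSet_wd s.2.len (fun f => cd s.2 f = k)
    (fun f g h => by simp only [hcd _ f g h]) a s.1

/-- The average over a skeleton of the frequency of a stationary event is at most the probability
of the event. -/
theorem mass_transport (hs : MeasurePreserving shift μ μ) (hξ : Measurable ξ)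
    (hg : ∀ᵐ x ∂μ, Gen ξ (hat a x)) (τ : ℕ → ℕ) (r : ℕ) (T : Set (ℤ → A)) (hT : MeasurableSet T)
    (f : (ℤ → A) → ℝ≥0∞)
    (hf : ∀ x, Gen ξ (hat a x) → ∀ (S : Skel) (u : ℕ), u < S.len →
      At ξ τ r (-(u : ℤ), S) (hat a x) → f x ≤ ∑ v ∈ Finset.range S.len,
        (shN ((v : ℤ) - u) ⁻¹' T).indicator 1 x * (S.len : ℝ≥0∞)⁻¹) :
    ∫⁻ x, f x ∂μ ≤ μ T := by
  have hcount := countable_skel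
  have hGA : ∀ s : ℤ × Skel, MeasurableSet {x | Gen ξ (hat a x) ∧ At ξ τ r s (hat a x)} :=
    fun s => ((measurableSet_gen hξ).preimage (measurable_hat a)).inter
      ((measurableSet_at hξ s).preimage (measurable_hat a))
  have hTs : ∀ n : ℤ, MeasurableSet (shN n ⁻¹' T) := fun n => hT.preimage (measurable_shN n)
  set E : Skel → ℕ → ℕ → Set (ℤ → A) := fun S u v =>
    {x | Gen ξ (hat a x) ∧ At ξ τ r (-(u : ℤ), S) (hat a x)} ∩ shN ((v : ℤ) - u) ⁻¹' T with hE
  set m : Skel → ℕ → ℝ≥0∞ := fun S v => μ (E S v v) with hm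
  have hEm : ∀ S u v, MeasurableSet (E S u v) := fun S u v => (hGA _).inter (hTs _)
  -- Here `0` is the coordinate `u` of the skeleton and `T` happens at its coordinate `v`. A
  -- translation moves the origin inside the skeleton, so the measure does not depend on `u`;
  -- summing over `u` then cancels the factor `1/|S|`.
  have hEmeas : ∀ S u v, μ (E S u v) = m S v := by
    intro S u v
    change _ = μ (E S v v)
    rw [← measure_shN hs ((v : ℤ) - u) (E S v v)]
    refine measure_congr ?_
    filter_upwards [hg] with x hx
    refine propext ⟨?_, ?_⟩
    · rintro ⟨⟨h1, h2⟩, h3⟩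
      refine ⟨⟨h1.shN _, ?_⟩, ?_⟩
      · rw [hat_shN, h1.at_shN]; convert h2 using 2; ring
      · simpa [shN_zero] using h3
    · rintro ⟨⟨h1, h2⟩, h3⟩
      rw [hat_shN, hx.at_shN] at h2
      refine ⟨⟨hx, ?_⟩, ?_⟩
      · convert h2 using 2; ring
      · simpa [shN_zero] using h3
  have hle : ∫⁻ x, f x ∂μ ≤ ∫⁻ x, ∑' S : Skel, ∑ u ∈ Finset.range S.len,
      ∑ v ∈ Finset.range S.len, (E S u v).indicator 1 x * (S.len : ℝ≥0∞)⁻¹ ∂μ := by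
    refine lintegral_mono_ae ?_
    filter_upwards [hg] with x hx
    obtain ⟨⟨α, S⟩, h1, h2⟩ := hx.exists_at τ r 0
    obtain ⟨u, rfl⟩ : ∃ u : ℕ, α = -u := ⟨(-α).toNat, by have := h2.1; dsimp only at this; omega⟩
    have hu : u < S.len := by have := h2.2; dsimp only at this; omega
    refine (hf x hx S u hu h1).trans (le_trans ?_ (ENNReal.le_tsum S))
    refine le_trans (le_of_eq ?_) (Finset.single_le_sum (f := fun u => ∑ v ∈ Finset.range S.len,
      (E S u v).indicator 1 x * (S.len : ℝ≥0∞)⁻¹) (fun _ _ => zero_le)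
      (Finset.mem_range.2 hu))
    refine Finset.sum_congr rfl fun v _ => ?_
    congr 1
    by_cases hx3 : x ∈ shN ((v : ℤ) - u) ⁻¹' T
    · rw [Set.indicator_of_mem hx3, Set.indicator_of_mem (show x ∈ E S u v from ⟨⟨hx, h1⟩, hx3⟩)]
    · rw [Set.indicator_of_notMem hx3, Set.indicator_of_notMem fun h => hx3 h.2]
  refine hle.trans ?_
  have hmeas : ∀ S u v, Measurable fun x => (E S u v).indicator (1 : (ℤ → A) → ℝ≥0∞) x *
      (S.len : ℝ≥0∞)⁻¹ := fun S u v =>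
    (measurable_one.indicator (hEm S u v)).mul_const _
  rw [lintegral_tsum fun S => (Finset.measurable_fun_sum _ fun u _ =>
    Finset.measurable_fun_sum _ fun v _ => hmeas S u v).aemeasurable]
  have hterm : ∀ S : Skel, ∫⁻ x, ∑ u ∈ Finset.range S.len, ∑ v ∈ Finset.range S.len,
      (E S u v).indicator 1 x * (S.len : ℝ≥0∞)⁻¹ ∂μ = ∑ v ∈ Finset.range S.len, m S v := by
    intro S
    rw [lintegral_finsetSum _ fun u _ => Finset.measurable_fun_sum _ fun v _ => hmeas S u v]
    have h1 : ∀ u, ∫⁻ x, ∑ v ∈ Finset.range S.len,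
        (E S u v).indicator 1 x * (S.len : ℝ≥0∞)⁻¹ ∂μ =
        (∑ v ∈ Finset.range S.len, m S v) * (S.len : ℝ≥0∞)⁻¹ := by
      intro u
      rw [lintegral_finsetSum _ fun v _ => hmeas S u v, Finset.sum_mul]
      refine Finset.sum_congr rfl fun v _ => ?_
      rw [lintegral_mul_const _ (measurable_one.indicator (hEm S u v)),
        lintegral_indicator_one (hEm S u v), hEmeas]
    simp only [h1, Finset.sum_const, Finset.card_range, nsmul_eq_mul]
    rcases Nat.eq_zero_or_pos S.len with h0 | h0
    · simp [h0]
    · rw [mul_comm, mul_assoc, ENNReal.inv_mul_cancel (by exact_mod_cast h0.ne')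
        (ENNReal.natCast_ne_top _), mul_one]
  simp only [hterm]
  have hfin : ∀ S : Skel, ∑ v ∈ Finset.range S.len, m S v =
      μ (⋃ v ∈ Finset.range S.len, E S v v) := by
    intro S
    rw [measure_biUnion_finset]
    · intro v hv v' hv' hne
      rw [Function.onFun, Set.disjoint_left]
      rintro x ⟨⟨h1, h2⟩, -⟩ ⟨⟨-, h3⟩, -⟩
      simp only [Finset.coe_range, Set.mem_Iio] at hv hv'
      have := h1.at_unique h2 (n := 0) ⟨by dsimp only; omega, by dsimp only; omega⟩ h3
        ⟨by dsimp only; omega, by dsimp only; omega⟩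
      simp only [Prod.mk.injEq, neg_inj, Nat.cast_inj, and_true] at this
      exact hne this
    · exact fun v _ => hEm S v v
  simp only [hfin]
  rw [← measure_iUnion]
  · refine measure_mono (Set.iUnion_subset fun S => Set.iUnion₂_subset fun v _ => ?_)
    rintro x ⟨-, hx⟩
    simpa [shN_zero] using hx
  · intro S S' hne
    rw [Function.onFun, Set.disjoint_left]
    intro x hx hx'
    obtain ⟨v, hv, ⟨h1, h2⟩, -⟩ := Set.mem_iUnion₂.1 hx
    obtain ⟨v', hv', ⟨-, h3⟩, -⟩ := Set.mem_iUnion₂.1 hx'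
    rw [Finset.mem_range] at hv hv'
    have := h1.at_unique h2 (n := 0) ⟨by dsimp only; omega, by dsimp only; omega⟩ h3
      ⟨by dsimp only; omega, by dsimp only; omega⟩
    exact hne (congrArg Prod.snd this)
  · exact fun S => Finset.measurableSet_biUnion _ fun v _ => hEm S v v

/-- The class of the covering skeleton determines the symbol at `0`, up to small probability. -/
theorem detP_of_determines (hs : MeasurePreserving shift μ μ)
    (hg : ∀ᵐ x ∂μ, Gen ξ (hat a x)) {x : ℤ → A} (hx : Gen ξ (hat a x))
    (h1 : At ξ τ r s (hat a x)) (h0 : Cov s 0) {i : ℤ} (hi : Cov s i)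
    (hd : Determines μ (classAt a ξ τ rel r) (fun x' => x' i) x) :
    DetP ξ τ id μ a (code rel 0) r 0 (shN i x) := by
  have e : ∀ (y : ℤ → A) (n : ℤ), wd y (s.1 + n) = wd (shN n y) s.1 := by
    intro y n; funext k; simp only [wd, shN]; congr 1; ring
  refine ⟨(s.1 - i, s.2), ?_, ?_, x i, ?_⟩
  · rw [hat_shN, hx.at_shN]; simpa using h1
  · refine ⟨?_, ?_⟩
    · have := hi.1; dsimp only; omega
    · have := hi.2; dsimp only; omega
  · filter_upwards [ae_shN hs hd, hg] with y hy hgy h2 h3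
    have h4 : At ξ τ r s (hat a (shN (-i) y)) := by
      rw [hat_shN, hgy.at_shN]; simpa [sub_eq_add_neg] using h2
    have h5 := hy (-i) (h1.classAt_eq_of_code_eq h4 h0 (N := 0) (Nat.zero_le _) (by
      rw [← e, ← sub_eq_add_neg, h3, sub_eq_add_neg, e, shN_shN]
      simp [shN_zero]))
    simpa [shN] using h5

-- A system of fillers controls the fraction of determined coordinates of the covering skeleton.
-- Mass transport turns this average into the probability that the origin is determined.
open Classical in
theorem tendsto_detP (hs : MeasurePreserving shift μ μ) (hξ : Measurable ξ)
    (hg : ∀ᵐ x ∂μ, Gen ξ (hat a x)) (𝒜 : SOF μ a ξ τ) :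
    Tendsto (fun r => μ {x | DetP ξ τ id μ a (code 𝒜.rel 0) r 0 x}) atTop (nhds 1) := by
  have hlim := ENNReal.tendsto_ofReal 𝒜.determines
  rw [ENNReal.ofReal_one] at hlim
  refine tendsto_of_tendsto_of_tendsto_of_le_of_le hlim tendsto_const_nhds (fun r => ?_)
    (fun r => prob_le_one)
  dsimp only
  set f : (ℤ → A) → ℝ := fun x =>
    ((((Finset.Ico (leftEnd (ξ (hat a x)) r) (rightEnd (ξ (hat a x)) r)).filter fun i =>
      Determines μ (classAt a ξ τ 𝒜.rel r) (fun x' => x' i) x).card : ℝ) /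
        ((rightEnd (ξ (hat a x)) r - leftEnd (ξ (hat a x)) r : ℤ) : ℝ)) with hf
  -- If the integrand is not integrable, the integral is `0` by convention and the bound is trivial.
  by_cases hint : Integrable f μ
  swap
  · rw [integral_undef hint]; simp
  have hnn : ∀ᵐ x ∂μ, 0 ≤ f x := by
    filter_upwards [hg] with x hx
    have := (hx.reg.sk r).1.1
    refine div_nonneg (Nat.cast_nonneg _) ?_
    exact_mod_cast (by omega : 0 ≤ rightEnd (ξ (hat a x)) r - leftEnd (ξ (hat a x)) r)
  rw [ofReal_integral_eq_lintegral_ofReal hint hnn]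
  refine mass_transport hs hξ hg τ r _ (measurableSet_detP hξ (fun S => code_depN S) id r 0) _ ?_
  intro x hx S u hu hAt
  have hcov : Cov (-(u : ℤ), S) 0 := ⟨by dsimp only; omega, by dsimp only; omega⟩
  obtain ⟨e1, e2⟩ := hAt.1.ends hcov.1 hcov.2
  dsimp only at e1 e2
  have hlen : ((rightEnd (ξ (hat a x)) r - leftEnd (ξ (hat a x)) r : ℤ) : ℝ) = S.len := by
    rw [e1, e2]; push_cast; ring
  rw [← Finset.sum_mul, hf]
  dsimp only
  rw [hlen, ENNReal.ofReal_div_of_pos (by exact_mod_cast (by omega : 0 < S.len)),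
    ENNReal.ofReal_natCast, ENNReal.ofReal_natCast, ENNReal.div_eq_inv_mul, mul_comm]
  refine mul_le_mul_left ?_ _
  rw [e1, e2, Finset.card_filter]
  push_cast
  have hbij : ∑ v ∈ Finset.range S.len, (if Determines μ (classAt a ξ τ 𝒜.rel r)
      (fun x' => x' ((v : ℤ) - u)) x then (1 : ℝ≥0∞) else 0) =
      ∑ i ∈ Finset.Ico (-(u : ℤ)) (-(u : ℤ) + S.len),
        (if Determines μ (classAt a ξ τ 𝒜.rel r) (fun x' => x' i) x then (1 : ℝ≥0∞) else 0) := by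
    refine Finset.sum_nbij (fun v => (v : ℤ) - u) ?_ ?_ ?_ ?_
    · intro v hv
      rw [Finset.mem_range] at hv
      rw [Finset.mem_Ico]; omega
    · intro v _ v' _ h
      dsimp only at h
      omega
    · intro i hi
      rw [Finset.mem_coe, Finset.mem_Ico] at hi
      refine ⟨(i + u).toNat, ?_, ?_⟩
      · rw [Finset.mem_coe, Finset.mem_range]; omega
      · dsimp only; omega
    · intro v _; rfl
  rw [← hbij]
  refine Finset.sum_le_sum fun v hv => ?_
  rw [Finset.mem_range] at hv
  split_ifs with hd
  · have := detP_of_determines (s := (-(u : ℤ), S)) hs hg hx hAt hcov (i := (v : ℤ) - u)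
      ⟨by dsimp only; omega, by dsimp only; omega⟩ hd
    rw [Set.indicator_of_mem (show x ∈ shN ((v : ℤ) - u) ⁻¹'
      {x | DetP ξ τ id μ a (code 𝒜.rel 0) r 0 x} from this)]
    rfl
  · exact zero_le

/-- Codes with threshold `N` carry the full class once the skeleton has length at least `N`. This
holds as soon as it covers `[-N, N]`, that is, with probability close to one. -/
theorem Side.detP_le {ρ : Measure (ℤ → Bool)} {R : ℕ → ℕ} (𝒜 : SOF μ a ξ τ) {N : ℕ}
    (h : Side ρ ξ τ R μ a (code 𝒜.rel N)) (hR : Tendsto R atTop atTop) (ε : ℝ≥0∞) (hε : ε ≠ 0) :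
    ∃ J, ∀ j ≥ J, μ {x | ¬ DetP ξ τ R μ a (code 𝒜.rel N) j 0 x} ≤ ε := by
  have hε2 : ε / 2 ≠ 0 := by simpa using hε
  obtain ⟨J1, hJ1⟩ := h.uncovered hR N _ hε2
  have hlim := (tendsto_detP h.stat h.meas h.gen 𝒜).comp hR
  have hlim2 := ENNReal.Tendsto.sub (tendsto_const_nhds (x := (1 : ℝ≥0∞))) hlim
    (Or.inl ENNReal.one_ne_top)
  rw [tsub_self] at hlim2
  obtain ⟨J2, hJ2⟩ := (hlim2.eventually_le_const (pos_iff_ne_zero.2 hε2)).exists_forall_of_atTop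
  refine ⟨max J1 J2, fun j hj => ?_⟩
  have h2 := hJ2 j ((le_max_right _ _).trans hj)
  rw [Function.comp_apply, ← prob_compl_eq_one_sub
    (measurableSet_detP h.meas (fun S => code_depN S) id (R j) 0)] at h2
  refine le_trans (measure_mono_ae ?_) ((measure_union_le _ _).trans
    ((add_le_add (hJ1 j ((le_max_left _ _).trans hj)) h2).trans (ENNReal.add_halves ε).le))
  filter_upwards [h.gen] with x hx hbad
  by_contra hcon
  refine hbad ?_
  have hdet : DetP ξ τ id μ a (code 𝒜.rel 0) (R j) 0 x := by
    by_contra hc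
    exact hcon (Or.inr hc)
  obtain ⟨s, h1, h3, c, h4⟩ := hdet
  refine ⟨s, h1, h3, c, ?_⟩
  have hlen : N ≤ s.2.len := by
    by_contra hl
    refine hcon (Or.inl ⟨s, h1, h3, fun hcov => ?_⟩)
    have k1 := hcov (-(N : ℤ)) ⟨le_rfl, by omega⟩
    have k2 := hcov N ⟨by omega, le_rfl⟩
    have k3 := k1.1
    have k4 := k2.2
    omega
  filter_upwards [h4] with y hy hy2 hy3
  have h1' : At ξ τ (R j) s (hat a x) := h1
  exact hy hy2 (h1'.code_eq_of_classAt_eq hy2 h3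
    (h1'.classAt_eq_of_code_eq hy2 h3 hlen hy3) 0)

end
end
end KSCoding

open MeasureTheory Filter Asymptotics
open scoped ENNReal
namespace KSCoding
noncomputable section

set_option linter.unusedSectionVars false

/-! ### A superadditive gauge -/

/-- The gauge `ε √s / log(s + 3) ^ k`. -/
def gau (ε : ℝ) (k : ℕ) (s : ℕ) : ℝ := ε * √s / Real.log (s + 3) ^ k

theorem one_le_log_add_three (s : ℝ) (hs : 0 ≤ s) : 1 ≤ Real.log (s + 3) := by
  rw [Real.le_log_iff_exp_le (by linarith)]
  linarith [Real.exp_one_lt_d9]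

theorem gau_pos {ε : ℝ} (hε : 0 < ε) (k : ℕ) {s : ℕ} (hs : 1 ≤ s) : 0 < gau ε k s := by
  have := one_le_log_add_three s (Nat.cast_nonneg s)
  have h2 : (0 : ℝ) < s := by exact_mod_cast hs
  unfold gau
  positivity

theorem gau_le {ε : ℝ} (hε : 0 ≤ ε) (k s : ℕ) : gau ε k s ≤ ε * s := by
  have h1 := one_le_log_add_three s (Nat.cast_nonneg s)
  have h2 : (1 : ℝ) ≤ Real.log (s + 3) ^ k := one_le_pow₀ h1
  have h3 : √(s : ℝ) ≤ s := by
    rcases Nat.eq_zero_or_pos s with rfl | hs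
    · simp
    · rw [Real.sqrt_le_left (by positivity)]
      have : (1 : ℝ) ≤ s := by exact_mod_cast hs
      nlinarith
  refine (div_le_self (by positivity) h2).trans (mul_le_mul_of_nonneg_left h3 hε)

/-- The ratio `gau s / s` decreases in `s`, so each piece of length at most `l` contributes per
coordinate at least the rate at `l`. -/
theorem gau_scale {ε : ℝ} (hε : 0 ≤ ε) (k : ℕ) {s : ℕ} (hs : 1 ≤ s) {l : ℝ} (hl : (s : ℝ) ≤ l) :
    s * (ε / (√l * Real.log (l + 3) ^ k)) ≤ gau ε k s := by
  have h0 : (0 : ℝ) < s := by exact_mod_cast hs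
  have h1 := one_le_log_add_three s (Nat.cast_nonneg s)
  have h2 : Real.log (s + 3) ≤ Real.log (l + 3) := Real.log_le_log (by linarith) (by linarith)
  have h3 : √(s : ℝ) ≤ √l := Real.sqrt_le_sqrt hl
  have h4 : 0 < √(s : ℝ) := Real.sqrt_pos.2 h0
  have h5 : (s : ℝ) * (ε / (√s * Real.log (s + 3) ^ k)) = gau ε k s := by
    have : (s : ℝ) = √s * √s := (Real.mul_self_sqrt h0.le).symm
    unfold gau
    field_simp
    nlinarith [Real.sq_sqrt h0.le]
  rw [← h5]
  gcongr

/-- For `y ≤ x` one has `√(x + y) ≤ √x + √y / 2`, and the larger logarithm of the sum only helps. -/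
theorem gau_add {ε : ℝ} (hε : 0 ≤ ε) (k : ℕ) {x y : ℕ} (hy : 1 ≤ y) (hxy : y ≤ x) :
    gau ε k (x + y) + gau ε k y / 2 ≤ gau ε k x + gau ε k y := by
  have hy0 : (0 : ℝ) < y := by exact_mod_cast hy
  have hxy' : (y : ℝ) ≤ x := by exact_mod_cast hxy
  have h1x := one_le_log_add_three x (Nat.cast_nonneg x)
  have h1y := one_le_log_add_three y (Nat.cast_nonneg y)
  have hl : ∀ z : ℕ, (z : ℝ) ≤ x + y → 1 ≤ Real.log ((z : ℝ) + 3) →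
      Real.log ((z : ℝ) + 3) ≤ Real.log (((x + y : ℕ) : ℝ) + 3) := fun z hz _ =>
    Real.log_le_log (by positivity) (by push_cast; linarith)
  set P := Real.log (((x + y : ℕ) : ℝ) + 3) ^ k with hP
  have hPx : Real.log ((x : ℝ) + 3) ^ k ≤ P :=
    pow_le_pow_left₀ (by linarith) (hl x (by linarith) h1x) k
  have hPy : Real.log ((y : ℝ) + 3) ^ k ≤ P :=
    pow_le_pow_left₀ (by linarith) (hl y (by linarith) h1y) k
  have hpx : (0 : ℝ) < Real.log ((x : ℝ) + 3) ^ k := by positivity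
  have hpy : (0 : ℝ) < Real.log ((y : ℝ) + 3) ^ k := by positivity
  have hP0 : 0 ≤ P := hpx.le.trans hPx
  have hsq : √((x + y : ℕ) : ℝ) ≤ √x + √y / 2 := by
    rw [Real.sqrt_le_left (by positivity)]
    have e1 := Real.sq_sqrt (show (0 : ℝ) ≤ x by positivity)
    have e2 := Real.sq_sqrt hy0.le
    have e3 : √(y : ℝ) ≤ √x := Real.sqrt_le_sqrt hxy'
    push_cast
    nlinarith [Real.sqrt_nonneg (y : ℝ)]
  have a1 : ε * √x / P ≤ gau ε k x := by unfold gau; gcongr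
  have a2 : ε * √y / P ≤ gau ε k y := by unfold gau; gcongr
  have a3 : gau ε k (x + y) ≤ ε * √x / P + ε * √y / P / 2 := by
    unfold gau
    rw [← hP]
    calc ε * √((x + y : ℕ) : ℝ) / P ≤ ε * (√x + √y / 2) / P := by
          gcongr
      _ = _ := by ring
  linarith

theorem tendsto_gau {ε : ℝ} (hε : 0 < ε) (k : ℕ) : Tendsto (gau ε k) atTop atTop := by
  have h1 : (fun x : ℝ => Real.log x ^ (k : ℝ)) =o[atTop] fun x => x ^ (1 / 2 : ℝ) :=
    isLittleO_log_rpow_rpow_atTop _ (by norm_num)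
  have h2 : Tendsto (fun s : ℕ => (s : ℝ) + 3) atTop atTop :=
    tendsto_atTop_add_const_right _ _ tendsto_natCast_atTop_atTop
  have h3 := (h1.comp_tendsto h2).tendsto_div_nhds_zero
  have h4 : Tendsto (fun s : ℕ => Real.log ((s : ℝ) + 3) ^ k / √((s : ℝ) + 3)) atTop
      (nhdsWithin 0 (Set.Ioi 0)) := by
    rw [tendsto_nhdsWithin_iff]
    refine ⟨?_, Eventually.of_forall fun s => ?_⟩
    · refine h3.congr fun s => ?_
      simp only [Function.comp_apply, Real.rpow_natCast, Real.sqrt_eq_rpow]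
    · have := one_le_log_add_three s (Nat.cast_nonneg s)
      rw [Set.mem_Ioi]
      positivity
  have h5 := (tendsto_inv_nhdsGT_zero.comp h4).const_mul_atTop (show 0 < ε / 2 by positivity)
  refine tendsto_atTop_mono' _ ?_ h5
  filter_upwards [eventually_ge_atTop 1] with s hs
  have := one_le_log_add_three s (Nat.cast_nonneg s)
  have hs' : (1 : ℝ) ≤ s := by exact_mod_cast hs
  simp only [Function.comp_apply, inv_div, gau]
  have h6 : √((s : ℝ) + 3) ≤ 2 * √s := by
    rw [Real.sqrt_le_left (by positivity), mul_pow, Real.sq_sqrt (by linarith)]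
    linarith
  rw [← mul_div_assoc]
  refine div_le_div_of_nonneg_right ?_ (by positivity)
  nlinarith

/-- The gauge is positive and tends to infinity, hence is bounded below on positive integers; half
of that bound is the gap. -/
theorem exists_gau_gap {ε : ℝ} (hε : 0 < ε) (k : ℕ) : ∃ c : ℝ, 0 < c ∧
    ∀ x y : ℕ, 1 ≤ x → 1 ≤ y → gau ε k (x + y) + c ≤ gau ε k x + gau ε k y := by
  have hinf : ∃ c : ℝ, 0 < c ∧ ∀ s : ℕ, 1 ≤ s → c ≤ gau ε k s := by
    obtain ⟨n, hn⟩ := ((tendsto_gau hε k).eventually_ge_atTop 1).exists_forall_of_atTop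
    obtain ⟨s0, hs0, hmin⟩ := (Finset.Icc 1 (n + 1)).exists_min_image (gau ε k)
      ⟨1, Finset.mem_Icc.2 ⟨le_rfl, by omega⟩⟩
    refine ⟨min 1 (gau ε k s0), lt_min one_pos (gau_pos hε k (Finset.mem_Icc.1 hs0).1),
      fun s hs => ?_⟩
    by_cases h : n ≤ s
    · exact (min_le_left _ _).trans (hn s h)
    · exact (min_le_right _ _).trans (hmin s (Finset.mem_Icc.2 ⟨hs, by omega⟩))
  obtain ⟨c, hc, h⟩ := hinf
  refine ⟨c / 2, by positivity, fun x y hx hy => ?_⟩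
  rcases le_total y x with hxy | hxy
  · have := gau_add hε.le k hy hxy
    linarith [h y hy]
  · have := gau_add hε.le k hx hxy
    rw [add_comm y x] at this
    linarith [h x hx]

/-- A single gap `c` is kept, however many the terms: it is all that is needed to absorb the classes
of the node in the count of atoms. -/
theorem gau_sum {g : ℕ → ℝ} {c : ℝ} (hc : 0 < c)
    (h : ∀ x y : ℕ, 1 ≤ x → 1 ≤ y → g (x + y) + c ≤ g x + g y) (l : List ℕ) :
    (∀ x ∈ l, 1 ≤ x) → l ≠ [] →
      g l.sum ≤ (l.map g).sum ∧ (2 ≤ l.length → g l.sum + c ≤ (l.map g).sum) := by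
  induction l with
  | nil => simp
  | cons x l ih =>
    intro hl _
    by_cases hl0 : l = []
    · subst hl0; simp
    · obtain ⟨h1, -⟩ := ih (fun y hy => hl y (List.mem_cons_of_mem _ hy)) hl0
      obtain ⟨y, l', rfl⟩ := List.exists_cons_of_ne_nil hl0
      have hy : 1 ≤ (y :: l').sum := by
        have := hl y (by simp)
        simp only [List.sum_cons]; omega
      have := h x _ (hl x (by simp)) hy
      simp only [List.sum_cons, List.map_cons] at h1 this ⊢
      exact ⟨by linarith, fun _ => by linarith⟩

theorem prod_le_exp_sum {γ : Type*} (l : List γ) (f g : γ → ℝ) (h0 : ∀ z ∈ l, 0 ≤ f z)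
    (h : ∀ z ∈ l, f z ≤ Real.exp (g z)) : (l.map f).prod ≤ Real.exp (l.map g).sum := by
  induction l with
  | nil => simp
  | cons z l ih =>
    rw [List.map_cons, List.map_cons, List.prod_cons, List.sum_cons, Real.exp_add]
    have h1 := ih (fun w hw => h0 w (List.mem_cons_of_mem _ hw))
      fun w hw => h w (List.mem_cons_of_mem _ hw)
    have h2 : 0 ≤ (l.map f).prod := List.prod_nonneg (by
      intro a ha
      obtain ⟨w, hw, rfl⟩ := List.mem_map.1 ha
      exact h0 w (List.mem_cons_of_mem _ hw))
    exact mul_le_mul (h z (by simp)) h1 h2 (Real.exp_pos _).le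

theorem sum_map_sub' {γ : Type*} (l : List γ) (f g : γ → ℝ) :
    (l.map fun z => f z - g z).sum = (l.map f).sum - (l.map g).sum := by
  induction l with
  | nil => simp
  | cons z l ih => simp only [List.map_cons, List.sum_cons, ih]; ring

theorem prod_le_one_nat (l : List ℕ) (h : ∀ n ∈ l, n ≤ 1) : l.prod ≤ 1 := by
  induction l with
  | nil => simp
  | cons n l ih =>
    rw [List.prod_cons]
    exact Nat.mul_le_mul (h n (by simp)) (ih fun m hm => h m (List.mem_cons_of_mem _ hm))

/-! ### Counting the symbols -/

theorem sub_self_eq (τ : ℕ → ℕ) (S : Skel) : S.sub τ 0 S.len = S := by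
  refine Skel.ext' rfl (fun k hk => ?_) (fun k hk => ?_)
  · rw [sub_stx _ _ _ _ _ hk, Nat.zero_add]
  · have hk' : k < (S.sub τ 0 S.len).len := hk
    rw [Skel.labx, dif_pos hk']
    simp [Skel.sub]

theorem pcs_eq_of_length (r : ℕ) (S : Skel) (h : (pcs r S).length = 1) :
    pcs r S = [(0, S.len)] := by
  obtain ⟨z, hz⟩ := List.length_eq_one_iff.1 h
  have hc := pcs_chn r S
  rw [hz] at hc ⊢
  generalize S.len = n at hc
  cases hc with
  | cons h1 h2 =>
    cases h2
    rfl

theorem len_sum_pcs (τ : ℕ → ℕ) (r : ℕ) (S : Skel) :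
    ((pcs r S).map fun z => (S.sub τ z.1 z.2).len).sum = S.len := by
  have h := (pcs_chn r S).sum
  have e : (((pcs r S).map fun z => (S.sub τ z.1 z.2).len).sum : ℝ) = S.len := by
    rw [Nat.cast_list_sum, List.map_map]
    exact h.trans (by simp)
  exact_mod_cast e

variable {A B : Type*} [Fintype A] [DecidableEq A] [MeasurableSpace A]
  [MeasurableSingletonClass A] [Fintype B] [DecidableEq B] [MeasurableSpace B]
  [MeasurableSingletonClass B] {ρ : Measure (ℤ → Bool)} {ξ : (ℤ → Bool) → ℤ → ℕ} {τ : ℕ → ℕ}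
  {R : ℕ → ℕ} {μ : Measure (ℤ → A)} [IsProbabilityMeasure μ] {a : A}
  {cd1 : Skel → (ℕ → A) → ℕ} {ν : Measure (ℤ → B)} [IsProbabilityMeasure ν] {b : B}
  {cd2 : Skel → (ℕ → B) → ℕ} {D : ChainData Skel} {p : ℕ → Prop}

/-- If the skeleton is not cut on two consecutive levels, the levels `j + 2` and `j` see the same
skeleton and the same process, so refining is the identity. The recoupling then adds no atoms. -/
theorem Link.rf_single_aux (H : Link ρ ξ τ R μ a cd1 ν b cd2 D p) {j : ℕ} (hj : p (j + 2))
    {S : Skel} (hS : Adm ρ ξ τ R (j + 2) S) (h1 : pcs (R (j + 1)) S = [(0, S.len)])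
    (h2 : pcs (R j) S = [(0, S.len)]) {c : ℕ} (hc : c ∈ (D.pi (j + 2) S).support) :
    D.rf (j + 2) S c = [[c]] := by
  rw [PMF.mem_support_iff, H.pix _ hj] at hc
  obtain ⟨w, -, hw, rfl⟩ := exists_vld_of_lawF_ne_zero (H.sx.HS_ne_zero hS) hc
  rw [H.rfx _ hj, H.sx.rfS_code hS hw, h1]
  simp only [List.map_cons, List.map_nil, lst, pcsL, sub_self_eq, h2, Nat.zero_add]

theorem Link.rf_single (H : Link ρ ξ τ R μ a cd1 ν b cd2 D p) {j : ℕ}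
    {S : Skel} (hS : Adm ρ ξ τ R (j + 2) S) (h1 : pcs (R (j + 1)) S = [(0, S.len)])
    (h2 : pcs (R j) S = [(0, S.len)]) {c : ℕ} (hc : c ∈ (D.pi (j + 2) S).support) :
    D.rf (j + 2) S c = [[c]] := by
  by_cases hj : p (j + 2)
  · exact H.rf_single_aux hj hS h1 h2 hc
  · exact H.symm.rf_single_aux hj hS h1 h2 hc

theorem fst_support_eq {T : Type*} {D : ChainData T} {Adm : ℕ → T → Prop} (hD : D.IsChain Adm)
    {j : ℕ} {t : T} (ht : Adm (j + 1) t) : ((D.K j t).map Prod.fst).support =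
      D.rf (j + 1) t '' (D.pi (j + 1) t).support := by
  obtain ⟨h1, h2, -⟩ := kap_isStep hD j t ht
  rw [← h2, PMF.map_comp, ← h1, PMF.support_map, PMF.support_map, Set.image_image]
  rfl

/-- The skeleton of level `j` has a single child. -/
def Sing (R : ℕ → ℕ) : ℕ → Skel → Prop
  | 0, _ => False
  | j + 1, S => (pcs (R j) S).length = 1

/-- Numerical hypotheses for the counting of the symbols. -/
structure Cnt (ρ : Measure (ℤ → Bool)) (ξ : (ℤ → Bool) → ℤ → ℕ) (τ : ℕ → ℕ) (R : ℕ → ℕ)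
    (D : ChainData Skel) (h : ℝ) (g : ℕ → ℝ) (c : ℝ) (N : ℕ) : Prop where
  cpos : 0 < c
  add : ∀ x y : ℕ, 1 ≤ x → 1 ≤ y → g (x + y) + c ≤ g x + g y
  -- The two copies of `exp(-g s)` pay for the classes of a node with several pieces and for those
  -- of one further level on which it is not cut.
  exp_le : ∀ s ≥ N, Real.exp (-c) + 2 * Real.exp (-g s) ≤ 1
  le : ∀ s, g s ≤ h * s
  big : ∀ j S, Adm ρ ξ τ R j S → N ≤ S.len →
    ((D.pi j S).support.ncard : ℝ) ≤ Real.exp (h * S.len - 2 * g S.len)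
  small : ∀ j S, Adm ρ ξ τ R j S → S.len < N → (D.pi j S).support.ncard ≤ 1

variable {h : ℝ} {g : ℕ → ℝ} {c : ℝ} {N : ℕ}

theorem Link.ncard_K_le (H : Link ρ ξ τ R μ a cd1 ν b cd2 D p) {j : ℕ} {S : Skel}
    (hS : Adm ρ ξ τ R (j + 1) S)
    (hch : ∀ z ∈ pcs (R j) S, ((D.kap j (S.sub τ z.1 z.2)).support.ncard : ℝ) ≤
      Real.exp (h * (S.sub τ z.1 z.2).len - g (S.sub τ z.1 z.2).len)) :
    ((D.K j S).support.ncard : ℝ) ≤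
      Real.exp (h * S.len - ((pcs (R j) S).map fun z => g (S.sub τ z.1 z.2).len).sum) := by
  have h1 := KSCoding.ncard_K_le H.isChain j S hS
  rw [H.ch] at h1
  have h2 : ((D.K j S).support.ncard : ℝ) ≤ ((pcs (R j) S).map fun z =>
      ((D.kap j (S.sub τ z.1 z.2)).support.ncard : ℝ)).prod := by
    have : ((D.K j S).support.ncard : ℝ) ≤ (((chS τ R (j + 1) S).map fun t' =>
      (D.kap j t').support.ncard).prod : ℕ) := by exact_mod_cast h1
    rw [Nat.cast_list_prod, chS, List.map_map, List.map_map] at this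
    exact this
  refine h2.trans ((prod_le_exp_sum _ _ _ (fun _ _ => Nat.cast_nonneg _) hch).trans
    (le_of_eq ?_))
  congr 1
  have h3 : (((pcs (R j) S).map fun z => (S.sub τ z.1 z.2).len).sum : ℝ) = S.len := by
    exact_mod_cast len_sum_pcs τ (R j) S
  rw [← h3, Nat.cast_list_sum, List.map_map, ← List.sum_map_mul_left, ← sum_map_sub']
  rfl

/-- The invariant is `exp(h|S| - g|S|)` atoms. With at least two pieces the product has at most
`exp(h|S| - g|S| - c)` atoms, and the at most `exp(h|S| - 2 g|S|)` classes of the node fit into the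
gap. A node with one piece gains no gap, which is why the sharper third clause is carried along: it
leaves room for one such level, and from the second one on the count no longer grows. -/
theorem Link.ncard_kap_aux (H : Link ρ ξ τ R μ a cd1 ν b cd2 D p)
    (C : Cnt ρ ξ τ R D h g c N) (j : ℕ) : ∀ S, Adm ρ ξ τ R j S →
      (S.len < N → (D.kap j S).support.ncard ≤ 1) ∧
      ((D.kap j S).support.ncard : ℝ) ≤ Real.exp (h * S.len - g S.len) ∧
      (N ≤ S.len → ¬ Sing R j S → ((D.kap j S).support.ncard : ℝ) ≤
        Real.exp (h * S.len - g S.len) * (Real.exp (-c) + Real.exp (-g S.len))) := by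
  have htwo : ∀ S : Skel, Real.exp (h * S.len - 2 * g S.len) =
      Real.exp (h * S.len - g S.len) * Real.exp (-g S.len) := fun S => by
    rw [← Real.exp_add]; congr 1; ring
  have hone : ∀ S : Skel, (1 : ℝ) ≤ Real.exp (h * S.len - g S.len) := fun S =>
    Real.one_le_exp (by linarith [C.le S.len])
  induction j with
  | zero =>
    intro S hS
    have e : (D.kap 0 S).support.ncard = (D.pi 0 S).support.ncard := by
      rw [ChainData.kap, PMF.support_map, Set.ncard_image_of_injective]
      intro x y hxy
      simpa using hxy
    rw [e]
    have h3 : N ≤ S.len → ((D.pi 0 S).support.ncard : ℝ) ≤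
        Real.exp (h * S.len - g S.len) * Real.exp (-g S.len) := fun hN => by
      rw [← htwo]; exact C.big 0 S hS hN
    refine ⟨C.small 0 S hS, ?_, fun hN _ => (h3 hN).trans ?_⟩
    · by_cases hN : N ≤ S.len
      · refine (h3 hN).trans (mul_le_of_le_one_right (Real.exp_pos _).le ?_)
        have := C.exp_le _ hN
        have := Real.exp_pos (-c)
        have := Real.exp_pos (-g S.len)
        linarith
      · refine le_trans ?_ (hone S)
        exact_mod_cast C.small 0 S hS (by omega)
    · gcongr
      linarith [Real.exp_pos (-c)]
  | succ j ih =>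
    intro S hS
    have hmk := H.sx.mk_of_adm hS
    obtain ⟨-, -, -, hstep⟩ := kap_isStep H.isChain j S hS
    have hpcs : pcs (R j) S ≠ [] := by
      intro h0
      have := pcs_chn (R j) S
      rw [h0] at this
      have hp := hmk.pos
      generalize S.len = n at this hp
      cases this
      omega
    have hchild : ∀ z ∈ pcs (R j) S, Adm ρ ξ τ R j (S.sub τ z.1 z.2) := fun z hz =>
      hS.sub H.sx.mono hz
    have hK := H.ncard_K_le (h := h) (g := g) hS fun z hz => (ih _ (hchild z hz)).2.1
    have hPfin : ((D.K j S).map Prod.fst).support.Finite := by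
      rw [fst_support_eq H.isChain hS]
      exact (H.isChain.finite _ _ hS).image _
    have hP : 1 ≤ ((D.K j S).map Prod.fst).support.ncard :=
      (Set.ncard_pos hPfin).2 (PMF.support_nonempty _)
    have hsum := gau_sum C.cpos C.add ((pcs (R j) S).map fun z => (S.sub τ z.1 z.2).len) (by
      intro x hx
      obtain ⟨z, hz, rfl⟩ := List.mem_map.1 hx
      exact (hmk.sub τ (H.sx.one_le j) hz).pos) (by simpa using hpcs)
    rw [len_sum_pcs, List.map_map, List.length_map] at hsum
    have hsmall : S.len < N → (D.kap (j + 1) S).support.ncard ≤ 1 := by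
      intro hN
      have h1 := C.small _ S hS hN
      have h2 : (D.K j S).support.ncard ≤ 1 := by
        have h3 := KSCoding.ncard_K_le H.isChain j S hS
        rw [H.ch] at h3
        refine h3.trans (prod_le_one_nat _ ?_)
        intro n hn
        obtain ⟨t, ht, rfl⟩ := List.mem_map.1 hn
        obtain ⟨z, hz, rfl⟩ := List.mem_map.1 ht
        have hzm := (pcs_chn (R j) S).mem z hz
        refine (ih _ (hchild z hz)).1 ?_
        change z.2 - z.1 < N
        omega
      omega
    have hnum : ((D.kap (j + 1) S).support.ncard : ℝ) ≤
        (D.K j S).support.ncard + (D.pi (j + 1) S).support.ncard := by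
      exact_mod_cast (by omega : (D.kap (j + 1) S).support.ncard ≤
        (D.K j S).support.ncard + (D.pi (j + 1) S).support.ncard)
    have hns : N ≤ S.len → ¬ Sing R (j + 1) S → ((D.kap (j + 1) S).support.ncard : ℝ) ≤
        Real.exp (h * S.len - g S.len) * (Real.exp (-c) + Real.exp (-g S.len)) := by
      intro hN hsing
      have hlen : 2 ≤ (pcs (R j) S).length := by
        have h1 : (pcs (R j) S).length ≠ 1 := hsing
        have h2 := List.length_pos_iff.2 hpcs
        omega
      have h1 := hsum.2 hlen
      have hA := C.big _ S hS hN
      rw [htwo] at hA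
      have h2 : ((D.K j S).support.ncard : ℝ) ≤ Real.exp (h * S.len - g S.len) *
          Real.exp (-c) := by
        refine hK.trans ?_
        rw [← Real.exp_add, Real.exp_le_exp]
        have h3 := hsum.2 hlen
        simp only [Function.comp_def] at h3
        linarith
      rw [mul_add]
      exact hnum.trans (add_le_add h2 hA)
    refine ⟨hsmall, ?_, hns⟩
    by_cases hN : N ≤ S.len
    swap
    · refine le_trans ?_ (hone S)
      exact_mod_cast hsmall (by omega)
    have hexp := C.exp_le _ hN
    have hp1 := Real.exp_pos (-g S.len)
    have hp2 := Real.exp_pos (h * S.len - g S.len)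
    by_cases hsing : Sing R (j + 1) S
    swap
    · refine (hns hN hsing).trans (mul_le_of_le_one_right hp2.le ?_)
      linarith
    have hone1 := pcs_eq_of_length _ _ hsing
    have hKj : (D.K j S).support.ncard ≤ (D.kap j S).support.ncard := by
      have h3 := KSCoding.ncard_K_le H.isChain j S hS
      rw [H.ch] at h3
      simpa [chS, pcsL, hone1, sub_self_eq] using h3
    have hadm : Adm ρ ξ τ R j S := by
      have := hchild (0, S.len) (by rw [hone1]; simp)
      rwa [sub_self_eq] at this
    obtain ⟨-, i2, i3⟩ := ih S hadm
    -- On a second uncut level the refinement map is injective on the classes. The term with the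
    -- marginal in the recoupling bound then cancels the number of classes of the node.
    by_cases hsj : Sing R j S
    · obtain _ | i := j
      · exact absurd hsj id
      have e : ((D.K (i + 1) S).map Prod.fst).support.ncard =
          (D.pi (i + 1 + 1) S).support.ncard := by
        rw [fst_support_eq H.isChain hS, Set.InjOn.ncard_image]
        intro x hx y hy hxy
        have e1 := H.rf_single hS hone1 (pcs_eq_of_length _ _ hsj) hx
        have e2 := H.rf_single hS hone1 (pcs_eq_of_length _ _ hsj) hy
        change D.rf (i + 2) S x = D.rf (i + 2) S y at hxy
        rw [e1, e2] at hxy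
        simpa using hxy
      refine le_trans ?_ i2
      exact_mod_cast (by omega : (D.kap (i + 1 + 1) S).support.ncard ≤
        (D.kap (i + 1) S).support.ncard)
    · have h1 := i3 hN hsj
      have hA := C.big _ S hS hN
      rw [htwo] at hA
      have hKj' : ((D.K j S).support.ncard : ℝ) ≤ (D.kap j S).support.ncard := by
        exact_mod_cast hKj
      refine hnum.trans ((add_le_add (hKj'.trans h1) hA).trans ?_)
      rw [← mul_add]
      refine mul_le_of_le_one_right hp2.le ?_
      linarith

/-- The number of symbols that do not determine the symbols of the children. -/
theorem Link.ncard_split_le (H : Link ρ ξ τ R μ a cd1 ν b cd2 D p)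
    (C : Cnt ρ ξ τ R D h g c N) {j : ℕ} {S : Skel} (hS : Adm ρ ξ τ R (j + 1) S) :
    ((D.split (j + 1) S).ncard : ℝ) ≤
      Real.exp (h * S.len - ((pcs (R j) S).map fun z => g (S.sub τ z.1 z.2).len).sum) := by
  refine le_trans ?_ (H.ncard_K_le hS fun z hz =>
    (H.ncard_kap_aux C j _ (hS.sub H.sx.mono hz)).2.1)
  exact_mod_cast KSCoding.ncard_split_le H.isChain j S hS

end
end KSCoding

open MeasureTheory Filter Asymptotics
open scoped ENNReal
namespace KSCoding
noncomputable section

set_option linter.unusedSectionVars false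

/-! ### Information of classes -/

theorem info_le_iff (q : ℝ≥0∞) (t : ℝ) :
    info q ≤ (t : EReal) ↔ ENNReal.ofReal (Real.exp (-t)) ≤ q := by
  have e : ENNReal.log (ENNReal.ofReal (Real.exp (-t))) = ((-t : ℝ) : EReal) := by
    rw [ENNReal.log_pos_real' (by
      rw [ENNReal.toReal_ofReal (Real.exp_pos _).le]; exact Real.exp_pos _),
      ENNReal.toReal_ofReal (Real.exp_pos _).le, Real.log_exp]
  rw [info, EReal.neg_le, ← EReal.coe_neg, ← e]
  exact ENNReal.log_strictMono.le_iff_le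

theorem info_lt_of_lt {q : ℝ≥0∞} {t : ℝ} (h : ENNReal.ofReal (Real.exp (-t)) < q) :
    info q < (t : EReal) := by
  have e : ENNReal.log (ENNReal.ofReal (Real.exp (-t))) = ((-t : ℝ) : EReal) := by
    rw [ENNReal.log_pos_real' (by
      rw [ENNReal.toReal_ofReal (Real.exp_pos _).le]; exact Real.exp_pos _),
      ENNReal.toReal_ofReal (Real.exp_pos _).le, Real.log_exp]
  rw [info, EReal.neg_lt_comm, ← EReal.coe_neg, ← e]
  exact ENNReal.log_strictMono h

section
variable {A : Type*} [Fintype A] [DecidableEq A] [MeasurableSpace A] [MeasurableSingletonClass A]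
variable {μ : Measure (ℤ → A)} [IsProbabilityMeasure μ] {a : A}
  {ξ : (ℤ → Bool) → ℤ → ℕ} {τ : ℕ → ℕ} {L : ℕ → ℝ} {R : ℕ → ℕ} {ρ : Measure (ℤ → Bool)}
  {rel : (S : Skel) → Setoid (Filler a S)} {N : ℕ} {cd : Skel → (ℕ → A) → ℕ}

theorem vld_of_code_eq {S : Skel} {f g : ℕ → A} (hg : Vld a S g)
    (hN : N ≤ S.len) (h : code rel N S f = code rel N S g) : Vld a S f := by
  by_contra hf
  have hinj := (exists_enc rel).choose_spec
  rw [code, code, dif_neg (fun h => hf h.1), dif_pos ⟨hg, hN⟩] at h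
  simpa using hinj h

theorem Filler.vld {S : Skel} (w : Filler a S) : Vld a S (wext a w.1) := by
  intro k hk
  rw [wext, dif_pos hk, Skel.stx, dif_pos hk]
  exact w.2 ⟨k, hk⟩

theorem toFil_wext {S : Skel} (w : Filler a S) : toFil w.vld = w := by
  refine Subtype.ext (funext fun j => ?_)
  simp [toFil, wext]

/-- The probability of a class of fillers is the probability of its code. -/
theorem lawF_code {S : Skel} (hpos : μ (HS a S) ≠ 0) (hN : N ≤ S.len) (w : Filler a S) :
    lawF μ a S (code rel N S) (code rel N S (wext a w.1)) =
      fillerMeasure μ a S (Subtype.val '' {v : Filler a S | (rel S) v w}) := by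
  rw [← pmf_toOuterMeasure_singleton, lawF_toOuterMeasure hpos]
  congr 1
  ext v
  simp only [Set.mem_ofPred_eq, Set.mem_singleton_iff, Set.mem_image]
  constructor
  · intro h
    have hv := vld_of_code_eq w.vld hN h
    obtain ⟨h1, h2, h3⟩ := rl_of_code_eq hv w.vld hN h
    refine ⟨toFil hv, ?_, ?_⟩
    · have := toFil_wext w
      rw [← this]; exact h3
    · funext j
      simp [toFil, wext]
  · rintro ⟨v, hv, rfl⟩
    refine code_eq_of_rl (Filler.vld v) w.vld fun _ => ⟨Filler.vld v, w.vld, ?_⟩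
    have h1 : toFil (Filler.vld (a := a) (S := S) v) = v := toFil_wext v
    have h2 := toFil_wext w
    have h3 : (rel S) v w := hv
    rw [← h1, ← h2] at h3
    exact h3

theorem pmf_ncard_le {β : Type*} (q : PMF β) (hf : q.support.Finite) {t : ℝ}
    (h : ∀ c ∈ q.support, ENNReal.ofReal (Real.exp (-t)) ≤ q c) :
    (q.support.ncard : ℝ) ≤ Real.exp t := by
  have h1 : (q.support.ncard : ℝ≥0∞) * ENNReal.ofReal (Real.exp (-t)) ≤ 1 := by
    rw [Set.ncard_eq_toFinset_card _ hf, ← nsmul_eq_mul, ← Finset.sum_const]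
    refine (Finset.sum_le_sum fun c hc => h c (hf.mem_toFinset.1 hc)).trans ?_
    rw [← q.tsum_coe]
    exact ENNReal.sum_le_tsum _
  have h2 := ENNReal.toReal_mono ENNReal.one_ne_top h1
  rw [ENNReal.toReal_mul, ENNReal.toReal_natCast, ENNReal.toReal_ofReal (Real.exp_pos _).le,
    ENNReal.toReal_one, Real.exp_neg, ← div_eq_mul_inv, div_le_one (Real.exp_pos _)] at h2
  exact h2

theorem ncard_code_le {S : Skel} (hpos : μ (HS a S) ≠ 0) (hN : N ≤ S.len) {t : ℝ}
    (ht : ∀ w : Filler a S, fillerMeasure μ a S {w.1} ≠ 0 →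
      info (fillerMeasure μ a S (Subtype.val '' {v | (rel S) v w})) ≤ (t : EReal)) :
    ((lawF μ a S (code rel N S)).support.ncard : ℝ) ≤ Real.exp t := by
  refine pmf_ncard_le _ (finite_support_lawF _ _) fun c hc => ?_
  obtain ⟨w, h1, h2, rfl⟩ := exists_vld_of_lawF_ne_zero hpos hc
  set w' : Filler a S := toFil h2 with hw'
  have e : w'.1 = w := by funext j; simp [hw', toFil, wext]
  have e2 := lawF_code (rel := rel) hpos hN w'
  rw [e] at e2
  rw [e2]
  rw [← info_le_iff]
  refine ht w' ?_
  rw [e, ← lawW_toOuterMeasure hpos, pmf_toOuterMeasure_singleton]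
  exact h1

theorem ncard_code_small {S : Skel} (hN : S.len < N) :
    (lawF μ a S (code rel N S)).support.ncard ≤ 1 := by
  rw [lawF, PMF.support_map]
  refine (Set.ncard_le_one ((Set.toFinite _).image _)).2 ?_
  rintro _ ⟨w, -, rfl⟩ _ ⟨w', -, rfl⟩
  simp only [code]
  rw [dif_neg (fun h => absurd h.2 (by omega)), dif_neg (fun h => absurd h.2 (by omega))]

/-- The upper bound of the information of the classes of fillers. -/
def UpInfo (μ : Measure (ℤ → A)) (a : A) (ξ : (ℤ → Bool) → ℤ → ℕ) (τ : ℕ → ℕ)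
    (rel : (S : Skel) → Setoid (Filler a S)) (k : ℝ) (N : ℕ) (ω : ℤ → Bool) : Prop :=
  ∀ α γ : ℤ, IsSkeleton (ξ ω) α γ → (N : ℤ) ≤ γ - α →
    ∀ w : Filler a (skelOn τ ω (ξ ω) α γ), fillerMeasure μ a _ {w.1} ≠ 0 →
      info (fillerMeasure μ a _ (Subtype.val '' {v | (rel _) v w})) ≤
        ((((γ - α : ℤ) : ℝ) * condEntropyRate μ a - Lam k (1 / 2) ((γ - α : ℤ) : ℝ) : ℝ) : EReal)

theorem UpInfo.at {k : ℝ} {ω : ℤ → Bool} (h : UpInfo μ a ξ τ rel k N ω) {r : ℕ} (hr : 1 ≤ r)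
    {s : ℤ × Skel} (hs : At ξ τ r s ω) (hN : N ≤ s.2.len) (w : Filler a s.2)
    (hw : fillerMeasure μ a s.2 {w.1} ≠ 0) :
    info (fillerMeasure μ a s.2 (Subtype.val '' {v | (rel s.2) v w})) ≤
      ((s.2.len * condEntropyRate μ a - Lam k (1 / 2) s.2.len : ℝ) : EReal) := by
  have h1 := h s.1 (s.1 + s.2.len) (hs.1.isSkeleton hr) (by omega)
  rw [hs.2] at h1
  have := h1 w hw
  rwa [add_sub_cancel_left] at this

theorem Side.info_le (h : Side ρ ξ τ R μ a cd) {k : ℝ} (hup : ∀ᵐ ω ∂ρ, UpInfo μ a ξ τ rel k N ω)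
    {j : ℕ} {S : Skel} (hS : Adm ρ ξ τ R j S) (hN : N ≤ S.len) (w : Filler a S)
    (hw : fillerMeasure μ a S {w.1} ≠ 0) :
    info (fillerMeasure μ a S (Subtype.val '' {v | (rel S) v w})) ≤
      ((S.len * condEntropyRate μ a - Lam k (1 / 2) S.len : ℝ) : EReal) := by
  obtain ⟨α, ω, h1, h2⟩ := hS.exists_at hup
  exact h1.at (h.one_le j) (s := (α, S)) h2 hN w hw

theorem lam_half (k s : ℝ) : Lam k (1 / 2) s = √s * Real.log s ^ k := by
  rw [Lam, Real.sqrt_eq_rpow]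

/-- Goodness thus leaves room for twice the gauge: one copy is the allowance of the coupling, the
other makes the classes of a node negligible against it. -/
theorem two_mul_gau_le {ε k : ℝ} {k' : ℕ} (hε : ε ≤ 1 / 2) (hk : -(k' : ℝ) ≤ k)
    {s : ℕ} (hs : 3 ≤ s) : 2 * gau ε k' s ≤ Lam k (1 / 2) s := by
  have hs' : (3 : ℝ) ≤ s := by exact_mod_cast hs
  have hl : 1 ≤ Real.log s := by
    rw [Real.le_log_iff_exp_le (by linarith)]
    linarith [Real.exp_one_lt_d9]
  have hl2 : Real.log s ≤ Real.log (s + 3) := Real.log_le_log (by linarith) (by linarith)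
  rw [lam_half]
  have h1 : (Real.log (s + 3) ^ k')⁻¹ ≤ Real.log s ^ k := by
    calc (Real.log (s + 3) ^ k')⁻¹ ≤ (Real.log s ^ k')⁻¹ := by gcongr
      _ = Real.log s ^ (-(k' : ℝ)) := by
        rw [Real.rpow_neg (by linarith), Real.rpow_natCast]
      _ ≤ _ := Real.rpow_le_rpow_of_exponent_le hl hk
  unfold gau
  rw [div_eq_mul_inv]
  have h2 : 0 ≤ √(s : ℝ) := Real.sqrt_nonneg _
  have h3 : 0 ≤ (Real.log ((s : ℝ) + 3) ^ k')⁻¹ := by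
    have : 0 < Real.log ((s : ℝ) + 3) := by linarith
    positivity
  calc 2 * (ε * √s * (Real.log (s + 3) ^ k')⁻¹) = (2 * ε) * (√s * (Real.log (s + 3) ^ k')⁻¹) := by
        ring
    _ ≤ 1 * (√s * (Real.log (s + 3) ^ k')⁻¹) := by gcongr; linarith
    _ ≤ _ := by rw [one_mul]; gcongr

/-- The entropy is positive. -/
theorem Side.entropy_pos (h : Side ρ ξ τ R μ a cd) (hR : Tendsto R atTop atTop) {k : ℝ}
    (hup : ∀ᵐ ω ∂ρ, UpInfo μ a ξ τ rel k N ω) : 0 < condEntropyRate μ a := by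
  have : IsProbabilityMeasure ρ := by
    rw [← h.law]; exact Measure.isProbabilityMeasure_map (measurable_hat a).aemeasurable
  obtain ⟨ω, hω⟩ := (h.ae_gd).exists
  obtain ⟨r0, hr0⟩ := hω.1.reg.eventually_cover (max N 3)
  obtain ⟨j, hj⟩ := (hR.eventually_ge_atTop r0).exists
  obtain ⟨s, h1, h2⟩ := hω.1.exists_at τ (R j) 0
  obtain ⟨e1, e2⟩ := h1.1.ends h2.1 h2.2
  have h3 := hr0 _ hj
  rw [e1, e2] at h3
  have hN : max N 3 ≤ s.2.len := by
    have := h3.1; have := h3.2; omega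
  have hlen : (3 : ℝ) ≤ s.2.len := by exact_mod_cast (le_max_right _ _).trans hN
  have hadm := hω.adm h1
  have hpos := h.HS_ne_zero hadm
  obtain ⟨w, hw⟩ := (lawW μ a s.2).support_nonempty
  have hv := vld_of_lawW_ne_zero hpos hw
  have e : (toFil hv).1 = w := by funext j; simp [toFil, wext]
  have hinf := h.info_le hup hadm ((le_max_left _ _).trans hN) (toFil hv) (by
    rw [e, ← lawW_toOuterMeasure hpos, pmf_toOuterMeasure_singleton]; exact hw)
  rw [info_le_iff] at hinf
  have := isProbabilityMeasure_fillerMeasure hpos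
  -- A class has probability at most one, so its information is nonnegative. The upper bound then
  -- forces `|S| h ≥ Λ_{k,1/2}(|S|) > 0`.
  have h4 := hinf.trans prob_le_one
  rw [← ENNReal.ofReal_one, ENNReal.ofReal_le_ofReal_iff zero_le_one, Real.exp_le_one_iff,
    lam_half] at h4
  have h5 : 0 < √(s.2.len : ℝ) * Real.log s.2.len ^ k :=
    mul_pos (Real.sqrt_pos.2 (by linarith)) (Real.rpow_pos_of_pos (Real.log_pos (by linarith)) _)
  by_contra hc
  have h6 : (s.2.len : ℝ) * condEntropyRate μ a ≤ 0 :=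
    mul_nonpos_of_nonneg_of_nonpos (by linarith) (not_lt.1 hc)
  linarith

end

variable {A B : Type*} [Fintype A] [DecidableEq A] [MeasurableSpace A]
  [MeasurableSingletonClass A] [Fintype B] [DecidableEq B] [MeasurableSpace B]
  [MeasurableSingletonClass B] {ρ : Measure (ℤ → Bool)} {ξ : (ℤ → Bool) → ℤ → ℕ} {τ : ℕ → ℕ}
  {R : ℕ → ℕ} {μ : Measure (ℤ → A)} [IsProbabilityMeasure μ] {a : A}
  {ν : Measure (ℤ → B)} [IsProbabilityMeasure ν] {b : B}
  {D : ChainData Skel} {p : ℕ → Prop}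

theorem Link.cnt {relA : (S : Skel) → Setoid (Filler a S)}
    {relB : (S : Skel) → Setoid (Filler b S)} {N NA NB : ℕ}
    (H : Link ρ ξ τ R μ a (code relA N) ν b (code relB N) D p) {kA kB h ε c : ℝ} {k' : ℕ}
    (hA : ∀ᵐ ω ∂ρ, UpInfo μ a ξ τ relA kA NA ω) (hB : ∀ᵐ ω ∂ρ, UpInfo ν b ξ τ relB kB NB ω)
    (hhA : condEntropyRate μ a = h) (hhB : condEntropyRate ν b = h)
    (hkA : -(k' : ℝ) ≤ kA) (hkB : -(k' : ℝ) ≤ kB) (hε0 : 0 ≤ ε) (hε : ε ≤ 1 / 2) (hεh : ε ≤ h)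
    (hc : 0 < c)
    (hadd : ∀ x y : ℕ, 1 ≤ x → 1 ≤ y → gau ε k' (x + y) + c ≤ gau ε k' x + gau ε k' y)
    (hexp : ∀ s ≥ N, Real.exp (-c) + 2 * Real.exp (-gau ε k' s) ≤ 1)
    (hN3 : 3 ≤ N) (hNA : NA ≤ N) (hNB : NB ≤ N) : Cnt ρ ξ τ R D h (gau ε k') c N where
  cpos := hc
  add := hadd
  exp_le := hexp
  le s := (gau_le hε0 k' s).trans (by gcongr)
  big j S hS hN := by
    by_cases hj : p j
    · rw [H.pix j hj]
      refine (ncard_code_le (H.sx.HS_ne_zero hS) hN fun w hw =>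
        H.sx.info_le hA hS (hNA.trans hN) w hw).trans ?_
      rw [Real.exp_le_exp, hhA, mul_comm]
      linarith [two_mul_gau_le hε hkA (hN3.trans hN)]
    · rw [H.piy j hj]
      refine (ncard_code_le (H.sy.HS_ne_zero hS) hN fun w hw =>
        H.sy.info_le hB hS (hNB.trans hN) w hw).trans ?_
      rw [Real.exp_le_exp, hhB, mul_comm]
      linarith [two_mul_gau_le hε hkB (hN3.trans hN)]
  small j S _ hN := by
    by_cases hj : p j
    · rw [H.pix j hj]; exact ncard_code_small hN
    · rw [H.piy j hj]; exact ncard_code_small hN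

theorem exists_threshold {ε c : ℝ} (hε : 0 < ε) (hc : 0 < c) (k' N0 : ℕ) : ∃ N : ℕ, N0 ≤ N ∧
    ∀ s ≥ N, Real.exp (-c) + 2 * Real.exp (-gau ε k' s) ≤ 1 := by
  have h1 : Tendsto (fun s => Real.exp (-c) + 2 * Real.exp (-gau ε k' s)) atTop
      (nhds (Real.exp (-c) + 2 * 0)) := by
    refine tendsto_const_nhds.add (Tendsto.const_mul _ ?_)
    exact Real.tendsto_exp_neg_atTop_nhds_zero.comp (tendsto_gau hε k')
  have h2 : Real.exp (-c) + 2 * 0 < 1 := by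
    have : Real.exp (-c) < 1 := Real.exp_lt_one_iff.2 (by linarith)
    linarith
  obtain ⟨n, hn⟩ := (h1.eventually_le_const h2).exists_forall_of_atTop
  exact ⟨max N0 n, le_max_left _ _, fun s hs => hn s ((le_max_right _ _).trans hs)⟩

end
end KSCoding

open MeasureTheory Filter Asymptotics
open scoped ENNReal
namespace KSCoding
noncomputable section

set_option linter.unusedSectionVars false

/-! ### The mass of the split symbols -/

variable {A B : Type*} [Fintype A] [DecidableEq A] [MeasurableSpace A]
  [MeasurableSingletonClass A] [Fintype B] [DecidableEq B] [MeasurableSpace B]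
  [MeasurableSingletonClass B] {ρ : Measure (ℤ → Bool)} {ξ : (ℤ → Bool) → ℤ → ℕ} {τ : ℕ → ℕ}
  {R : ℕ → ℕ} {μ : Measure (ℤ → A)} [IsProbabilityMeasure μ] {a : A}
  {cd1 : Skel → (ℕ → A) → ℕ} {ν : Measure (ℤ → B)} [IsProbabilityMeasure ν] {b : B}
  {cd2 : Skel → (ℕ → B) → ℕ} {D : ChainData Skel} {p : ℕ → Prop}

theorem At.fillerAt_iff {r : ℕ} {x : ℤ → A} {s : ℤ × Skel} (h : At ξ τ r s (hat a x))
    (h0 : Cov s 0) (P : (S : Skel) → Filler a S → Prop) :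
    P (skelAt a ξ τ r x) (fillerAt a ξ τ r x) ↔ P s.2 (toFil h.vld_wd) := by
  obtain ⟨α, S⟩ := s
  have e := h.pos_eq h0.1 h0.2
  simp only [pos, Prod.mk.injEq] at e
  obtain ⟨rfl, rfl⟩ := e
  rfl

theorem Side.measure_codeEv_le (h : Side ρ ξ τ R μ a cd1) (j : ℕ) (C : ℤ × Skel → Set ℕ)
    (t : ℝ≥0∞) (hC : ∀ s, Adm ρ ξ τ R j s.2 →
      (lawF μ a s.2 (cd1 s.2)).toOuterMeasure (C s) ≤ t) : μ (codeEv ξ τ R a cd1 j C) ≤ t := by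
  rw [h.measure_codeEv]
  have h1 : ∀ s : {s : ℤ × Skel // Cov s 0}, μ {x | (Gen ξ (hat a x) ∧
      At ξ τ (R j) s.1 (hat a x)) ∧ cd1 s.1.2 (wd x s.1.1) ∈ C s.1} ≤
      μ {x | (Gen ξ (hat a x) ∧ At ξ τ (R j) s.1 (hat a x)) ∧
        cd1 s.1.2 (wd x s.1.1) ∈ Set.univ} * t := by
    intro s
    have e : {x | (Gen ξ (hat a x) ∧ At ξ τ (R j) s.1 (hat a x)) ∧
        cd1 s.1.2 (wd x s.1.1) ∈ Set.univ} =
        {x | Gen ξ (hat a x) ∧ At ξ τ (R j) s.1 (hat a x)} := by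
      ext x; simp
    rw [e]
    by_cases h0 : μ {x | Gen ξ (hat a x) ∧ At ξ τ (R j) s.1 (hat a x)} = 0
    · rw [measure_mono_null (fun x hx => hx.1) h0]
      exact zero_le
    have hadm : Adm ρ ξ τ R j s.1.2 := by
      refine ⟨s.1.1, fun hz => h0 ?_⟩
      rw [h.measure_at_eq]
      exact measure_mono_null (fun ω hω => hω.2) hz
    rw [show μ {x | (Gen ξ (hat a x) ∧ At ξ τ (R j) s.1 (hat a x)) ∧
        cd1 s.1.2 (wd x s.1.1) ∈ C s.1} = _ from
      at_law (τ := τ) h.meas h.stat h.renewal h.apos (h.one_le j) s.1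
      (h.HS_ne_zero hadm) (h.mk_of_adm hadm) (cd1 s.1.2) (h.depN _) (C s.1)]
    exact mul_le_mul_right (hC _ hadm) _
  refine (ENNReal.tsum_le_tsum h1).trans ?_
  rw [ENNReal.tsum_mul_right, ← h.measure_codeEv j fun _ => Set.univ]
  exact mul_le_of_le_one_left zero_le prob_le_one

theorem pmf_small_mass {β : Type*} (q : PMF β) {C : Set β} (hC : C.Finite) (δ : ℝ≥0∞)
    (h : ∀ c ∈ C, q c ≤ δ) : q.toOuterMeasure C ≤ C.ncard * δ := by
  rw [Set.ncard_eq_toFinset_card _ hC]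
  conv_lhs => rw [← hC.coe_toFinset]
  rw [PMF.toOuterMeasure_apply_finset, ← nsmul_eq_mul, ← Finset.sum_const]
  exact Finset.sum_le_sum fun c hc => h c (hC.mem_toFinset.1 hc)

/-- The lower bound of the information of the class of the covering skeleton. -/
def LowInfo (μ : Measure (ℤ → A)) (a : A) (ξ : (ℤ → Bool) → ℤ → ℕ) (τ : ℕ → ℕ)
    (rel : (S : Skel) → Setoid (Filler a S)) (h K : ℝ) (r : ℕ) (x : ℤ → A) : Prop :=
  (((((skelAt a ξ τ r x).len : ℝ) * h
    - Lam K (1 / 2) ((skelAt a ξ τ r x).len : ℝ) : ℝ) : EReal)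
      ≤ info (fillerMeasure μ a (skelAt a ξ τ r x)
        (Subtype.val '' {v | (rel (skelAt a ξ τ r x)) v (fillerAt a ξ τ r x)})))

/-- The gauges of the children outweigh the fluctuation of the information. -/
def Heavy (τ : ℕ → ℕ) (g : ℕ → ℝ) (K θ : ℝ) (N : ℕ) (r : ℕ) (S : Skel) : Prop :=
  N ≤ S.len ∧ Lam K (1 / 2) S.len + θ ≤ ((pcs r S).map fun z => g (S.sub τ z.1 z.2).len).sum

/-- Outside the atypical skeletons and classes, a split code has mass at most `exp(-h|S| +
Λ_{K,1/2}(|S|))`, and there are at most `exp(h|S| - Σ g)` split codes. On a heavy skeleton the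
product is at most `exp(-θ)`. -/
theorem Link.split_le {rel : (S : Skel) → Setoid (Filler a S)} {N : ℕ}
    (H : Link ρ ξ τ R μ a (code rel N) ν b cd2 D p) {h c : ℝ} {g : ℕ → ℝ}
    (C : Cnt ρ ξ τ R D h g c N) {j : ℕ} (hj : p (j + 1)) (K θ : ℝ) :
    μ (splitEv ξ τ R a (code rel N) D (j + 1)) ≤ ENNReal.ofReal (Real.exp (-θ)) +
      μ {x | ¬ LowInfo μ a ξ τ rel h K (R (j + 1)) x} +
      μ {x | ∃ s, At ξ τ (R (j + 1)) s (hat a x) ∧ Cov s 0 ∧ ¬ Heavy τ g K θ N (R j) s.2} := by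
  set δ : Skel → ℝ≥0∞ := fun S => ENNReal.ofReal (Real.exp (-(S.len * h - Lam K (1 / 2) S.len)))
    with hδ
  set C1 : ℤ × Skel → Set ℕ := fun s => {c | Heavy τ g K θ N (R j) s.2 ∧
    c ∈ D.split (j + 1) s.2 ∧ D.pi (j + 1) s.2 c ≤ δ s.2} with hC1
  have hsub : μ (splitEv ξ τ R a (code rel N) D (j + 1)) ≤
      μ ((codeEv ξ τ R a (code rel N) (j + 1) C1 ∪
      {x | ¬ LowInfo μ a ξ τ rel h K (R (j + 1)) x}) ∪
      {x | ∃ s, At ξ τ (R (j + 1)) s (hat a x) ∧ Cov s 0 ∧ ¬ Heavy τ g K θ N (R j) s.2}) := by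
    refine measure_mono_ae ?_
    filter_upwards [H.sx.ae_map H.sx.ae_gd] with x hgd
    rintro ⟨h1, s, h2, h3, h4⟩
    by_cases hh : Heavy τ g K θ N (R j) s.2
    swap
    · exact Or.inr ⟨s, h2, h3, hh⟩
    left
    by_cases hd : D.pi (j + 1) s.2 (code rel N s.2 (wd x s.1)) ≤ δ s.2
    · exact Or.inl ⟨h1, s, h2, h3, hh, h4, hd⟩
    · right
      change ¬ LowInfo μ a ξ τ rel h K (R (j + 1)) x
      intro hlow
      have hlow' := (h2.fillerAt_iff h3 fun S w =>
        (((S.len : ℝ) * h - Lam K (1 / 2) (S.len : ℝ) : ℝ) : EReal)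
          ≤ info (fillerMeasure μ a S (Subtype.val '' {v | (rel S) v w}))).1 hlow
      have hpos := H.sx.HS_ne_zero (hgd.adm h2)
      rw [not_le, H.pix _ hj] at hd
      have e : code rel N s.2 (wd x s.1) = code rel N s.2 (wext a (toFil h2.vld_wd).1) :=
        code_depN s.2 _ _ fun k hk => by simp [wext, toFil, hk]
      rw [e, lawF_code hpos hh.1] at hd
      exact absurd (info_lt_of_lt hd) (not_lt.2 hlow')
  refine hsub.trans ((measure_union_le _ _).trans (add_le_add ((measure_union_le _ _).trans
    (add_le_add ?_ le_rfl)) le_rfl))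
  refine H.sx.measure_codeEv_le _ _ _ fun s hs => ?_
  rw [← H.pix _ hj]
  by_cases hh : Heavy τ g K θ N (R j) s.2
  swap
  · have : C1 s = ∅ := Set.eq_empty_iff_forall_notMem.2 fun c hc => hh hc.1
    rw [this]; simp
  have hfin : (D.split (j + 1) s.2).Finite :=
    (H.isChain.finite _ _ hs).subset fun c hc => hc.1
  have hsub2 : C1 s ⊆ D.split (j + 1) s.2 := fun c hc => hc.2.1
  refine (pmf_small_mass _ (hfin.subset hsub2) (δ s.2) fun c hc => hc.2.2).trans ?_
  have hcard : ((C1 s).ncard : ℝ) ≤ Real.exp (h * s.2.len -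
      ((pcs (R j) s.2).map fun z => g (s.2.sub τ z.1 z.2).len).sum) := by
    refine le_trans ?_ (H.ncard_split_le C hs)
    exact_mod_cast Set.ncard_le_ncard hsub2 hfin
  have e1 : ((C1 s).ncard : ℝ≥0∞) = ENNReal.ofReal ((C1 s).ncard : ℝ) := by simp
  rw [e1, hδ, ← ENNReal.ofReal_mul (Nat.cast_nonneg _)]
  refine ENNReal.ofReal_le_ofReal ((mul_le_mul_of_nonneg_right hcard (Real.exp_pos _).le).trans ?_)
  rw [← Real.exp_add, Real.exp_le_exp]
  linarith [hh.2]

/-- The skeleton of rank `r` that covers `0` has a length out of the range `[u, v]`. -/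
def BadSize (a : A) (ξ : (ℤ → Bool) → ℤ → ℕ) (r : ℕ) (u v : ℝ) (x : ℤ → A) : Prop :=
  ¬ (u ≤ ((rightEnd (ξ (hat a x)) r - leftEnd (ξ (hat a x)) r : ℤ) : ℝ) ∧
    ((rightEnd (ξ (hat a x)) r - leftEnd (ξ (hat a x)) r : ℤ) : ℝ) ≤ v)

theorem At.badSize_iff {r : ℕ} {x : ℤ → A} {s : ℤ × Skel} (h : At ξ τ r s (hat a x))
    (h0 : Cov s 0) (u v : ℝ) :
    BadSize a ξ r u v x ↔ ¬ (u ≤ (s.2.len : ℝ) ∧ (s.2.len : ℝ) ≤ v) := by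
  obtain ⟨e1, e2⟩ := h.1.ends h0.1 h0.2
  rw [BadSize, e1, e2, add_sub_cancel_left, Int.cast_natCast]

/-- Most covering skeletons are heavy. -/
theorem Side.measure_not_heavy_le (H : Side ρ ξ τ R μ a cd1) {K θ u v u' l ε : ℝ} {k N j : ℕ}
    (hε : 0 ≤ ε)
    (hnum : ∀ s : ℕ, u ≤ s → (s : ℝ) ≤ v → N ≤ s ∧
      Lam K (1 / 2) s + θ ≤ s * (ε / (√l * Real.log (l + 3) ^ k))) :
    μ {x | ∃ s, At ξ τ (R (j + 1)) s (hat a x) ∧ Cov s 0 ∧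
      ¬ Heavy τ (gau ε k) K θ N (R j) s.2} ≤
      μ {x | BadSize a ξ (R (j + 1)) u v x} +
        (2 * ⌈v⌉₊ + 1 : ℕ) * μ {x | BadSize a ξ (R j) u' l x} := by
  set U2 : ℤ → Set (ℤ → A) := fun n => shN n ⁻¹' {x | BadSize a ξ (R j) u' l x} with hU2
  have hsub : μ {x | ∃ s, At ξ τ (R (j + 1)) s (hat a x) ∧ Cov s 0 ∧
      ¬ Heavy τ (gau ε k) K θ N (R j) s.2} ≤ μ ({x | BadSize a ξ (R (j + 1)) u v x} ∪
        ⋃ n ∈ Finset.Icc (-(⌈v⌉₊ : ℤ)) ⌈v⌉₊, U2 n) := by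
    refine measure_mono_ae ?_
    filter_upwards [H.gen] with x hx
    rintro ⟨s, h1, h2, h3⟩
    by_contra hcon
    refine h3 ?_
    have hgood : u ≤ (s.2.len : ℝ) ∧ (s.2.len : ℝ) ≤ v := by
      by_contra hb
      exact hcon (Or.inl ((h1.badSize_iff h2 u v).2 hb))
    obtain ⟨k1, k2⟩ := hnum _ hgood.1 hgood.2
    refine ⟨k1, k2.trans ?_⟩
    have hlenv : s.2.len ≤ ⌈v⌉₊ := by
      exact_mod_cast hgood.2.trans (Nat.le_ceil v)
    have hm : R j ≤ R (j + 1) := H.mono (Nat.le_succ j)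
    have hchild : ∀ z ∈ pcs (R j) s.2, (((s.2.sub τ z.1 z.2).len : ℕ) : ℝ) ≤ l ∧
        1 ≤ (s.2.sub τ z.1 z.2).len := by
      intro z hz
      obtain ⟨z1, z2, z3⟩ := (pcs_chn (R j) s.2).mem z hz
      have hlen : (s.2.sub τ z.1 z.2).len = z.2 - z.1 := rfl
      refine ⟨?_, by omega⟩
      by_contra hl
      -- A piece that is too long starts at a coordinate of `[-⌈v⌉, ⌈v⌉]`; translated to the origin
      -- it is a bad skeleton of the lower level, so a union bound over these coordinates applies.
      refine hcon (Or.inr (Set.mem_iUnion₂.2 ⟨s.1 + z.1, ?_, ?_⟩))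
      · have := h2.1; have := h2.2
        rw [Finset.mem_Icc]; omega
      · have h4 := h1.sub hm hz
        have h5 : At ξ τ (R j) (0, s.2.sub τ z.1 z.2) (hat a (shN (s.1 + z.1) x)) := by
          rw [hat_shN, hx.at_shN]; simpa using h4
        change BadSize a ξ (R j) u' l (shN (s.1 + z.1) x)
        rw [h5.badSize_iff ⟨le_rfl, by dsimp only; omega⟩]
        exact fun h => hl h.2
    have e : (s.2.len : ℝ) = (((pcs (R j) s.2).map fun z => (s.2.sub τ z.1 z.2).len).sum : ℕ) := by
      exact_mod_cast (len_sum_pcs τ (R j) s.2).symm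
    rw [e, Nat.cast_list_sum, List.map_map, ← List.sum_map_mul_right]
    refine List.sum_le_sum fun z hz => ?_
    exact gau_scale hε k (hchild z hz).2 (hchild z hz).1
  refine hsub.trans ((measure_union_le _ _).trans (add_le_add le_rfl
    ((measure_biUnion_finset_le _ _).trans ?_)))
  have hb : ∀ n ∈ Finset.Icc (-(⌈v⌉₊ : ℤ)) ⌈v⌉₊, μ (U2 n) ≤
      μ {x | BadSize a ξ (R j) u' l x} := by
    intro n _
    rw [hU2, measure_shN H.stat]
  refine (Finset.sum_le_sum hb).trans ?_
  rw [Finset.sum_const, Int.card_Icc, nsmul_eq_mul]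
  have : ((⌈v⌉₊ : ℤ) + 1 - -(⌈v⌉₊ : ℤ)).toNat = 2 * ⌈v⌉₊ + 1 := by omega
  rw [this]

end
end KSCoding

open MeasureTheory Filter Asymptotics
open scoped ENNReal
namespace KSCoding
noncomputable section

set_option linter.unusedSectionVars false

/-! ### Rapidly decaying sequences -/

theorem SuperPoly.comp {f L : ℕ → ℝ} (h : SuperPoly f L) {R : ℕ → ℕ} (hR : Tendsto R atTop atTop) :
    SuperPoly (fun j => f (R j)) fun j => L (R j) := fun k => (h k).comp_tendsto hR

theorem SuperPoly.add {f g L : ℕ → ℝ} (hf : SuperPoly f L) (hg : SuperPoly g L) :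
    SuperPoly (fun j => f j + g j) L := fun k => (hf k).add (hg k)

theorem SuperPoly.mono {f g L : ℕ → ℝ} (hg : SuperPoly g L) (h0 : ∀ᶠ j in atTop, 0 ≤ f j)
    (h : ∀ᶠ j in atTop, f j ≤ g j) : SuperPoly f L := fun k => by
  refine IsBigO.trans (IsBigO.of_bound 1 ?_) (hg k)
  filter_upwards [h0, h] with j h1 h2
  rw [Real.norm_of_nonneg h1, Real.norm_of_nonneg (h1.trans h2), one_mul]
  exact h2

theorem SuperPoly.change_base {f M M' : ℕ → ℝ} (h : SuperPoly f M)
    (h0 : ∀ᶠ j in atTop, 0 < M' j) (hM : ∀ᶠ j in atTop, M' j ≤ M j ^ 2) : SuperPoly f M' :=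
  fun k => by
  refine (h (2 * k)).trans (IsBigO.of_bound 1 ?_)
  filter_upwards [h0, hM] with j h1 h2
  have h3 : 0 < M' j ^ k := pow_pos h1 k
  have h4 : M' j ^ k ≤ M j ^ (2 * k) := by
    rw [pow_mul]; exact pow_le_pow_left₀ h1.le h2 k
  rw [Real.norm_of_nonneg (inv_nonneg.2 (h3.le.trans h4)), Real.norm_of_nonneg (inv_nonneg.2 h3.le),
    one_mul]
  exact inv_anti₀ h3 h4

theorem SuperPoly.mul_base {f g M : ℕ → ℝ} (h : SuperPoly f M) (hM : Tendsto M atTop atTop)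
    (hg : g =O[atTop] M) : SuperPoly (fun j => g j * f j) M := fun k => by
  refine (hg.mul (h (k + 1))).trans_eventuallyEq ?_
  filter_upwards [hM.eventually_gt_atTop 0] with j hj
  rw [pow_succ, mul_inv]
  field_simp

theorem eventually_log_rpow_le (k : ℝ) : ∀ᶠ x : ℝ in atTop, Real.log x ^ k ≤ x := by
  have h := (isLittleO_log_rpow_rpow_atTop k (one_pos)).bound (c := 1) one_pos
  filter_upwards [h, eventually_ge_atTop 1] with x hx h1
  rw [Real.rpow_one, one_mul, Real.norm_of_nonneg (Real.rpow_nonneg (Real.log_nonneg h1) _),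
    Real.norm_of_nonneg (by linarith)] at hx
  exact hx

/-- Eventually `M / log^c M ≥ √M`, so the exponential is at most `exp(-M^{1/4})`, which beats every
power of `M`. -/
theorem superPoly_exp {M : ℕ → ℝ} (hM : Tendsto M atTop atTop) (c : ℝ) :
    SuperPoly (fun j => Real.exp (-√(M j / Real.log (M j) ^ c))) M := fun k => by
  have h1 : Tendsto (fun x : ℝ => x ^ (4 * k) * Real.exp (-x)) atTop (nhds 0) :=
    Real.tendsto_pow_mul_exp_neg_atTop_nhds_zero (4 * k)
  have h2 : Tendsto (fun j => √(√(M j))) atTop atTop :=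
    Real.tendsto_sqrt_atTop.comp (Real.tendsto_sqrt_atTop.comp hM)
  have h3 := (h1.comp h2).eventually_le_const one_pos
  refine IsBigO.of_bound 1 ?_
  have hlog : ∀ᶠ x : ℝ in atTop, Real.log x ^ c ≤ √x := by
    have h := (isLittleO_log_rpow_rpow_atTop c (show (0 : ℝ) < 1 / 2 by norm_num)).bound
      (c := 1) one_pos
    filter_upwards [h, eventually_ge_atTop 1] with x hx h1
    rw [one_mul, Real.norm_of_nonneg (Real.rpow_nonneg (Real.log_nonneg h1) _),
      Real.norm_of_nonneg (Real.rpow_nonneg (by linarith) _), ← Real.sqrt_eq_rpow] at hx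
    exact hx
  filter_upwards [h3, hM.eventually_gt_atTop 1, hM.eventually hlog] with j hj hM1 hl
  have hM0 : 0 < M j := by linarith
  have hpow : √(√(M j)) ^ (4 * k) = M j ^ k := by
    rw [pow_mul, show (4 : ℕ) = 2 * 2 from rfl, pow_mul, Real.sq_sqrt (Real.sqrt_nonneg _),
      Real.sq_sqrt hM0.le]
  simp only [Function.comp_apply, hpow] at hj
  have hlp : 0 < Real.log (M j) ^ c := Real.rpow_pos_of_pos (Real.log_pos hM1) _
  have hle : √(√(M j)) ≤ √(M j / Real.log (M j) ^ c) := by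
    refine Real.sqrt_le_sqrt ?_
    rw [le_div_iff₀ hlp]
    calc √(M j) * Real.log (M j) ^ c ≤ √(M j) * √(M j) := by gcongr
      _ = M j := Real.mul_self_sqrt hM0.le
  have hk : 0 < M j ^ k := pow_pos hM0 k
  rw [one_mul, Real.norm_of_nonneg (Real.exp_pos _).le, Real.norm_of_nonneg (inv_nonneg.2 hk.le),
    le_inv_comm₀ (Real.exp_pos _) hk, ← one_div, le_div_iff₀ (Real.exp_pos _)]
  refine le_trans ?_ hj
  gcongr

/-! ### The growth of the lengths -/

/-- The implied constant is absorbed by one more power of the logarithm. -/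
theorem SoftO.eventually_le {L : ℕ → ℝ} (hL : Tendsto L atTop atTop)
    (h : SoftO (fun r => L (r + 1)) L) : ∃ k : ℝ, 0 ≤ k ∧
      ∀ᶠ r in atTop, L (r + 1) ≤ L r * Real.log (L r) ^ k := by
  obtain ⟨k, hk, hO⟩ := h
  obtain ⟨C, hC⟩ := hO.bound
  refine ⟨k + 1, by linarith, ?_⟩
  filter_upwards [hC, hL.eventually_gt_atTop 1,
    (Real.tendsto_log_atTop.comp hL).eventually_ge_atTop (max 1 C)] with r h1 h2 h3
  simp only [Function.comp_apply, max_le_iff] at h3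
  have hp : 0 < Real.log (L r) ^ k := Real.rpow_pos_of_pos (by linarith) _
  rw [Lam, Real.rpow_one, Real.norm_of_nonneg (mul_nonneg (by linarith) hp.le)] at h1
  refine (le_abs_self _).trans (h1.trans ?_)
  rw [Real.rpow_add (by linarith), Real.rpow_one]
  calc C * (L r * Real.log (L r) ^ k) ≤ Real.log (L r) * (L r * Real.log (L r) ^ k) := by
        gcongr; exact h3.2
    _ = _ := by ring

theorem two_mul_rpow_le {x k : ℝ} (hx : 2 ≤ x) (hk : 0 ≤ k) : (2 * x) ^ k ≤ x ^ (2 * k) := by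
  rw [Real.rpow_mul (by linarith)]
  refine Real.rpow_le_rpow (by linarith) ?_ hk
  rw [Real.rpow_two]; nlinarith

theorem eventually_growth_le {L : ℕ → ℝ} (hL : Tendsto L atTop atTop) {k : ℝ} (hk : 0 ≤ k)
    (h : ∀ᶠ r in atTop, L (r + 1) ≤ L r * Real.log (L r) ^ k) (i : ℕ) : ∃ k' : ℝ, 0 ≤ k' ∧
      ∀ᶠ r in atTop, L (r + i) ≤ L r * Real.log (L r) ^ k' := by
  induction i with
  | zero => exact ⟨0, le_rfl, Eventually.of_forall fun r => by simp⟩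
  | succ i ih =>
    obtain ⟨k', hk', hi⟩ := ih
    refine ⟨k' + 2 * k, by positivity, ?_⟩
    have hsh := tendsto_add_atTop_nat i
    filter_upwards [hi, hsh.eventually h, hL.eventually_gt_atTop 1,
      (hL.comp hsh).eventually_gt_atTop 1, hL.eventually (eventually_log_rpow_le k'),
      (Real.tendsto_log_atTop.comp hL).eventually_ge_atTop 2] with r h1 h2 h3 h4 h5 h6
    simp only [Function.comp_apply] at h4 h6
    have hlog : Real.log (L (r + i)) ≤ 2 * Real.log (L r) := by
      have : L (r + i) ≤ L r * L r := h1.trans (by gcongr)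
      calc Real.log (L (r + i)) ≤ Real.log (L r * L r) := Real.log_le_log (by linarith) this
        _ = _ := by rw [Real.log_mul (by linarith) (by linarith)]; ring
    have hl0 : 0 ≤ Real.log (L (r + i)) := Real.log_nonneg h4.le
    calc L (r + (i + 1)) ≤ L (r + i) * Real.log (L (r + i)) ^ k := h2
      _ ≤ (L r * Real.log (L r) ^ k') * (2 * Real.log (L r)) ^ k := by gcongr
      _ ≤ (L r * Real.log (L r) ^ k') * Real.log (L r) ^ (2 * k) := by
          gcongr
          exact two_mul_rpow_le h6 hk
      _ = _ := by rw [mul_assoc, ← Real.rpow_add (by linarith)]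

/-- Each rank gains a factor `log^c`, so `i` ranks gain `log^{c i}`. This is what makes a
progression of ranks with a large difference separate consecutive levels by any prescribed power of
the logarithm. -/
theorem eventually_le_growth {L : ℕ → ℝ} (hL : Tendsto L atTop atTop) {c : ℝ} (hc : 0 < c)
    (h : ∀ᶠ r in atTop, L r < L (r + 1) / Real.log (L (r + 1)) ^ c) (i : ℕ) :
      ∀ᶠ r in atTop, L r * Real.log (L r) ^ (c * i) ≤ L (r + i) := by
  induction i with
  | zero => exact Eventually.of_forall fun r => by simp
  | succ i ih =>
    have hsh := tendsto_add_atTop_nat i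
    have hsh1 := tendsto_add_atTop_nat (i + 1)
    have hE := (Real.tendsto_log_atTop.comp hL).eventually_ge_atTop 1
    filter_upwards [ih, hsh.eventually h, hL.eventually_gt_atTop 1,
      (hL.comp hsh).eventually_gt_atTop 1, (hL.comp hsh1).eventually_gt_atTop 1, hE,
      hsh1.eventually hE] with r h1 h2 h3 h4 h4' h5 h6
    simp only [Function.comp_apply] at h4 h4' h5 h6
    rw [add_assoc] at h2
    have hp : 1 ≤ Real.log (L (r + (i + 1))) ^ c := Real.one_le_rpow h6 hc.le
    rw [lt_div_iff₀ (by linarith)] at h2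
    have h7 : L (r + i) ≤ L (r + (i + 1)) := by nlinarith
    have h8 : L r ≤ L (r + i) :=
      le_trans (le_mul_of_one_le_right (by linarith) (Real.one_le_rpow h5 (by positivity))) h1
    have h9 : Real.log (L r) ≤ Real.log (L (r + (i + 1))) :=
      Real.log_le_log (by linarith) (h8.trans h7)
    calc L r * Real.log (L r) ^ (c * (i + 1 : ℕ)) =
        (L r * Real.log (L r) ^ (c * i)) * Real.log (L r) ^ c := by
          rw [mul_assoc, ← Real.rpow_add (by linarith)]; congr 2; push_cast; ring
      _ ≤ L (r + i) * Real.log (L (r + (i + 1))) ^ c := by gcongr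
      _ ≤ _ := h2.le

/-- The numerical inequality behind the choice of the levels. -/
theorem heavy_numeric {ε K c q l L' s : ℝ} {Kn k : ℕ} (hK : K ≤ Kn) (hc : 0 < c) (hl1 : 1 < l)
    (hx2 : 2 ≤ Real.log l) (hxε : 2 ≤ ε * Real.log l) (hlow : l * Real.log l ^ q ≤ L')
    (hup : L' ≤ l * l) (hq : 2 * c + 2 * ((2 * k + 2 * Kn + 1 : ℕ) : ℝ) ≤ q)
    (hs1 : L' / Real.log L' ^ c ≤ s) (hs2 : s ≤ L') :
    l ≤ s ∧ Lam K (1 / 2) s + √(L' / Real.log L' ^ c) ≤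
      s * (ε / (√l * Real.log (l + 3) ^ k)) := by
  set x := Real.log l with hx
  -- The exponent `2 Kn` covers `log^K s`, the exponent `2 k` covers `log^k (l + 3)`, since both
  -- logarithms are at most `x ^ 2`; the last factor `x` absorbs the constant `2 / ε`.
  set m : ℕ := 2 * k + 2 * Kn + 1 with hm
  have hx0 : 0 < x := by linarith
  have hl0 : 0 < l := by linarith
  have hq0 : 0 ≤ q := le_trans (by positivity) hq
  have hε : 0 < ε := by
    by_contra h
    have := mul_nonpos_of_nonpos_of_nonneg (not_lt.1 h) hx0.le
    linarith
  have hlL : l ≤ L' := le_trans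
    (le_mul_of_one_le_right hl0.le (Real.one_le_rpow (by linarith) hq0)) hlow
  have hy1 : x ≤ Real.log L' := Real.log_le_log hl0 hlL
  have hy2 : Real.log L' ≤ 2 * x := by
    calc Real.log L' ≤ Real.log (l * l) := Real.log_le_log (by linarith) hup
      _ = 2 * x := by rw [Real.log_mul hl0.ne' hl0.ne']; ring
  have hu : l * (x ^ m) ^ 2 ≤ L' / Real.log L' ^ c := by
    rw [le_div_iff₀ (Real.rpow_pos_of_pos (by linarith) _)]
    calc l * (x ^ m) ^ 2 * Real.log L' ^ c ≤ l * (x ^ m) ^ 2 * x ^ (2 * c) := by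
          gcongr
          exact (Real.rpow_le_rpow (by linarith) hy2 hc.le).trans (two_mul_rpow_le hx2 hc.le)
      _ = l * x ^ (2 * (m : ℝ) + 2 * c) := by
          rw [Real.rpow_add hx0, mul_comm 2 (m : ℝ), ← mul_assoc, Real.rpow_mul hx0.le (m : ℝ),
            Real.rpow_natCast, Real.rpow_two]
      _ ≤ l * x ^ q := by
          gcongr
          · linarith
          · linarith
      _ ≤ L' := hlow
  have hxm : 1 ≤ x ^ m := one_le_pow₀ (by linarith)
  have hls : l ≤ s := le_trans (le_mul_of_one_le_right hl0.le (one_le_pow₀ hxm)) (hu.trans hs1)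
  refine ⟨hls, ?_⟩
  have hs0 : 0 < s := by linarith
  have hsq : √l * x ^ m ≤ √s := by
    refine Real.le_sqrt_of_sq_le ?_
    rw [mul_pow, Real.sq_sqrt hl0.le]
    exact hu.trans hs1
  have hlog1 : x ≤ Real.log s := Real.log_le_log hl0 hls
  have hlog2 : Real.log s ≤ x ^ 2 :=
    (Real.log_le_log hs0 hs2).trans (hy2.trans (by nlinarith))
  have hLam : Lam K (1 / 2) s ≤ √s * (x ^ 2) ^ Kn := by
    rw [lam_half]
    gcongr
    calc Real.log s ^ K ≤ Real.log s ^ (Kn : ℝ) :=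
          Real.rpow_le_rpow_of_exponent_le (by linarith) hK
      _ = Real.log s ^ Kn := Real.rpow_natCast _ _
      _ ≤ (x ^ 2) ^ Kn := pow_le_pow_left₀ (by linarith) hlog2 _
  have hθ : √(L' / Real.log L' ^ c) ≤ √s * (x ^ 2) ^ Kn :=
    (Real.sqrt_le_sqrt hs1).trans (le_mul_of_one_le_right (Real.sqrt_nonneg _)
      (one_le_pow₀ (by nlinarith)))
  have hl3 : Real.log (l + 3) ≤ x ^ 2 := by
    have h3 : x + 1 ≤ l := by
      have := Real.add_one_le_exp x
      rwa [hx, Real.exp_log hl0] at this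
    calc Real.log (l + 3) ≤ Real.log (l * l) := Real.log_le_log (by linarith) (by nlinarith)
      _ = 2 * x := by rw [Real.log_mul hl0.ne' hl0.ne']; ring
      _ ≤ x ^ 2 := by nlinarith
  have hl30 : 0 < Real.log (l + 3) := Real.log_pos (by linarith)
  have hsl : 0 < √l := Real.sqrt_pos.2 hl0
  calc Lam K (1 / 2) s + √(L' / Real.log L' ^ c) ≤ √s * (x ^ 2) ^ Kn * 2 := by linarith
    _ ≤ √s * (x ^ 2) ^ Kn * (ε * x) := by gcongr
    _ = √s * (√l * x ^ m) * (ε / (√l * (x ^ 2) ^ k)) := by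
        rw [hm]; field_simp; ring
    _ ≤ √s * √s * (ε / (√l * Real.log (l + 3) ^ k)) := by gcongr
    _ = _ := by rw [Real.mul_self_sqrt hs0.le]

end
end KSCoding

open MeasureTheory Filter Asymptotics
open scoped ENNReal
namespace KSCoding
noncomputable section

set_option linter.unusedSectionVars false

/-! ### The rate of coding -/

variable {A B : Type*} [Fintype A] [DecidableEq A] [MeasurableSpace A]
  [MeasurableSingletonClass A] [Fintype B] [DecidableEq B] [MeasurableSpace B]
  [MeasurableSingletonClass B] {ρ : Measure (ℤ → Bool)} {ξ : (ℤ → Bool) → ℤ → ℕ} {τ : ℕ → ℕ}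
  {R : ℕ → ℕ} {μ : Measure (ℤ → A)} [IsProbabilityMeasure μ] {a : A}
  {ν : Measure (ℤ → B)} [IsProbabilityMeasure ν] {b : B}
  {cd2 : Skel → (ℕ → B) → ℕ} {D : ChainData Skel} {p : ℕ → Prop} {L : ℕ → ℝ} {stp : ℕ}

/-- Arithmetic progressions of ranks. -/
theorem tendsto_ranks (hstp : 0 < stp) : Tendsto (fun j => stp * j + 1) atTop atTop :=
  tendsto_atTop_mono (fun j => (Nat.le_mul_of_pos_left j hstp).trans (Nat.le_succ _)) tendsto_id

theorem eventually_le_sq (hL : Tendsto L atTop atTop) (h : SoftO (fun r => L (r + 1)) L) (i : ℕ) :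
    ∀ᶠ r in atTop, L (r + i) ≤ L r * L r := by
  obtain ⟨k, hk, h1⟩ := SoftO.eventually_le hL h
  obtain ⟨k', -, h2⟩ := eventually_growth_le hL hk h1 i
  filter_upwards [h2, hL.eventually (eventually_log_rpow_le k'), hL.eventually_ge_atTop 0]
    with r h3 h4 h5
  exact h3.trans (by gcongr)

theorem tendsto_div_log (hL : Tendsto L atTop atTop) (c : ℝ) :
    Tendsto (fun r => L r / Real.log (L r) ^ c) atTop atTop := by
  have h0 : Tendsto (fun x : ℝ => Real.log x) atTop atTop := Real.tendsto_log_atTop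
  refine Tendsto.comp (g := fun x : ℝ => x / Real.log x ^ c) ?_ hL
  refine tendsto_atTop_mono' _ ?_ h0
  filter_upwards [eventually_log_rpow_le (c + 1), h0.eventually_gt_atTop 0] with x h1 h2
  rw [Real.rpow_add h2, Real.rpow_one] at h1
  rwa [le_div_iff₀ (Real.rpow_pos_of_pos h2 _), mul_comm]

/-- The data about the lengths and the information of the covering skeletons. -/
structure Rate (μ : Measure (ℤ → A)) (a : A) (ξ : (ℤ → Bool) → ℤ → ℕ) (τ : ℕ → ℕ)
    (rel : (S : Skel) → Setoid (Filler a S)) (L : ℕ → ℝ) (h K c : ℝ) : Prop where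
  tendsto : Tendsto L atTop atTop
  soft : SoftO (fun r => L (r + 1)) L
  cpos : 0 < c
  growth : ∀ᶠ r in atTop, L r < L (r + 1) / Real.log (L (r + 1)) ^ c
  sizes : SuperPoly (fun r => μ.real {x | BadSize a ξ r (L r / Real.log (L r) ^ c) (L r) x}) L
  low : SuperPoly (fun r => μ.real {x | ¬ LowInfo μ a ξ τ rel h K r x}) L

/-- Here `θ` is the square root of the least typical length, so `exp(-θ)` decays fast enough. The
bad sizes of the lower level are multiplied by the number of positions in a skeleton of the upper
one. This is harmless, since the upper length is at most the square of the lower one. The term with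
`N` is needed to pass from codes back to classes. -/
theorem Link.exists_split_rate {rel : (S : Skel) → Setoid (Filler a S)} {N : ℕ}
    (H : Link ρ ξ τ (fun j => stp * j + 1) μ a (code rel N) ν b cd2 D p) {h c0 ε K c : ℝ}
    {k Kn : ℕ} (C : Cnt ρ ξ τ (fun j => stp * j + 1) D h (gau ε k) c0 N) (hε : 0 < ε)
    (hstp : 0 < stp) (Q : Rate μ a ξ τ rel L h K c) (hK : K ≤ Kn)
    (hq : 2 * c + 2 * ((2 * k + 2 * Kn + 1 : ℕ) : ℝ) ≤ c * stp) :
    ∃ f : ℕ → ℝ, SuperPoly f (fun j => L (stp * (j + 1) + 1)) ∧ ∀ᶠ j in atTop, p (j + 1) →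
      μ.real (splitEv ξ τ (fun j => stp * j + 1) a (code rel N) D (j + 1)) +
        μ.real {x | ∃ s, At ξ τ (stp * j + 1) s (hat a x) ∧ Cov s 0 ∧ s.2.len < N} ≤ f j := by
  have hL := Q.tendsto
  have hR := tendsto_ranks hstp
  have hR1 : Tendsto (fun j => stp * (j + 1) + 1) atTop atTop := hR.comp (tendsto_add_atTop_nat 1)
  have hstep : ∀ j, stp * (j + 1) + 1 = stp * j + 1 + stp := fun j => by ring
  set M : ℕ → ℝ := fun j => L (stp * (j + 1) + 1) with hM
  have hMt : Tendsto M atTop atTop := hL.comp hR1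
  set bad : ℕ → ℝ := fun r => μ.real {x | BadSize a ξ r (L r / Real.log (L r) ^ c) (L r) x}
    with hbad
  set low : ℕ → ℝ := fun r => μ.real {x | ¬ LowInfo μ a ξ τ rel h K r x} with hlow
  have hsq : ∀ᶠ j in atTop, M j ≤ L (stp * j + 1) * L (stp * j + 1) := by
    filter_upwards [hR.eventually (eventually_le_sq hL Q.soft stp)] with j hj
    simp only [hM, hstep]; exact hj
  have hbadj : SuperPoly (fun j => bad (stp * j + 1)) M := by
    refine (SuperPoly.comp Q.sizes hR).change_base (hMt.eventually_gt_atTop 0) ?_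
    filter_upwards [hsq] with j hj
    rw [sq]; exact hj
  have hg : (fun j => ((2 * ⌈M j⌉₊ + 1 : ℕ) : ℝ)) =O[atTop] M := by
    refine IsBigO.of_bound 5 ?_
    filter_upwards [hMt.eventually_ge_atTop 1] with j hj
    rw [Real.norm_of_nonneg (Nat.cast_nonneg _), Real.norm_of_nonneg (by linarith)]
    have := (Nat.ceil_lt_add_one (show 0 ≤ M j by linarith)).le
    push_cast
    linarith
  refine ⟨fun j => (Real.exp (-√(M j / Real.log (M j) ^ c)) + low (stp * (j + 1) + 1) +
    (bad (stp * (j + 1) + 1) + ((2 * ⌈M j⌉₊ + 1 : ℕ) : ℝ) * bad (stp * j + 1))) +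
      bad (stp * j + 1), ?_, ?_⟩
  · exact (((superPoly_exp hMt c).add (Q.low.comp hR1)).add
      ((Q.sizes.comp hR1).add (hbadj.mul_base hMt hg))).add hbadj
  have hLR := hL.comp hR
  have hlogR := Real.tendsto_log_atTop.comp hLR
  filter_upwards [hsq, hR.eventually (eventually_le_growth hL Q.cpos Q.growth stp),
    hLR.eventually_gt_atTop 1, hlogR.eventually_ge_atTop 2, hlogR.eventually_ge_atTop (2 / ε),
    hLR.eventually_ge_atTop (N : ℝ), hR.eventually ((tendsto_div_log hL c).eventually_ge_atTop
      (N : ℝ))] with j h1 h2 h3 h4 h5 h6 h7 hp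
  simp only [Function.comp_apply] at h3 h4 h5 h6
  rw [div_le_iff₀' hε] at h5
  rw [← hstep] at h2
  have hnum : ∀ s : ℕ, M j / Real.log (M j) ^ c ≤ s → (s : ℝ) ≤ M j → N ≤ s ∧
      Lam K (1 / 2) s + √(M j / Real.log (M j) ^ c) ≤
        s * (ε / (√(L (stp * j + 1)) * Real.log (L (stp * j + 1) + 3) ^ k)) := by
    intro s hs1 hs2
    obtain ⟨k1, k2⟩ := heavy_numeric hK Q.cpos h3 h4 h5 h2 h1 hq hs1 hs2
    exact ⟨by exact_mod_cast h6.trans k1, k2⟩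
  have hs := H.split_le C hp K (√(M j / Real.log (M j) ^ c))
  have hh := H.sx.measure_not_heavy_le (j := j) (u' := L (stp * j + 1) /
    Real.log (L (stp * j + 1)) ^ c) hε.le hnum
  have hb : μ {x | ∃ s, At ξ τ (stp * j + 1) s (hat a x) ∧ Cov s 0 ∧ s.2.len < N} ≤
      μ {x | BadSize a ξ (stp * j + 1) (L (stp * j + 1) / Real.log (L (stp * j + 1)) ^ c)
        (L (stp * j + 1)) x} := by
    refine measure_mono ?_
    rintro x ⟨s, s1, s2, s3⟩
    refine (s1.badSize_iff s2 _ _).2 fun hc => ?_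
    have : (N : ℝ) ≤ s.2.len := h7.trans hc.1
    exact absurd (by exact_mod_cast this) (not_le.2 s3)
  have ht := hs.trans (add_le_add le_rfl hh)
  have e1 : μ.real (splitEv ξ τ (fun j => stp * j + 1) a (code rel N) D (j + 1)) ≤
      Real.exp (-√(M j / Real.log (M j) ^ c)) + low (stp * (j + 1) + 1) +
    (bad (stp * (j + 1) + 1) + ((2 * ⌈M j⌉₊ + 1 : ℕ) : ℝ) * bad (stp * j + 1)) := by
    have hfin : ∀ S : Set (ℤ → A), μ S ≠ ⊤ := fun S => measure_ne_top μ S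
    have hmul : (((2 * ⌈M j⌉₊ + 1 : ℕ) : ℝ≥0∞) * μ {x | BadSize a ξ (stp * j + 1)
        (L (stp * j + 1) / Real.log (L (stp * j + 1)) ^ c) (L (stp * j + 1)) x}) ≠ ⊤ :=
      ENNReal.mul_ne_top (ENNReal.natCast_ne_top _) (hfin _)
    have h8 := ENNReal.toReal_mono (ENNReal.add_ne_top.2 ⟨ENNReal.add_ne_top.2
      ⟨ENNReal.ofReal_ne_top, hfin _⟩, ENNReal.add_ne_top.2 ⟨hfin _, hmul⟩⟩) ht
    rw [ENNReal.toReal_add (ENNReal.add_ne_top.2 ⟨ENNReal.ofReal_ne_top, hfin _⟩)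
      (ENNReal.add_ne_top.2 ⟨hfin _, hmul⟩), ENNReal.toReal_add ENNReal.ofReal_ne_top (hfin _),
      ENNReal.toReal_add (hfin _) hmul, ENNReal.toReal_mul, ENNReal.toReal_natCast,
      ENNReal.toReal_ofReal (Real.exp_pos _).le] at h8
    exact h8
  have e2 := ENNReal.toReal_mono (measure_ne_top μ _) hb
  exact add_le_add e1 e2

theorem Link.exists_determines_rate {relA : (S : Skel) → Setoid (Filler a S)}
    {relB : (S : Skel) → Setoid (Filler b S)} {N : ℕ}
    (H : Link ρ ξ τ R μ a (code relA N) ν b (code relB N) D p)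
    (G : Good ξ τ R μ a (code relA N) ν b (code relB N) D p) {j : ℕ} (hj : p (j + 1)) :
    μ.real {x | ¬ Determines μ (classAt a ξ τ relA (R (j + 1))) (fun x' =>
      classAt b ξ τ relB (R j) (phi ξ τ R a (code relA N) ν b (code relB N) D p x')) x} ≤
      μ.real (splitEv ξ τ R a (code relA N) D (j + 1)) +
        μ.real {x | ∃ s, At ξ τ (R j) s (hat a x) ∧ Cov s 0 ∧ s.2.len < N} := by
  have h1 := H.measure_not_determines_le G hj (classAt a ξ τ relA (R (j + 1)))
    (classAt b ξ τ relB (R j)) N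
    (fun x x' _ hx' he s hs h0 => ⟨hs.of_classAt_eq hx' h0 he,
      hs.code_eq_of_classAt_eq (hs.of_classAt_eq hx' h0 he) h0 he N⟩)
    (fun y y' s hs hs' h0 hN he => hs.classAt_eq_of_code_eq hs' h0 hN he)
  have h2 := ENNReal.toReal_mono (ENNReal.add_ne_top.2 ⟨measure_ne_top _ _, measure_ne_top _ _⟩) h1
  rwa [ENNReal.toReal_add (measure_ne_top _ _) (measure_ne_top _ _)] at h2

/-- Ranks adapted to a given length. -/
theorem exists_ranks (hL : Tendsto L atTop atTop) (hsoft : SoftO (fun r => L (r + 1)) L) {c : ℝ}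
    (hc : 0 < c) (hlow : ∀ᶠ r in atTop, L r < L (r + 1) / Real.log (L (r + 1)) ^ c)
    (hstp : 0 < stp) (hp : ∀ j, p (j + 1) ↔ ¬ p j) :
    ∃ t : ℕ → ℕ, Tendsto t atTop atTop ∧ (∀ n, p (t n + 1)) ∧
      (∀ᶠ n : ℕ in atTop, (n : ℝ) ≤ L (stp * (t n + 1) + 1)) ∧
      SoftTheta (fun n => L (stp * (t n + 1) + 1)) (fun n => (n : ℝ)) ∧
      SoftTheta (fun n => L (stp * t n + 1)) (fun n => (n : ℝ)) := by
  classical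
  have hR := tendsto_ranks hstp
  have hex : ∀ n : ℕ, ∃ j, p (j + 1) ∧ (n : ℝ) < L (stp * j + 1) := by
    intro n
    obtain ⟨J, hJ⟩ := ((hL.comp hR).eventually_gt_atTop (n : ℝ)).exists_forall_of_atTop
    by_cases h : p (J + 1)
    · exact ⟨J, h, hJ J le_rfl⟩
    · exact ⟨J + 1, (hp _).2 h, hJ _ (Nat.le_succ _)⟩
  -- The first level of the right parity whose length exceeds `n`.
  set t : ℕ → ℕ := fun n => Nat.find (hex n) with ht
  have ht1 : ∀ n, p (t n + 1) := fun n => (Nat.find_spec (hex n)).1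
  have ht2 : ∀ n : ℕ, (n : ℝ) < L (stp * t n + 1) := fun n => (Nat.find_spec (hex n)).2
  have ht3 : ∀ n j, p (j + 1) → j < t n → L (stp * j + 1) ≤ n := fun n j h1 h2 => by
    have := Nat.find_min (hex n) h2
    rw [not_and, not_lt] at this
    exact this h1
  have htt : Tendsto t atTop atTop := by
    refine tendsto_atTop.2 fun J => ?_
    have : ∀ᶠ n : ℕ in atTop, ∀ i ∈ Finset.range J, L (stp * i + 1) ≤ n :=
      (Finset.eventually_all _).2 fun i _ =>
        tendsto_natCast_atTop_atTop.eventually_ge_atTop _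
    filter_upwards [this] with n hn
    by_contra h
    exact absurd (ht2 n) (not_lt.2 (hn _ (Finset.mem_range.2 (not_le.1 h))))
  have hup : ∀ᶠ n : ℕ in atTop, (n : ℝ) ≤ L (stp * (t n + 1) + 1) := by
    filter_upwards [htt.eventually (hR.eventually (eventually_le_growth hL hc hlow stp)),
      htt.eventually ((hL.comp hR).eventually_ge_atTop 0), htt.eventually
      ((Real.tendsto_log_atTop.comp (hL.comp hR)).eventually_ge_atTop 1)] with n h1 h2 h3
    simp only [Function.comp_apply] at h2 h3
    have h4 : stp * (t n + 1) + 1 = stp * t n + 1 + stp := by ring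
    rw [h4]
    exact (ht2 n).le.trans ((le_mul_of_one_le_right h2
      (Real.one_le_rpow h3 (by positivity))).trans h1)
  have htheta : ∀ i, (∀ᶠ n : ℕ in atTop, (n : ℝ) ≤ L (stp * (t n + i) + 1)) →
      SoftTheta (fun n => L (stp * (t n + i) + 1)) (fun n => (n : ℝ)) := by
    intro i hi
    refine ⟨?_, 0, 1, one_pos, ?_⟩
    · obtain ⟨k, hk, h1⟩ := SoftO.eventually_le hL hsoft
      obtain ⟨k', hk', h2⟩ := eventually_growth_le hL hk h1 (stp * (i + 2))
      refine ⟨k' + 1, by linarith, IsBigO.of_bound 1 ?_⟩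
      have hs2 : Tendsto (fun n => t n - 2) atTop atTop :=
        (tendsto_sub_atTop_nat 2).comp htt
      have hcast : Tendsto (fun n : ℕ => (n : ℝ)) atTop atTop := tendsto_natCast_atTop_atTop
      filter_upwards [hs2.eventually (hR.eventually h2), hs2.eventually
        ((hL.comp hR).eventually_ge_atTop 1), htt.eventually_ge_atTop 2, hi,
        (Real.tendsto_log_atTop.comp hcast).eventually_ge_atTop 1] with n h3 h4 h5 h6 h7
      simp only [Function.comp_apply] at h4 h7
      -- Two levels below, the parity is again right, so minimality bounds the length there by `n`.
      -- A bounded number of ranks then costs only a power of the logarithm.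
      obtain ⟨m, hm⟩ : ∃ m, t n = m + 2 := ⟨t n - 2, by omega⟩
      have h8 : L (stp * m + 1) ≤ n := by
        refine ht3 n m ?_ (by omega)
        have := ht1 n
        rw [hm, hp, hp, not_not] at this
        exact this
      rw [hm, Nat.add_sub_cancel] at h3 h4
      have e : stp * (t n + i) + 1 = stp * m + 1 + stp * (i + 2) := by rw [hm]; ring
      rw [e] at h6 ⊢
      have hn0 : (0 : ℝ) ≤ n := Nat.cast_nonneg n
      have hl0 : 0 ≤ Real.log (L (stp * m + 1)) := Real.log_nonneg h4
      rw [Real.norm_of_nonneg (hn0.trans h6), one_mul]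
      refine le_trans ?_ (le_abs_self _)
      rw [Lam, Real.rpow_one]
      calc _ ≤ _ := h3
        _ ≤ (n : ℝ) * Real.log n ^ k' := by
            gcongr
        _ ≤ _ := by
            gcongr
            linarith
    · filter_upwards [hi] with n hn
      rw [Lam, Real.rpow_zero, Real.rpow_one, mul_one, one_mul, abs_of_nonneg (Nat.cast_nonneg n)]
      exact hn
  refine ⟨t, htt, ht1, hup, htheta 1 hup, ?_⟩
  exact htheta 0 (Eventually.of_forall fun n => (ht2 n).le)

end
end KSCoding

open MeasureTheory Filter Asymptotics
open scoped ENNReal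
namespace KSCoding
noncomputable section

set_option linter.unusedSectionVars false

/-! ### The isomorphism and its rate -/

variable {A B : Type*} [Fintype A] [DecidableEq A] [MeasurableSpace A]
  [MeasurableSingletonClass A] [Fintype B] [DecidableEq B] [MeasurableSpace B]
  [MeasurableSingletonClass B] {ρ : Measure (ℤ → Bool)} {ξ : (ℤ → Bool) → ℤ → ℕ} {τ : ℕ → ℕ}
  {R : ℕ → ℕ} {μ : Measure (ℤ → A)} [IsProbabilityMeasure μ] {a : A}
  {ν : Measure (ℤ → B)} [IsProbabilityMeasure ν] {b : B}
  {D : ChainData Skel} {p : ℕ → Prop} {L : ℕ → ℝ} {stp : ℕ}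

theorem Link.good {𝒜 : SOF μ a ξ τ} {ℬ : SOF ν b ξ τ} {N : ℕ}
    (H : Link ρ ξ τ (fun j => stp * j + 1) μ a (code 𝒜.rel N) ν b (code ℬ.rel N) D p)
    (hstp : 0 < stp) (hL : Tendsto L atTop atTop) {f : ℕ → ℝ}
    (hf : SuperPoly f fun j => L (stp * (j + 1) + 1))
    (hle : ∀ᶠ j in atTop, p (j + 1) →
      μ.real (splitEv ξ τ (fun j => stp * j + 1) a (code 𝒜.rel N) D (j + 1)) ≤ f j) :
    Good ξ τ (fun j => stp * j + 1) μ a (code 𝒜.rel N) ν b (code ℬ.rel N) D p where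
  tendsto := tendsto_ranks hstp
  split ε hε := by
    have h0 : Tendsto (fun j => ENNReal.ofReal (f j)) atTop (nhds 0) := by
      rw [← ENNReal.ofReal_zero]
      exact ENNReal.tendsto_ofReal (hf.tendsto_zero (hL.comp
        ((tendsto_ranks hstp).comp (tendsto_add_atTop_nat 1))))
    obtain ⟨J, hJ⟩ := ((h0.eventually_le_const (pos_iff_ne_zero.2 hε)).and
      hle).exists_forall_of_atTop
    refine ⟨J + 1, fun j hj hp => ?_⟩
    obtain ⟨i, rfl⟩ : ∃ i, j = i + 1 := ⟨j - 1, by omega⟩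
    obtain ⟨h1, h2⟩ := hJ i (by omega)
    refine le_trans ?_ h1
    rw [← ENNReal.ofReal_toReal (measure_ne_top μ (splitEv ξ τ _ a (code 𝒜.rel N) D (i + 1)))]
    exact ENNReal.ofReal_le_ofReal (h2 hp)
  det ε hε := H.sy.detP_le ℬ (tendsto_ranks hstp) ε hε

theorem Link.superPoly_determines {relA : (S : Skel) → Setoid (Filler a S)}
    {relB : (S : Skel) → Setoid (Filler b S)} {N : ℕ}
    (H : Link ρ ξ τ (fun j => stp * j + 1) μ a (code relA N) ν b (code relB N) D p)
    (G : Good ξ τ (fun j => stp * j + 1) μ a (code relA N) ν b (code relB N) D p) {f : ℕ → ℝ}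
    (hf : SuperPoly f fun j => L (stp * (j + 1) + 1))
    (hle : ∀ᶠ j in atTop, p (j + 1) →
      μ.real (splitEv ξ τ (fun j => stp * j + 1) a (code relA N) D (j + 1)) +
        μ.real {x | ∃ s, At ξ τ (stp * j + 1) s (hat a x) ∧ Cov s 0 ∧ s.2.len < N} ≤ f j)
    {t : ℕ → ℕ} (ht : Tendsto t atTop atTop) (htp : ∀ n, p (t n + 1))
    (htL : ∀ᶠ n : ℕ in atTop, (n : ℝ) ≤ L (stp * (t n + 1) + 1)) :
    SuperPoly (fun n => μ.real {x | ¬ Determines μ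
      (classAt a ξ τ relA (stp * (t n + 1) + 1)) (fun x' => classAt b ξ τ relB (stp * t n + 1)
        (phi ξ τ (fun j => stp * j + 1) a (code relA N) ν b (code relB N) D p x')) x})
      (fun n => (n : ℝ)) := by
  have h1 : SuperPoly (fun n => f (t n)) fun n => (n : ℝ) := by
    refine SuperPoly.change_base (M := fun n => L (stp * (t n + 1) + 1)) (hf.comp ht) ?_ ?_
    · exact (tendsto_natCast_atTop_atTop (R := ℝ)).eventually_gt_atTop 0
    · filter_upwards [htL, (tendsto_natCast_atTop_atTop (R := ℝ)).eventually_ge_atTop 1]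
        with n h1 h2
      nlinarith
  refine h1.mono (Eventually.of_forall fun n => measureReal_nonneg) ?_
  filter_upwards [ht.eventually hle] with n hn
  exact (H.exists_determines_rate G (htp n)).trans (hn (htp n))

/-- The chain of laws that alternates between the two processes. -/
def altChain (τ : ℕ → ℕ) (R : ℕ → ℕ) (μ : Measure (ℤ → A))
    [IsProbabilityMeasure μ] (a : A) (cd1 : Skel → (ℕ → A) → ℕ) (ν : Measure (ℤ → B))
    [IsProbabilityMeasure ν] (b : B) (cd2 : Skel → (ℕ → B) → ℕ) : ChainData Skel where
  pi j S := if Even j then lawF μ a S (cd1 S) else lawF ν b S (cd2 S)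
  rf j := if Even j then rfS a τ R cd1 j else rfS b τ R cd2 j
  ch := chS τ R

theorem link_altChain {cd1 : Skel → (ℕ → A) → ℕ} {cd2 : Skel → (ℕ → B) → ℕ}
    (hx : Side ρ ξ τ R μ a cd1) (hy : Side ρ ξ τ R ν b cd2) :
    Link ρ ξ τ R μ a cd1 ν b cd2 (altChain τ R μ a cd1 ν b cd2) Even where
  sx := hx
  sy := hy
  alt _ := Nat.even_add_one
  ch := rfl
  pix _ hj _ := if_pos hj
  piy _ hj _ := if_neg hj
  rfx _ hj := if_pos hj
  rfy _ hj := if_neg hj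

end
end KSCoding

/-! ### Choice of the constants and conclusion. -/

theorem mainTheorem4 {A B : Type*}
    [Fintype A] [DecidableEq A] [MeasurableSpace A] [MeasurableSingletonClass A]
    [Fintype B] [DecidableEq B] [MeasurableSpace B] [MeasurableSingletonClass B]
    (μ : Measure (ℤ → A)) [IsProbabilityMeasure μ]
    (ν : Measure (ℤ → B)) [IsProbabilityMeasure ν]
    (a : A) (b : B) (hX : IsMarkedProcess μ a) (hY : IsMarkedProcess ν b)
    (hent : entropyRate μ = entropyRate ν)
    (hdist : μ.map (hat a) = ν.map (hat b))
    (ξ : (ℤ → Bool) → ℤ → ℕ) (hξ : IsMarkerFactor (μ.map (hat a)) ξ)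
    (L : ℕ → ℝ) (hLX : IsNice μ a ξ L) (hLY : IsNice ν b ξ L)
    (τ : ℕ → ℕ) (𝒜 : SOF μ a ξ τ) (ℬ : SOF ν b ξ τ)
    (h𝒜 : 𝒜.IsGood L) (hℬ : ℬ.IsGood L) :
    ∃ (φ : (ℤ → A) → ℤ → B) (ψ : (ℤ → B) → ℤ → A),
      IsIsomorphism μ ν φ ψ ∧
      (∀ᵐ x ∂μ, hat b (φ x) = hat a x) ∧
      (∀ᵐ y ∂ν, hat a (ψ y) = hat b y) ∧
      ∃ r₁ r₂ r₃ r₄ : ℕ → ℕ,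
        (∀ n, 1 ≤ r₁ n ∧ 1 ≤ r₂ n ∧ 1 ≤ r₃ n ∧ 1 ≤ r₄ n) ∧
        SoftTheta (fun n => L (r₁ n)) (fun n => (n : ℝ)) ∧
        SoftTheta (fun n => L (r₂ n)) (fun n => (n : ℝ)) ∧
        SoftTheta (fun n => L (r₃ n)) (fun n => (n : ℝ)) ∧
        SoftTheta (fun n => L (r₄ n)) (fun n => (n : ℝ)) ∧
        SuperPoly (fun n => μ.real {x | ¬ Determines μ
          (classAt a ξ τ 𝒜.rel (r₁ n)) (fun x' => classAt b ξ τ ℬ.rel (r₂ n) (φ x')) x})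
          (fun n => (n : ℝ)) ∧
        SuperPoly (fun n => ν.real {y | ¬ Determines ν
          (classAt b ξ τ ℬ.rel (r₃ n)) (fun y' => classAt a ξ τ 𝒜.rel (r₄ n) (ψ y')) y})
          (fun n => (n : ℝ)) := by

  classical
  obtain ⟨kA, KA, -, ⟨NA, hupA⟩, hlowA⟩ := h𝒜
  obtain ⟨kB, KB, -, ⟨NB, hupB⟩, hlowB⟩ := hℬ
  obtain ⟨cX, hcX, hgX, hszX⟩ := hLX.sizes
  obtain ⟨cY, hcY, hgY, hszY⟩ := hLY.sizes
  have hh : condEntropyRate ν b = condEntropyRate μ a := by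
    rw [condEntropyRate, condEntropyRate, hent, hdist]
  -- Integer exponents: `k` makes the gauge smaller than both upper corrections, and `Kn` dominates
  -- both exponents of the lower bounds.
  obtain ⟨k, hk⟩ := exists_nat_ge (max (-kA) (-kB))
  obtain ⟨Kn, hKn⟩ := exists_nat_ge (max KA KB)
  have hξ' : IsMarkerFactor (ν.map (hat b)) ξ := hdist ▸ hξ
  have hsideX : ∀ (N : ℕ) {R : ℕ → ℕ}, Monotone R → (∀ j, 1 ≤ R j) →
      Side (μ.map (hat a)) ξ τ R μ a (code 𝒜.rel N) := fun N R h1 h2 =>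
    side_of_sof hX hξ hLX 𝒜 N h1 h2
  have hsideY : ∀ (N : ℕ) {R : ℕ → ℕ}, Monotone R → (∀ j, 1 ≤ R j) →
      Side (μ.map (hat a)) ξ τ R ν b (code ℬ.rel N) := fun N R h1 h2 => by
    rw [hdist]; exact side_of_sof hY hξ' hLY ℬ N h1 h2
  have hupA' : ∀ᵐ ω ∂(μ.map (hat a)), UpInfo μ a ξ τ 𝒜.rel kA NA ω := hupA
  have hupB' : ∀ᵐ ω ∂(μ.map (hat a)), UpInfo ν b ξ τ ℬ.rel kB NB ω := by
    rw [hdist]; exact hupB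
  have hmono : ∀ stp : ℕ, Monotone fun j => stp * j + 1 := fun stp i j hij => by
    dsimp only; gcongr
  have hone : ∀ stp j : ℕ, 1 ≤ stp * j + 1 := fun stp j => Nat.le_add_left _ _
  have hpos : 0 < condEntropyRate μ a := (hsideX NA (hmono 1) (hone 1)).entropy_pos (tendsto_ranks one_pos) hupA'
  -- The bound `1 / 2` puts twice the gauge below `Λ_{k,1/2}`; the bound by the entropy gives `g s ≤
  -- h s`, so that the invariant of the counting is at least one.
  set ε := min (1 / 2) (condEntropyRate μ a)
  have hε : 0 < ε := lt_min (by norm_num) hpos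
  obtain ⟨c, hc, hgap⟩ := exists_gau_gap hε k
  obtain ⟨N, hN, hthr⟩ := exists_threshold hε hc k (max 3 (max NA NB))
  -- The step is so large that `stp` ranks separate the lengths by the power of the logarithm that
  -- `heavy_numeric` requires, for the size exponents of both processes.
  obtain ⟨stp, hstp⟩ := exists_nat_ge (max 1
    (max ((2 * cX + 2 * ((2 * k + 2 * Kn + 1 : ℕ) : ℝ)) / cX)
      ((2 * cY + 2 * ((2 * k + 2 * Kn + 1 : ℕ) : ℝ)) / cY)))
  simp only [max_le_iff] at hk hKn hstp hN
  obtain ⟨hstp1, hstpX, hstpY⟩ := hstp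
  have hs0 : 0 < stp := by exact_mod_cast hstp1
  rw [div_le_iff₀' hcX] at hstpX
  rw [div_le_iff₀' hcY] at hstpY
  have H := link_altChain (hsideX N (hmono stp) (hone stp)) (hsideY N (hmono stp) (hone stp))
  have C := H.cnt hupA' hupB' rfl hh (neg_le.1 hk.1) (neg_le.1 hk.2) hε.le (min_le_left _ _)
    (min_le_right _ _) hc hgap hthr hN.1 hN.2.1 hN.2.2
  obtain ⟨f, hf, hfle⟩ := H.exists_split_rate C hε hs0
    (K := KA) ⟨hLX.tendsto, hLX.soft_growth, hcX, hgX, hszX, hlowA⟩ hKn.1 hstpX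
  obtain ⟨f', hf', hfle'⟩ := H.symm.exists_split_rate C hε hs0
    (K := KB) ⟨hLY.tendsto, hLY.soft_growth, hcY, hgY, hszY, by rw [← hh]; exact hlowB⟩ hKn.2 hstpY
  have G := H.good hs0 hLX.tendsto hf (hfle.mono fun j hj hp =>
    (le_add_of_nonneg_right measureReal_nonneg).trans (hj hp))
  have G' := H.symm.good hs0 hLX.tendsto hf' (hfle'.mono fun j hj hp =>
    (le_add_of_nonneg_right measureReal_nonneg).trans (hj hp))
  -- The class of X is taken on an even level and that of its image one level lower; for the inverse
  -- the parities are exchanged.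
  obtain ⟨t, t1, t2, t3, t4, t5⟩ := exists_ranks hLX.tendsto hLX.soft_growth hcX hgX hs0 H.alt
  obtain ⟨u, u1, u2, u3, u4, u5⟩ := exists_ranks hLX.tendsto hLX.soft_growth hcX hgX hs0
    (p := fun j => ¬ Even j) H.symm.alt
  exact ⟨_, _, H.isIsomorphism G G', H.ae_hat_phi G, H.symm.ae_hat_phi G',
    fun n => stp * (t n + 1) + 1, fun n => stp * t n + 1, fun n => stp * (u n + 1) + 1,
    fun n => stp * u n + 1, fun n => ⟨hone _ _, hone _ _, hone _ _, hone _ _⟩, t4, t5, u4, u5,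
    H.superPoly_determines G hf hfle t1 t2 t3,
    H.symm.superPoly_determines G' hf' hfle' u1 u2 u3⟩
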